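/- Let $\mathbb{k}$ be an algebraically closed field (of any characteristic); a variety over $\mathbb{k}$ is an integral separated scheme of finite type over $\mathbb{k}$. Let $\gamma\ge 2$ be an integer and let $f\colon X\to B$ be a proper morphism over $\mathbb{k}$ of normal varieties over $\mathbb{k}$ whose generic fiber is a smooth, geometrically connected curve over the function field of $B$ (so $f$ has relative dimension $1$). Let $n=\dim X$ and let $1\le q\le n$. Suppose that there are a line bundle $\mathcal L$ on $X$ and an injective morphism of $\mathcal O_X$-modules $\mathcal L\hookrightarrow\Omega_X^{q}=\bigwedge^q\Omega_{X/\mathbb{k}}$, and that the sections of $\mathcal L$ separate $\gamma$ points on a nonempty open set $U\subset X$: for any $\gamma$ distinct closed points $x_1,\dots,x_\gamma\in U$ there is a section $s\in H^0(X,\mathcal L)$ that vanishes at $x_1,\dots,x_{\gamma-1}$ but not at $x_\gamma$. Then the general fiber of $f$ has gonality at least $\gamma+1$; that is, there is a nonempty open set $V\subset B$ such that for every closed point $b\in V$ the fiber $X_b$ is an integral curve over $\mathbb{k}$ and $\operatorname{gon}(X_b)\ge\gamma+1$. Here the gonality of an integral curve $C$ over $\mathbb{k}$ is the minimal degree of a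 nonconstant morphism $\widetilde C\to\mathbb{P}^1_{\mathbb{k}}$ over $\mathbb{k}$, where $\widetilde C$ is the normalization of $C$. -/

import Mathlib

open CategoryTheory AlgebraicGeometry Opposite

universe u v w

noncomputable section

/-! ### Exterior powers of presheaves of modules and the sheaves `Ω^q` -/

/-- The map `⋀^q M → ⋀^q N` induced by an additive map `f : M → N` that is semilinear with respect to
a homomorphism of commutative rings `φ : A → B`. It is `A`-linear for the `A`-module structure of
`⋀^q N` obtained by restriction of scalars along `φ`. -/
def exteriorPowerMapAlong {A B : CommRingCat.{u}} (φ : A ⟶ B) {M : ModuleCat.{u} A}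
    {N : ModuleCat.{u} B} (f : M ⟶ (ModuleCat.restrictScalars φ.hom).obj N) (q : ℕ) :
    M.exteriorPower q ⟶ (ModuleCat.restrictScalars φ.hom).obj (N.exteriorPower q) :=
  ModuleCat.exteriorPower.desc
    (N := (ModuleCat.restrictScalars φ.hom).obj (N.exteriorPower q))
    { toFun := fun m => ModuleCat.exteriorPower.mk (M := N) (fun i => f.hom (m i))
      map_update_add' := fun {_} m i x y => by
        have h (z : M) : (fun j => f.hom (Function.update m i z j)) =
            Function.update (fun j => (f.hom (m j) : N)) i (f.hom z) := by
          funext j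
          exact Function.apply_update (fun _ (w : M) => (f.hom w : N)) m i z j
        rw [h, h, h, map_add]
        exact (ModuleCat.exteriorPower.mk (M := N) (n := q)).map_update_add _ i _ _
      map_update_smul' := fun {_} m i c x => by
        have h (z : M) : (fun j => f.hom (Function.update m i z j)) =
            Function.update (fun j => (f.hom (m j) : N)) i (f.hom z) := by
          funext j
          exact Function.apply_update (fun _ (w : M) => (f.hom w : N)) m i z j
        rw [h, h, map_smul]
        exact (ModuleCat.exteriorPower.mk (M := N) (n := q)).map_update_smul _ i (φ.hom c) _
      map_eq_zero_of_eq' := fun m i j h hij =>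
        (ModuleCat.exteriorPower.mk (M := N) (n := q)).map_eq_zero_of_eq _
          (congrArg (fun w => (f.hom w : N)) h) hij }

lemma exteriorPowerMapAlong_mk {A B : CommRingCat.{u}} (φ : A ⟶ B) {M : ModuleCat.{u} A}
    {N : ModuleCat.{u} B} (f : M ⟶ (ModuleCat.restrictScalars φ.hom).obj N) {q : ℕ}
    (m : Fin q → M) :
    (exteriorPowerMapAlong φ f q).hom (ModuleCat.exteriorPower.mk m) =
      ModuleCat.exteriorPower.mk (M := N) (fun i => f.hom (m i)) :=
  ModuleCat.exteriorPower.desc_mk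
    (N := (ModuleCat.restrictScalars φ.hom).obj (N.exteriorPower q)) _ m

/-- The presheaf of modules `U ↦ ⋀^q M(U)` attached to a presheaf of modules `M` over a presheaf of
commutative rings. -/
def exteriorPowerPresheaf {D : Type w} [Category.{v} D] {R : Dᵒᵖ ⥤ CommRingCat.{u}}
    (M : PresheafOfModules.{u} (R ⋙ forget₂ CommRingCat RingCat)) (q : ℕ) :
    PresheafOfModules.{u} (R ⋙ forget₂ CommRingCat RingCat) where
  obj U := ModuleCat.exteriorPower (R := R.obj U) (M.obj U) q
  map {U V} i := exteriorPowerMapAlong (R.map i) (M := M.obj U) (N := M.obj V) (M.map i) q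
  map_id U := by
    apply ModuleCat.exteriorPower.hom_ext (R := R.obj U)
    apply ModuleCat.AlternatingMap.ext
    intro x
    refine (exteriorPowerMapAlong_mk (R.map (𝟙 U)) (M := M.obj U) (N := M.obj U)
      (M.map (𝟙 U)) x).trans ?_
    refine congrArg (ModuleCat.exteriorPower.mk (R := R.obj U) (M := M.obj U)) ?_
    funext i
    rw [M.map_id]
    rfl
  map_comp {U V W} i j := by
    apply ModuleCat.exteriorPower.hom_ext (R := R.obj U)
    apply ModuleCat.AlternatingMap.ext
    intro x
    refine (exteriorPowerMapAlong_mk (R.map (i ≫ j)) (M := M.obj U) (N := M.obj W)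
      (M.map (i ≫ j)) x).trans ?_
    have h : (exteriorPowerMapAlong (R.map j) (M := M.obj V) (N := M.obj W) (M.map j) q).hom
        ((exteriorPowerMapAlong (R.map i) (M := M.obj U) (N := M.obj V) (M.map i) q).hom
          (ModuleCat.exteriorPower.mk (R := R.obj U) (M := M.obj U) x)) =
        ModuleCat.exteriorPower.mk (R := R.obj W) (M := M.obj W)
          (fun l => (M.map j).hom ((M.map i).hom (x l))) := by
      refine (congrArg _ (exteriorPowerMapAlong_mk (R.map i) (M := M.obj U) (N := M.obj V)
        (M.map i) x)).trans ?_
      exact exteriorPowerMapAlong_mk (R.map j) (M := M.obj V) (N := M.obj W) (M.map j) _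
    refine Eq.trans ?_ h.symm
    refine congrArg (ModuleCat.exteriorPower.mk (R := R.obj W) (M := M.obj W)) ?_
    funext l
    exact M.map_comp_apply i j (x l)

/-- The ring homomorphisms `𝕜 → Γ(X, U)` of a scheme `X` over `𝕜`, as a morphism out of the
constant presheaf. -/
def structurePresheafHom {𝕜 : Type u} [Field 𝕜] {X : Scheme.{u}} (p : X ⟶ Spec (.of 𝕜)) :
    (Functor.const (TopologicalSpace.Opens X)ᵒᵖ).obj (CommRingCat.of 𝕜) ⟶ X.presheaf where
  app U := (Scheme.ΓSpecIso (.of 𝕜)).inv ≫ p.appTop ≫ X.presheaf.map (homOfLE le_top).op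
  naturality U V i := by
    simp only [Functor.const_obj_map, Category.assoc, ← Functor.map_comp]
    rfl

/-- The sheaf `Ω^q_{X/𝕜} = ⋀^q Ω_{X/𝕜}` of `q`-forms of a scheme `p : X ⟶ Spec 𝕜`: the sheaf of
`𝒪_X`-modules associated with the presheaf `U ↦ ⋀^q Ω_{Γ(X, U)/𝕜}` of exterior powers of modules of
Kähler differentials. -/
def sheafOfForms {𝕜 : Type u} [Field 𝕜] {X : Scheme.{u}} (p : X ⟶ Spec (.of 𝕜)) (q : ℕ) :
    X.Modules :=
  (PresheafOfModules.sheafification (𝟙 X.ringCatSheaf.obj)).obj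
    (exteriorPowerPresheaf (PresheafOfModules.DifferentialsConstruction.relativeDifferentials'
      (structurePresheafHom p)) q)

/-! ### Line bundles and separation of points -/

/-- `L` is a line bundle: an `𝒪_X`-module that is locally isomorphic to `𝒪_X`. -/
def IsLineBundle {X : Scheme.{u}} (L : X.Modules) : Prop :=
  ∀ x : X, ∃ U : X.Opens, x ∈ U ∧
    Nonempty (L.restrict U.ι ≅ (SheafOfModules.unit U.toScheme.ringCatSheaf : U.toScheme.Modules))

/-- The stalk of an `𝒪_X`-module is a module over the local ring. -/
instance stalkModule {X : Scheme.{u}} (L : X.Modules) (x : X) :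
    Module (X.presheaf.stalk x) ↑(TopCat.Presheaf.stalk L.presheaf x) :=
  PresheafOfModules.instModuleCarrierStalkCommRingCatCarrierAbPresheafOpensCarrier
    (R := X.presheaf) L.val x

/-- The global section `s` of `L` vanishes at `x`: its value in the fibre `L_x / 𝔪_x L_x` is zero,
that is, its germ lies in `𝔪_x L_x`. -/
def VanishesAt {X : Scheme.{u}} (L : X.Modules) (s : Γ(L, ⊤)) (x : X) : Prop :=
  L.presheaf.germ ⊤ x trivial s ∈
    IsLocalRing.maximalIdeal (X.presheaf.stalk x) •
      (⊤ : Submodule (X.presheaf.stalk x) ↑(TopCat.Presheaf.stalk L.presheaf x))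

/-- Sections of `L` separate `γ` points on `U`: for any `γ` distinct closed points
`x_0, …, x_{γ-1}` in `U` some global section vanishes at all of them but the last one. -/
def SeparatesPointsOn {X : Scheme.{u}} (L : X.Modules) (γ : ℕ) (U : X.Opens) : Prop :=
  ∀ x : Fin γ → X, Function.Injective x → (∀ i, x i ∈ U ∧ IsClosed {x i}) →
    ∃ s : Γ(L, ⊤), ∀ i : Fin γ,
      ((i : ℕ) + 1 < γ → VanishesAt L s (x i)) ∧ ((i : ℕ) + 1 = γ → ¬ VanishesAt L s (x i))

/-! ### Normal schemes, integral curves and gonality -/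

/-- A scheme is normal if its local rings are integrally closed domains. -/
def IsNormalScheme (X : Scheme.{u}) : Prop :=
  ∀ x : X, IsDomain (X.presheaf.stalk x) ∧ IsIntegrallyClosed (X.presheaf.stalk x)

/-- `p : C ⟶ Spec 𝕜` is an integral curve over `𝕜`: an integral separated scheme of finite type and
of dimension one. -/
structure IsIntegralAlgebraicCurve {𝕜 : Type u} [Field 𝕜] {C : Scheme.{u}} (p : C ⟶ Spec (.of 𝕜)) :
    Prop where
  isIntegral : IsIntegral C
  isSeparated : IsSeparated p
  locallyOfFiniteType : LocallyOfFiniteType p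
  quasiCompact : QuasiCompact p
  dim_eq_one : topologicalKrullDim C = 1

/-- The projective line `Proj 𝕜[T₀, T₁]`. -/
def projectiveLine (𝕜 : Type u) [Field 𝕜] : Scheme.{u} :=
  letI := MvPolynomial.gradedAlgebra (σ := Fin 2) (R := 𝕜)
  Proj (MvPolynomial.homogeneousSubmodule (Fin 2) 𝕜)

/-- The structure morphism of the projective line. -/
def projectiveLineToSpec (𝕜 : Type u) [Field 𝕜] : projectiveLine 𝕜 ⟶ Spec (.of 𝕜) :=
  letI := MvPolynomial.gradedAlgebra (σ := Fin 2) (R := 𝕜)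
  Proj.toSpecZero (MvPolynomial.homogeneousSubmodule (Fin 2) 𝕜) ≫
    Spec.map (CommRingCat.ofHom
      (algebraMap 𝕜 (MvPolynomial.homogeneousSubmodule (Fin 2) 𝕜 0)))

/-- The normalization `C̃` of an integral scheme `C`, that is, its relative normalization in the
spectrum of its function field. -/
def normalizationOf (C : Scheme.{u}) [IsIntegral C] : Scheme.{u} :=
  (C.fromSpecStalk (genericPoint C)).normalization

/-- The normalization morphism `C̃ ⟶ C`. -/
def normalizationOfHom (C : Scheme.{u}) [IsIntegral C] : normalizationOf C ⟶ C :=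
  (C.fromSpecStalk (genericPoint C)).fromNormalization

instance (C : Scheme.{u}) [IsIntegral C] : IsIntegral (normalizationOf C) :=
  inferInstanceAs (IsIntegral (C.fromSpecStalk (genericPoint C)).normalization)

/-- The degree of a dominant morphism `g : X ⟶ Y` of integral schemes: the degree of the extension
of function fields `𝐤(Y) → 𝐤(X)` (`⊤` if it is infinite). As `g` is dominant, it sends the generic
point of `X` to the generic point of `Y`, so that the local ring of `Y` below is `𝐤(Y)`. -/
def dominantDegree {X Y : Scheme.{u}} [IsIntegral X] (g : X ⟶ Y) : ℕ∞ :=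
  letI := (g.stalkMap (genericPoint X)).hom.toAlgebra
  Cardinal.toENat
    (Module.rank (Y.presheaf.stalk (g (genericPoint X))) (X.presheaf.stalk (genericPoint X)))

/-- The gonality of an integral curve `p : C ⟶ Spec 𝕜`: the minimal degree of a nonconstant
(equivalently, dominant) morphism over `𝕜` from the normalization of `C` to the projective line. -/
def gonality {𝕜 : Type u} [Field 𝕜] {C : Scheme.{u}} (p : C ⟶ Spec (.of 𝕜))
    (hC : IsIntegralAlgebraicCurve p) : ℕ∞ :=
  haveI := hC.isIntegral
  ⨅ (φ : normalizationOf C ⟶ projectiveLine 𝕜)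
    (_ : φ ≫ projectiveLineToSpec 𝕜 = normalizationOfHom C ≫ p) (_ : IsDominant φ),
    dominantDegree φ

end

/-! Suppose that a general fibre `C` has a map to the projective line of degree `d ≤ γ`. Restricted
to `C` and multiplied by one common function, the sections of `L` become either regular functions on
`C` or regular differential forms on `C`. Regular functions on a proper curve are constant, and
constants do not separate two points, so `γ ≥ 2` excludes the first case. In the second case, the
trace of a regular form to the projective line is a regular form there, hence zero. Over a general
point with preimages `p₁, …, p_d` this is a linear relation, with nonzero coefficients, between the
values of the form at the `pᵢ`. So a form that vanishes at `d - 1` of these points vanishes at the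
last one too. Filling up the `pᵢ` to `γ` points contradicts the separation hypothesis.

In characteristic `p` two difficulties arise. The trace is zero for inseparable maps; but a function
with zero differential is a `p`-th power, so extracting roots yields a separable map of no larger
degree (`exists_isSeparable_adjoin_finrank_le`). Ramification can be wild; but over a discrete
valuation ring with algebraically closed residue field the integral closure is generated by one
element `θ`, the different is generated by `P'(θ)` for the minimal polynomial `P`, and `P'(θ) db` is
integral for integral `b`, so traces of regular forms are regular
(`exists_trace_mul_derivation_eq_algebraMap`). The linear relation is Euler's formula for the trace
of `Q(θ) / P'(θ)` (`exists_points_of_trace_eq_zero`). The argument on the curve is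
`false_of_separates_of_finrank_le`, where regularity is tested on all valuation rings containing the
constants.

To pass from `q`-forms on `X` to the fibres, write the sections of `L` as multiples `g ω` of one
form `ω` over the function field and evaluate `ω` on `q` derivations preserving the functions of the
base. If some tuple containing a vertical derivation `V` gives a nonzero value `h`, then `g h` is
the coefficient of a regular relative 1-form. If all such tuples give zero, some other tuple gives a
nonzero `h`, and `g h` is regular (`exists_coordinate_function`). Both statements are read off in
charts étale over the affine line over the base, and `exists_vertical_restriction` carries them to
the function field of a fibre.

The generic fibre, being smooth and geometrically connected, is geometrically integral. A
Bertini–Noether argument, based on the irreducibility of one polynomial under specialization, makes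
the fibres of each chart integral curves over a nonempty open set
(`exists_ne_zero_forall_isPrime_map`). By properness finitely many charts cover the general fibres.
Finally `lt_gonality` translates the bound on degrees of function field extensions into gonality. -/

noncomputable section

/-! ### Monogenic extensions of discrete valuation rings -/

section Monogenic

open IsLocalRing Polynomial

variable {k O C : Type*} [Field k] [IsAlgClosed k] [CommRing O] [IsDomain O]
  [IsDiscreteValuationRing O] [CommRing C] [Algebra k O]
  [Algebra O C] [Algebra k C] [IsScalarTower k O C] [Module.Finite O C]

/-- The residue field at `m` is integral over that of `O`, which by `hres` consists of constants; as
`k` is algebraically closed, it is `k` again. -/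
lemma exists_sub_algebraMap_mem_of_isMaximal
    (hres : ∀ z : O, ∃ c : k, z - algebraMap k O c ∈ maximalIdeal O)
    (m : Ideal C) [m.IsMaximal] (z : C) : ∃ c : k, z - algebraMap k C c ∈ m := by
  have : IsDomain (C ⧸ m) := inferInstance
  have hm : m.comap (algebraMap O C) = maximalIdeal O :=
    eq_maximalIdeal (Ideal.isMaximal_comap_of_isIntegral_of_isMaximal m)
  have hint : Algebra.IsIntegral k (C ⧸ m) := by
    refine ⟨fun y => ?_⟩
    obtain ⟨p, hp, hpy⟩ : IsIntegral O y := Algebra.IsIntegral.isIntegral y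
    have hl : p.map (algebraMap O (C ⧸ m)) ∈ lifts (algebraMap k (C ⧸ m)) := by
      rw [lifts_iff_coeff_lifts]
      intro n
      obtain ⟨c, hc⟩ := hres (p.coeff n)
      refine ⟨c, ?_⟩
      rw [← hm, Ideal.mem_comap, map_sub, ← IsScalarTower.algebraMap_apply] at hc
      rw [coeff_map, IsScalarTower.algebraMap_apply k C, IsScalarTower.algebraMap_apply O C]
      exact ((Ideal.Quotient.eq).2 hc).symm
    obtain ⟨r, hr, -, hrm⟩ := lifts_and_natDegree_eq_and_monic hl (hp.map _)
    refine ⟨r, hrm, ?_⟩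
    rw [← Polynomial.eval_map, hr, Polynomial.eval_map, hpy]
  obtain ⟨c, hc⟩ := (IsAlgClosed.algebraMap_bijective_of_isIntegral (k := k) (K := C ⧸ m)).2
    (Ideal.Quotient.mk m z)
  refine ⟨c, ?_⟩
  rw [← Ideal.Quotient.eq, ← hc]
  rfl

/-- No residue field grows, so even wild ramification does not obstruct a single generator. It
suffices that `θ` takes distinct constant values at the finitely many maximal ideals and that `θ`
minus its value is a uniformizer at each. Every element is then a polynomial in `θ` modulo any power
of the product of these uniformizers, and Nakayama's lemma concludes. -/
theorem exists_adjoin_eq_top_of_isDedekindDomain [IsDedekindDomain C] [FaithfulSMul O C]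
    (hres : ∀ z : O, ∃ c : k, z - algebraMap k O c ∈ maximalIdeal O) :
    ∃ θ : C, Algebra.adjoin O {θ} = ⊤ := by
  classical
  have hnf : ¬ IsField C := by
    intro h
    exact IsDiscreteValuationRing.not_isField O
      (isField_of_isIntegral_of_isField (FaithfulSMul.algebraMap_injective O C) h)
  set I : Ideal C := (maximalIdeal O).map (algebraMap O C) with hI
  have hIne : I ≠ ⊥ := by
    rw [hI, Ne, Ideal.map_eq_bot_iff_of_injective (FaithfulSMul.algebraMap_injective O C)]
    exact IsDiscreteValuationRing.not_a_field O
  have hIm (m : Ideal C) [m.IsMaximal] : I ≤ m := by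
    rw [hI, Ideal.map_le_iff_le_comap]
    exact (eq_maximalIdeal (Ideal.isMaximal_comap_of_isIntegral_of_isMaximal m)).ge
  have hfin : Finite (MaximalSpectrum C) := by
    have h1 : ((maximalIdeal O).primesOver C).Finite :=
      IsDedekindDomain.primesOver_finite (maximalIdeal O) C
    have : Finite ((maximalIdeal O).primesOver C) := h1
    refine Finite.of_injective (β := (maximalIdeal O).primesOver C)
      (fun m => ⟨m.asIdeal, m.isMaximal.isPrime, ⟨?_⟩⟩) ?_
    · have := m.isMaximal
      exact (eq_maximalIdeal (Ideal.isMaximal_comap_of_isIntegral_of_isMaximal m.asIdeal)).symm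
    · intro m m' h
      exact MaximalSpectrum.ext (congrArg Subtype.val h)
  have := Fintype.ofFinite (MaximalSpectrum C)
  have : Infinite k := IsAlgClosed.instInfinite
  obtain ⟨c⟩ : Nonempty (MaximalSpectrum C ↪ k) :=
    ⟨(Finite.equivFin _).toEmbedding.trans (Fin.valEmbedding.trans (Infinite.natEmbedding k))⟩
  have hpi (m : MaximalSpectrum C) : ∃ t ∈ m.asIdeal, t ∉ m.asIdeal ^ 2 := by
    have := m.isMaximal
    have hne : m.asIdeal ≠ ⊥ := Ring.ne_bot_of_isMaximal_of_not_isField m.isMaximal hnf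
    obtain ⟨t, h1, h2⟩ := Ideal.exists_mem_pow_notMem_pow_succ m.asIdeal hne m.isMaximal.ne_top 1
    exact ⟨t, by simpa using h1, h2⟩
  choose t ht ht' using hpi
  have hcop : Pairwise (Function.onFun IsCoprime
      (fun m : MaximalSpectrum C => m.asIdeal ^ 2)) := by
    intro m m' h
    refine IsCoprime.pow ?_
    rw [Ideal.isCoprime_iff_sup_eq]
    exact m.isMaximal.coprime_of_ne m'.isMaximal (fun h' => h (MaximalSpectrum.ext h'))
  -- Congruences modulo the squares control both the value of `θ` and the order of vanishing of `θ`
  -- minus its value.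
  obtain ⟨θ, hθ⟩ := Ideal.exists_forall_sub_mem_ideal hcop
    (fun m => algebraMap k C (c m) + t m)
  have hmem (m : MaximalSpectrum C) : θ - algebraMap k C (c m) ∈ m.asIdeal := by
    have h1 := Ideal.pow_le_self two_ne_zero (hθ m)
    have := m.asIdeal.add_mem h1 (ht m)
    convert this using 1
    ring
  have hnmem (m : MaximalSpectrum C) : θ - algebraMap k C (c m) ∉ m.asIdeal ^ 2 := by
    intro h
    refine ht' m ?_
    have := (m.asIdeal ^ 2).sub_mem h (hθ m)
    convert this using 1
    ring
  have hnmem' (m m' : MaximalSpectrum C) (hmm : m ≠ m') :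
      θ - algebraMap k C (c m) ∉ m'.asIdeal := by
    intro h
    have h2 := m'.asIdeal.sub_mem h (hmem m')
    have h3 : algebraMap k C (c m' - c m) ∈ m'.asIdeal := by
      convert h2 using 1
      rw [map_sub]; ring
    have h4 : IsUnit (algebraMap k C (c m' - c m)) :=
      (IsUnit.mk0 _ (sub_ne_zero.2 (fun h => hmm (c.injective h).symm))).map _
    exact m'.isMaximal.ne_top (Ideal.eq_top_of_isUnit_mem _ h3 h4)
  -- This element lies in `m` but not in `m ^ 2`, and in no other maximal ideal, so `m` is its whole
  -- factorization.
  have hspan (m : MaximalSpectrum C) :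
      Ideal.span {θ - algebraMap k C (c m)} = m.asIdeal := by
    have h1 : m.asIdeal ∣ Ideal.span {θ - algebraMap k C (c m)} := by
      rw [Ideal.dvd_iff_le, Ideal.span_singleton_le_iff_mem]
      exact hmem m
    obtain ⟨J, hJ⟩ := h1
    have hJt : J = ⊤ := by
      by_contra hne
      obtain ⟨m', hm', hle⟩ := Ideal.exists_le_maximal J hne
      by_cases hmm : m.asIdeal = m'
      · apply hnmem m
        rw [← Ideal.span_singleton_le_iff_mem, hJ, pow_two]
        exact Ideal.mul_mono le_rfl (hmm ▸ hle)
      · apply hnmem' m ⟨m', hm'⟩ (fun h => hmm (congrArg MaximalSpectrum.asIdeal h))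
        change _ ∈ m'
        rw [← Ideal.span_singleton_le_iff_mem, hJ]
        exact le_trans Ideal.mul_le_right hle
    rw [hJ, hJt, Ideal.mul_top]
  set N := Algebra.adjoin O {θ} with hN
  have hθN : θ ∈ N := Algebra.subset_adjoin rfl
  have hkN (a : k) : algebraMap k C a ∈ N := by
    rw [IsScalarTower.algebraMap_apply k O C]
    exact N.algebraMap_mem _
  have hfac (m : MaximalSpectrum C) (b : C) :
      ∃ p ∈ N, ∃ b', b = p + (θ - algebraMap k C (c m)) * b' := by
    have := m.isMaximal
    obtain ⟨a, ha⟩ := exists_sub_algebraMap_mem_of_isMaximal hres m.asIdeal b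
    rw [← hspan m, Ideal.mem_span_singleton] at ha
    obtain ⟨b', hb'⟩ := ha
    exact ⟨_, hkN a, b', by rw [← hb']; ring⟩
  have hprod (s : Finset (MaximalSpectrum C)) (b : C) :
      ∃ p ∈ N, ∃ b', b = p + (∏ m ∈ s, (θ - algebraMap k C (c m))) * b' := by
    induction s using Finset.induction_on generalizing b with
    | empty => exact ⟨0, N.zero_mem, b, by simp⟩
    | insert m s hms ih =>
      obtain ⟨p, hp, b', rfl⟩ := hfac m b
      obtain ⟨p', hp', b'', rfl⟩ := ih b'
      refine ⟨p + (θ - algebraMap k C (c m)) * p',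
        N.add_mem hp (N.mul_mem (N.sub_mem hθN (hkN _)) hp'), b'', ?_⟩
      rw [Finset.prod_insert hms]; ring
  set J := ∏ m, (θ - algebraMap k C (c m)) with hJ
  have hJN : J ∈ N := N.prod_mem fun m _ => N.sub_mem hθN (hkN _)
  have hpow (n : ℕ) (b : C) : ∃ p ∈ N, ∃ b', b = p + J ^ n * b' := by
    induction n generalizing b with
    | zero => exact ⟨0, N.zero_mem, b, by simp⟩
    | succ n ih =>
      obtain ⟨p, hp, b', rfl⟩ := ih b
      obtain ⟨p', hp', b'', rfl⟩ := hprod Finset.univ b'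
      exact ⟨p + J ^ n * p', N.add_mem hp (N.mul_mem (N.pow_mem hJN n) hp'), b'', by
        rw [← hJ]; ring⟩
  have hrad : J ∈ I.radical := by
    rw [Ideal.radical_eq_sInf, Ideal.mem_sInf]
    rintro P ⟨hIP, hP⟩
    have hPm : P.IsMaximal := hP.isMaximal (fun h => hIne (le_bot_iff.1 (h ▸ hIP)))
    rw [hJ]
    exact Ideal.mem_of_dvd _ (Finset.dvd_prod_of_mem _ (Finset.mem_univ ⟨P, hPm⟩)) (hmem ⟨P, hPm⟩)
  obtain ⟨n, hn⟩ := hrad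
  refine ⟨θ, ?_⟩
  rw [← Algebra.toSubmodule_eq_top, eq_top_iff]
  -- Nakayama's lemma over `O`: a power of `J` lies in the extension of the maximal ideal of `O`, so
  -- `N` generates `C` modulo that ideal.
  refine Submodule.le_of_le_smul_of_le_jacobson_bot (I := maximalIdeal O)
    (Module.finite_def.1 inferInstance) (IsLocalRing.jacobson_eq_maximalIdeal _ bot_ne_top).ge ?_
  rintro b -
  obtain ⟨p, hp, b', rfl⟩ := hpow n b
  refine Submodule.add_mem_sup hp ?_
  rw [Ideal.smul_top_eq_map]
  exact Ideal.mul_mem_right _ _ hn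

end Monogenic

/-! ### Traces of differential forms over a discrete valuation ring -/

section TraceOfDerivation

open IsLocalRing Polynomial

variable {k O E K : Type*} [Field k] [IsAlgClosed k] [CommRing O] [IsDomain O]
  [IsDiscreteValuationRing O] [Algebra k O] [Field E] [Field K] [Algebra O E] [IsFractionRing O E]
  [Algebra E K] [Algebra O K] [IsScalarTower O E K] [Algebra k K] [IsScalarTower k O K]
  [FiniteDimensional E K] [Algebra.IsSeparable E K]

/-- The trace of a regular differential form `a db` is regular, over a discrete valuation ring
with algebraically closed residue field. -/
theorem exists_trace_mul_derivation_eq_algebraMap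
    (hres : ∀ z : O, ∃ c : k, z - algebraMap k O c ∈ maximalIdeal O) (D : Derivation k K K)
    (hD : ∀ z : O, ∃ y : O, D (algebraMap O K z) = algebraMap O K y) {a b : K}
    (ha : IsIntegral O a) (hb : IsIntegral O b) :
    ∃ c : O, Algebra.trace E K (a * D b) = algebraMap O E c := by
  let C := integralClosure O K
  have : IsDedekindDomain C := integralClosure.isDedekindDomain O E K
  have : Module.Finite O C := IsIntegralClosure.finite O E K C
  have : IsFractionRing C K := integralClosure.isFractionRing_of_finite_extension E K
  have hinjOK : Function.Injective (algebraMap O K) := by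
    rw [IsScalarTower.algebraMap_eq O E K]
    exact (algebraMap E K).injective.comp (IsFractionRing.injective O E)
  have : FaithfulSMul O C := by
    rw [faithfulSMul_iff_algebraMap_injective]
    intro x y h
    exact hinjOK (congrArg Subtype.val h)
  obtain ⟨θ, hθ⟩ := exists_adjoin_eq_top_of_isDedekindDomain (k := k) (C := C) hres
  -- Since `D` preserves `O`, differentiating the coefficients of `Q` contributes only an integral
  -- term.
  have hDQ (Q : O[X]) : ∃ z : C, D (aeval (θ : K) Q) =
      aeval (θ : K) (derivative Q) * D (θ : K) + z := by
    induction Q using Polynomial.induction_on' with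
    | add p q hp hq =>
      obtain ⟨z, hz⟩ := hp
      obtain ⟨z', hz'⟩ := hq
      refine ⟨z + z', ?_⟩
      rw [map_add, map_add, hz, hz', derivative_add, map_add]
      push_cast
      ring
    | monomial n o =>
      obtain ⟨y, hy⟩ := hD o
      refine ⟨algebraMap O C y * θ ^ n, ?_⟩
      rw [aeval_monomial, D.leibniz, D.leibniz_pow, hy, derivative_monomial, aeval_monomial,
        map_mul, map_natCast]
      push_cast
      have h1 : ((algebraMap O C y : C) : K) = algebraMap O K y := rfl
      have h2 : ((algebraMap O C y : C) : K) * (θ : K) ^ n = algebraMap O K y * (θ : K) ^ n := by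
        rw [h1]
      simp only [smul_eq_mul, nsmul_eq_mul]
      refine Eq.trans ?_ (congrArg _ h2.symm)
      ring
  have hθint : IsIntegral O (θ : K) := θ.2
  set P' := aeval (θ : K) (derivative (minpoly O (θ : K))) with hP'
  have hrep (b : C) : ∃ Q : O[X], aeval (θ : K) Q = b := by
    have : b ∈ Algebra.adjoin O {θ} := hθ ▸ Algebra.mem_top
    rw [Algebra.adjoin_singleton_eq_range_aeval] at this
    obtain ⟨Q, hQ⟩ := this
    refine ⟨Q, ?_⟩
    rw [← hQ]
    exact aeval_algebraMap_apply K θ Q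
  -- For `Q` the minimal polynomial, `hDQ` says that `P' * D θ` is integral; a general `b` is a
  -- polynomial in `θ`.
  have hDb (b : C) : ∃ z : C, P' * D b = z := by
    obtain ⟨Q, hQ⟩ := hrep b
    obtain ⟨z, hz⟩ := hDQ Q
    obtain ⟨z', hz'⟩ := hDQ (minpoly O (θ : K))
    rw [minpoly.aeval, map_zero, ← hP'] at hz'
    obtain ⟨q', hq'⟩ : ∃ q' : C, aeval (θ : K) (derivative Q) = q' :=
      ⟨aeval θ (derivative Q), aeval_algebraMap_apply K θ _⟩
    refine ⟨aeval θ (derivative (minpoly O (θ : K))) * z - q' * z', ?_⟩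
    have h3 : ((aeval θ (derivative (minpoly O (θ : K))) : C) : K) = P' :=
      (aeval_algebraMap_apply K θ _).symm
    rw [Subalgebra.coe_sub, Subalgebra.coe_mul, Subalgebra.coe_mul, h3, ← hQ, hz, hq']
    linear_combination (-(q' : K)) * hz'
  have hgen : IntermediateField.adjoin E {(θ : K)} = ⊤ := by
    rw [eq_top_iff]
    rintro y -
    obtain ⟨r, s, hs, rfl⟩ := IsFractionRing.div_surjective (A := C) y
    have hin (b : C) : (b : K) ∈ IntermediateField.adjoin E {(θ : K)} := by
      obtain ⟨Q, hQ⟩ := hrep b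
      rw [← hQ, aeval_eq_sum_range]
      refine sum_mem fun i _ => ?_
      rw [Algebra.smul_def, IsScalarTower.algebraMap_apply O E K]
      exact mul_mem (IntermediateField.algebraMap_mem _ _)
        (pow_mem (IntermediateField.mem_adjoin_simple_self E _) i)
    exact div_mem (hin r) (hin s)
  have hgen' : Algebra.adjoin E {algebraMap C K θ} = ⊤ := by
    have h1 := IntermediateField.adjoin_simple_toSubalgebra_of_isAlgebraic
      (Algebra.IsAlgebraic.isAlgebraic (R := E) (θ : K))
    rw [hgen] at h1
    exact h1.symm
  -- As `θ` generates `C` over `O`, the conductor is trivial and `P'` generates the different. So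
  -- `P' * D b ∈ C` places `a * D b` in the trace dual of `C`.
  have hdiff := conductor_mul_differentIdeal O E K θ hgen'
  rw [conductor_eq_top_of_adjoin_eq_top hθ, ← Ideal.one_eq_top, one_mul] at hdiff
  have hmin : minpoly O θ = minpoly O (θ : K) :=
    (minpoly.algebraMap_eq (B := C) (B' := K) Subtype.val_injective θ).symm
  set p : C := aeval θ (derivative (minpoly O θ)) with hp
  have hpP : (p : K) = P' := by
    rw [hp, hmin]
    exact (aeval_algebraMap_apply K θ _).symm
  have hp0 : P' ≠ 0 := by
    intro h0
    have h1 : differentIdeal O C = ⊥ := by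
      rw [hdiff, Ideal.span_singleton_eq_bot]
      exact Subtype.ext (hpP.trans h0)
    have h2 := coeIdeal_differentIdeal O E K C
    rw [h1, FractionalIdeal.coeIdeal_bot, eq_comm, inv_eq_zero,
      FractionalIdeal.dual_eq_zero_iff] at h2
    exact one_ne_zero h2
  obtain ⟨z, hz⟩ := hDb ⟨b, hb⟩
  have hmem : a * D b ∈ FractionalIdeal.dual O E (1 : FractionalIdeal (nonZeroDivisors C) K) := by
    have h2 := congrArg (·⁻¹) (coeIdeal_differentIdeal O E K C)
    simp only [inv_inv] at h2
    rw [← h2, hdiff, FractionalIdeal.coeIdeal_span_singleton, FractionalIdeal.spanSingleton_inv,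
      FractionalIdeal.mem_spanSingleton]
    refine ⟨⟨a, ha⟩ * z, ?_⟩
    rw [Algebra.smul_def]
    change a * (z : K) * (p : K)⁻¹ = _
    rw [hpP, ← hz]
    field_simp
  have h10 : (1 : FractionalIdeal (nonZeroDivisors C) K) ≠ 0 := one_ne_zero
  rw [FractionalIdeal.mem_dual h10] at hmem
  obtain ⟨c, hc⟩ := hmem 1 (FractionalIdeal.one_mem_one _)
  exact ⟨c, by rw [hc, Algebra.traceForm_apply, mul_one]⟩

end TraceOfDerivation

end

noncomputable section

/-! ### The local ring of the line at the origin and regularity of traces there -/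

section OriginLocalRing

open Polynomial

variable (k : Type*) [Field k]

instance isPrime_span_X : (Ideal.span {(X : k[X])}).IsPrime :=
  (Ideal.span_singleton_prime X_ne_zero).2 prime_X

/-- The local ring of the affine line at the origin. -/
abbrev OriginLocalRing := Localization.AtPrime (Ideal.span {(X : k[X])})

instance : IsDiscreteValuationRing (OriginLocalRing k) :=
  IsLocalization.AtPrime.isDiscreteValuationRing_of_dedekind_domain k[X]
    (by rw [Ne, Ideal.span_singleton_eq_bot]; exact X_ne_zero) _

variable {k}

lemma mem_primeCompl_span_X {p : k[X]} : p ∈ (Ideal.span {(X : k[X])}).primeCompl ↔ p.eval 0 ≠ 0 := by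
  rw [Ideal.mem_primeCompl_iff, Ideal.mem_span_singleton, X_dvd_iff, coeff_zero_eq_eval_zero]

lemma OriginLocalRing.exists_rep (z : OriginLocalRing k) :
    ∃ p q : k[X], ∃ hq : q.eval 0 ≠ 0,
      z = IsLocalization.mk' _ p (⟨q, mem_primeCompl_span_X.2 hq⟩ :
        (Ideal.span {(X : k[X])}).primeCompl) := by
  obtain ⟨p, ⟨q, hq⟩, h⟩ := IsLocalization.exists_mk'_eq (Ideal.span {(X : k[X])}).primeCompl z
  exact ⟨p, q, mem_primeCompl_span_X.1 hq, h.symm⟩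

/-- Evaluation at the origin. -/
def OriginLocalRing.eval : OriginLocalRing k →ₐ[k] k :=
  IsLocalization.liftAlgHom (M := (Ideal.span {(X : k[X])}).primeCompl) (f := aeval (0 : k))
    (fun p => by
      rw [coe_aeval_eq_eval]
      exact IsUnit.mk0 _ (mem_primeCompl_span_X.1 p.2))

lemma OriginLocalRing.mem_maximalIdeal {z : OriginLocalRing k} :
    z ∈ IsLocalRing.maximalIdeal (OriginLocalRing k) ↔ OriginLocalRing.eval z = 0 := by
  have hs : Function.Surjective (OriginLocalRing.eval (k := k)) := fun c =>
    ⟨algebraMap k _ c, by rw [AlgHom.commutes]; rfl⟩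
  have h := IsLocalRing.eq_maximalIdeal
    (RingHom.ker_isMaximal_of_surjective (OriginLocalRing.eval (k := k)).toRingHom hs)
  rw [← h]
  rfl

variable {E : Type*} [Field E] [Algebra k E] (y : E) (hy : Transcendental k y)

lemma aeval_ne_zero_of_transcendental {y : E} (hy : Transcendental k y) {p : k[X]} (hp : p ≠ 0) :
    aeval y p ≠ 0 := fun h => hp ((transcendental_iff.1 hy) p h)

/-- The embedding of the local ring of the affine line at the origin in an extension of `k`
given by a transcendental element. -/
def originLift : OriginLocalRing k →ₐ[k] E :=
  IsLocalization.liftAlgHom (M := (Ideal.span {(X : k[X])}).primeCompl) (f := aeval y)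
    (fun p => IsUnit.mk0 _ (aeval_ne_zero_of_transcendental hy (fun h => by
      have := mem_primeCompl_span_X.1 p.2
      rw [h, eval_zero] at this
      exact this rfl)))

lemma originLift_algebraMap (p : k[X]) :
    originLift y hy (algebraMap k[X] (OriginLocalRing k) p) = aeval y p := by
  rw [originLift, IsLocalization.liftAlgHom_apply, IsLocalization.lift_eq]
  rfl

lemma originLift_mk' (p q : k[X]) (hq : q.eval 0 ≠ 0) :
    originLift y hy (IsLocalization.mk' _ p (⟨q, mem_primeCompl_span_X.2 hq⟩ :
        (Ideal.span {(X : k[X])}).primeCompl)) = aeval y p / aeval y q := by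
  have hq0 : aeval y q ≠ 0 := aeval_ne_zero_of_transcendental hy (by rintro rfl; exact hq Polynomial.eval_zero)
  rw [eq_div_iff hq0, ← originLift_algebraMap y hy q, ← originLift_algebraMap y hy p, ← map_mul]
  congr 1
  exact IsLocalization.mk'_spec _ p (⟨q, mem_primeCompl_span_X.2 hq⟩ :
        (Ideal.span {(X : k[X])}).primeCompl)

lemma mem_range_originLift {z : E} :
    z ∈ (originLift y hy).range ↔
      ∃ p q : k[X], q.eval 0 ≠ 0 ∧ z = aeval y p / aeval y q := by
  constructor
  · rintro ⟨c, rfl⟩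
    obtain ⟨p, q, hq, rfl⟩ := c.exists_rep
    exact ⟨p, q, hq, originLift_mk' y hy p q hq⟩
  · rintro ⟨p, q, hq, rfl⟩
    exact ⟨_, originLift_mk' y hy p q hq⟩

lemma originLift_injective : Function.Injective (originLift y hy) := by
  rw [injective_iff_map_eq_zero]
  intro z hz
  obtain ⟨p, q, hq, rfl⟩ := z.exists_rep
  rw [originLift_mk' y hy p q hq, div_eq_zero_iff] at hz
  have hq0 : aeval y q ≠ 0 := aeval_ne_zero_of_transcendental hy (by rintro rfl; exact hq Polynomial.eval_zero)
  have hp : p = 0 := by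
    by_contra h
    exact aeval_ne_zero_of_transcendental hy h (hz.resolve_right hq0)
  rw [hp, IsLocalization.mk'_zero]

lemma isFractionRing_originLift (hgen : IntermediateField.adjoin k {y} = ⊤) :
    let := (originLift y hy).toRingHom.toAlgebra
    IsFractionRing (OriginLocalRing k) E := by
  let := (originLift y hy).toRingHom.toAlgebra
  have hinj : Function.Injective (algebraMap (OriginLocalRing k) E) := originLift_injective y hy
  have : FaithfulSMul (OriginLocalRing k) E := (faithfulSMul_iff_algebraMap_injective _ _).2 hinj
  refine IsFractionRing.of_field _ _ fun z => ?_
  have hz : z ∈ IntermediateField.adjoin k {y} := hgen ▸ IntermediateField.mem_top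
  obtain ⟨r, s, rfl⟩ := (IntermediateField.mem_adjoin_simple_iff k z).1 hz
  refine ⟨algebraMap _ _ r, algebraMap _ _ s, ?_⟩
  rw [← originLift_algebraMap y hy r, ← originLift_algebraMap y hy s]
  rfl

variable {K : Type*} [Field K] [Algebra k K] [Algebra E K] [IsScalarTower k E K]

/-- The trace of a differential form that is regular at every place is regular at the origin. -/
theorem trace_mem_range_originLift [IsAlgClosed k] [FiniteDimensional E K]
    [Algebra.IsSeparable E K]
    (hgen : IntermediateField.adjoin k {y} = ⊤) (D : Derivation k K K)
    (hDy : D (algebraMap E K y) = 1) (z : K)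
    (hz : ∀ v : ValuationSubring K, (∀ c : k, algebraMap k K c ∈ v) →
      z ∈ Submodule.span v (D '' v)) :
    Algebra.trace E K z ∈ (originLift y hy).range := by
  let alg1 := (originLift y hy).toRingHom.toAlgebra
  let alg2 := ((algebraMap E K).comp (originLift y hy).toRingHom).toAlgebra
  have : IsFractionRing (OriginLocalRing k) E := isFractionRing_originLift y hy hgen
  have t1 : IsScalarTower (OriginLocalRing k) E K := .of_algebraMap_eq fun _ => rfl
  have t2 : IsScalarTower k (OriginLocalRing k) K := .of_algebraMap_eq fun c => by
    change _ = algebraMap E K (originLift y hy (algebraMap k _ c))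
    rw [AlgHom.commutes, ← IsScalarTower.algebraMap_apply]
  have hres (z : OriginLocalRing k) :
      ∃ c : k, z - algebraMap k _ c ∈ IsLocalRing.maximalIdeal (OriginLocalRing k) := by
    refine ⟨OriginLocalRing.eval z, ?_⟩
    rw [OriginLocalRing.mem_maximalIdeal, map_sub, AlgHom.commutes]
    exact sub_self _
  have hDp (p : k[X]) : D (algebraMap E K (aeval y p)) = algebraMap E K (aeval y (derivative p)) := by
    rw [← aeval_algebraMap_apply, ← aeval_algebraMap_apply, D.map_aeval, hDy, smul_eq_mul, mul_one]
  have hD (z : OriginLocalRing k) : ∃ x : OriginLocalRing k,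
      D (algebraMap _ K z) = algebraMap _ K x := by
    obtain ⟨p, q, hq, rfl⟩ := z.exists_rep
    have hq0 : aeval y q ≠ 0 := aeval_ne_zero_of_transcendental hy (by rintro rfl; exact hq Polynomial.eval_zero)
    have h2 : (q ^ 2).eval 0 ≠ 0 := by
      simpa using hq
    refine ⟨_, Eq.trans ?_ (congrArg (algebraMap E K) (originLift_mk' y hy
      (derivative p * q - p * derivative q) _ h2)).symm⟩
    change D (algebraMap E K _) = _
    erw [originLift_mk' y hy p q hq]
    have hq0' : algebraMap E K (aeval y q) ≠ 0 := by simpa using hq0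
    rw [map_div₀, D.leibniz_div, hDp, hDp]
    simp only [map_sub, map_mul, map_pow, map_div₀, smul_eq_mul]
    field_simp
  let O := OriginLocalRing k
  let C := integralClosure O K
  have : IsDedekindDomain C := integralClosure.isDedekindDomain O E K
  have : Module.Finite O C := IsIntegralClosure.finite O E K C
  have : IsFractionRing C K := integralClosure.isFractionRing_of_finite_extension E K
  have hnf : ¬ IsField C := by
    intro h
    have hinj : Function.Injective (algebraMap O C) := by
      intro a b h
      have h' := congrArg Subtype.val h
      exact originLift_injective y hy ((algebraMap E K).injective h')
    exact IsDiscreteValuationRing.not_isField O (isField_of_isIntegral_of_isField (R := O) (S := C) hinj h)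
  have hkC (c : k) : ∃ c' : C, (c' : K) = algebraMap k K c :=
    ⟨algebraMap O C (algebraMap k O c), (IsScalarTower.algebraMap_apply k O K c).symm⟩
  let S : Submodule C K := Submodule.span C (D '' (C : Set K))
  -- The valuation ring of `m` contains the constants, so `hz` applies to it. Its elements are
  -- fractions with denominators outside `m`, and the quotient rule clears the denominators under
  -- `D`.
  have key : ∀ m : Ideal C, m.IsMaximal → ∃ s : C, s ∉ m ∧ s • z ∈ S := by
    intro m hm
    let V : IsDedekindDomain.HeightOneSpectrum C :=
      ⟨m, hm.isPrime, Ring.ne_bot_of_isMaximal_of_not_isField hm hnf⟩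
    have hv := hz (V.valuation K).valuationSubring (fun c => by
      obtain ⟨c', hc'⟩ := hkC c
      rw [Valuation.mem_valuationSubring_iff, ← hc']
      exact V.valuation_le_one c')
    have hfrac (b : K) (hb : b ∈ (V.valuation K).valuationSubring) :
        ∃ r s : C, s ∉ m ∧ (s : K) ≠ 0 ∧ b = r / s := by
      obtain ⟨n, d, hnd⟩ := IsDedekindDomain.HeightOneSpectrum.exists_primeCompl_mul_eq_of_integer
        V b ((Valuation.mem_valuationSubring_iff _ _).1 hb)
      have hd : (d : C) ∉ m := d.2
      have hd0 : ((d : C) : K) ≠ 0 := fun h => hd (by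
        rw [show (d : C) = 0 from Subtype.ext h]; exact m.zero_mem)
      exact ⟨n, d, hd, hd0, by rw [eq_div_iff hd0]; exact hnd⟩
    clear hz
    induction hv using Submodule.span_induction with
    | zero => exact ⟨1, fun h => hm.ne_top ((Ideal.eq_top_iff_one m).2 h), by simp⟩
    | add a b _ _ ha hb =>
      obtain ⟨s, hs, hs'⟩ := ha
      obtain ⟨t, ht, ht'⟩ := hb
      refine ⟨s * t, fun h => (hm.isPrime.mem_or_mem h).elim hs ht, ?_⟩
      rw [smul_add]
      refine S.add_mem ?_ ?_
      · rw [mul_comm, mul_smul]; exact S.smul_mem _ hs'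
      · rw [mul_smul]; exact S.smul_mem _ ht'
    | smul a b _ hb =>
      obtain ⟨s, hs, hs'⟩ := hb
      obtain ⟨r, t, ht, ht0, hrt⟩ := hfrac a a.2
      refine ⟨s * t, fun h => (hm.isPrime.mem_or_mem h).elim hs ht, ?_⟩
      have : (s * t) • a • b = r • s • b := by
        change (s : K) * t * (a * b) = r * (s * b)
        rw [hrt]; field_simp
      rw [this]
      exact S.smul_mem _ hs'
    | mem a ha =>
      obtain ⟨b, hb, rfl⟩ := ha
      obtain ⟨r, t, ht, ht0, hrt⟩ := hfrac b hb
      refine ⟨t * t, fun h => (hm.isPrime.mem_or_mem h).elim ht ht, ?_⟩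
      have : (t * t) • D b = t • D (r : K) - r • D (t : K) := by
        change (t : K) * t * D b = t * D (r : K) - r * D (t : K)
        rw [hrt, D.leibniz_div]
        simp only [smul_eq_mul]
        field_simp
      rw [this]
      have hr : D (r : K) ∈ S := Submodule.subset_span ⟨r, r.2, rfl⟩
      have ht : D (t : K) ∈ S := Submodule.subset_span ⟨t, t.2, rfl⟩
      have hsub : t • D (r : K) - r • D (t : K) = t • D (r : K) + (-r) • D (t : K) := by
        change (t : K) * _ - r * _ = t * _ + (-(r : K)) * _
        ring
      rw [hsub]
      exact S.add_mem (S.smul_mem t hr) (S.smul_mem (-r) ht)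
  have hzS : z ∈ S := by
    let I : Ideal C := S.comap (LinearMap.toSpanSingleton C K z)
    have hI : I = ⊤ := by
      by_contra hne
      obtain ⟨m, hm, hle⟩ := Ideal.exists_le_maximal I hne
      obtain ⟨s, hs, hs'⟩ := key m hm
      exact hs (hle hs')
    have h1 : (1 : C) ∈ I := hI ▸ Submodule.mem_top
    have h2 : (1 : C) • z ∈ S := h1
    rwa [one_smul] at h2
  -- The factor `c` is needed for the induction: `S` is a `C`-module, whereas the trace is not
  -- `C`-linear.
  have htr (w : K) (hw : w ∈ S) : ∀ c : C, Algebra.trace E K (c * w) ∈ (originLift y hy).range := by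
    induction hw using Submodule.span_induction with
    | zero => intro c; rw [mul_zero, map_zero]; exact zero_mem _
    | add a b _ _ ha hb => intro c; rw [mul_add, map_add]; exact add_mem (ha c) (hb c)
    | smul a b _ hb =>
      intro c
      have := hb (c * a)
      rwa [MulMemClass.coe_mul, mul_assoc] at this
    | mem a ha =>
      obtain ⟨b, hb, rfl⟩ := ha
      intro c
      obtain ⟨e, he⟩ := exists_trace_mul_derivation_eq_algebraMap (E := E) hres D hD c.2 hb
      exact ⟨e, he.symm⟩
  simpa using htr z hzS 1

end OriginLocalRing

end

/-! ### Forms on the projective line and the points of a general fibre of a covering -/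

noncomputable section

section

open Polynomial

variable {k E : Type*} [Field k] [Field E] [Algebra k E]

lemma transcendental_sub_algebraMap {x : E} (hx : Transcendental k x) (a : k) :
    Transcendental k (x - algebraMap k E a) := fun h =>
  hx (by simpa using h.add (isAlgebraic_algebraMap (R := k) (A := E) a))

lemma adjoin_sub_algebraMap {x : E} (a : k) (h : IntermediateField.adjoin k {x} = ⊤) :
    IntermediateField.adjoin k {x - algebraMap k E a} = ⊤ := by
  rw [eq_top_iff, ← h, IntermediateField.adjoin_le_iff, Set.singleton_subset_iff]
  have := add_mem (IntermediateField.mem_adjoin_simple_self k (x - algebraMap k E a))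
    ((IntermediateField.adjoin k {x - algebraMap k E a}).algebraMap_mem a)
  simpa using this

lemma adjoin_inv {x : E} (h : IntermediateField.adjoin k {x} = ⊤) :
    IntermediateField.adjoin k {x⁻¹} = ⊤ := by
  rw [eq_top_iff, ← h, IntermediateField.adjoin_le_iff, Set.singleton_subset_iff]
  simpa using inv_mem (IntermediateField.mem_adjoin_simple_self k x⁻¹)

lemma transcendental_inv {x : E} (hx : Transcendental k x) : Transcendental k x⁻¹ := fun h =>
  hx (by simpa using h.inv)

/-- There is no nonzero regular differential form on the projective line. -/
lemma eq_zero_of_mem_range_originLift [IsAlgClosed k] {x : E} (hx : Transcendental k x)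
    (hgen : IntermediateField.adjoin k {x} = ⊤) {T : E}
    (h : ∀ a : k, T ∈ (originLift _ (transcendental_sub_algebraMap hx a)).range)
    (h' : x ^ 2 * T ∈ (originLift _ (transcendental_inv hx)).range) : T = 0 := by
  have hx0 : x ≠ 0 := by rintro rfl; exact hx isAlgebraic_zero
  obtain ⟨p, rfl⟩ : ∃ p : k[X], T = aeval x p := by
    -- The ideal of denominators of `T`. Regularity of `T` at each `a` gives an element of `I` not
    -- vanishing at `a`, so `I` is the unit ideal.
    let I : Ideal k[X] :=
      { carrier := {q | ∃ p : k[X], aeval x q * T = aeval x p}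
        zero_mem' := ⟨0, by simp⟩
        add_mem' := by
          rintro q r ⟨a, ha⟩ ⟨b, hb⟩
          exact ⟨a + b, by rw [map_add, map_add, add_mul, ha, hb]⟩
        smul_mem' := by
          rintro c q ⟨a, ha⟩
          exact ⟨c * a, by rw [smul_eq_mul, map_mul, map_mul, mul_assoc, ha]⟩ }
    have hI : I = ⊤ := by
      by_contra hne
      obtain ⟨m, hm, hle⟩ := Ideal.exists_le_maximal I hne
      have hm0 : m ≠ ⊥ := Ring.ne_bot_of_isMaximal_of_not_isField hm (Polynomial.not_isField k)
      have hirr := (Submodule.IsPrincipal.prime_generator_of_isPrime m hm0).irreducible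
      obtain ⟨a, ha⟩ := IsAlgClosed.exists_root _ (degree_pos_of_irreducible hirr).ne'
      obtain ⟨r, s, hs, hrs⟩ := (mem_range_originLift _ _).1 (h a)
      have hs0 := aeval_ne_zero_of_transcendental (transcendental_sub_algebraMap hx a)
        (p := s) (by rintro rfl; exact hs eval_zero)
      have hmem : s.comp (X - C a) ∈ I := by
        refine ⟨r.comp (X - C a), ?_⟩
        rw [aeval_comp, aeval_comp, map_sub, aeval_X, aeval_C, hrs, mul_div_cancel₀ _ hs0]
      have := hle hmem
      rw [Submodule.IsPrincipal.mem_iff_generator_dvd] at this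
      have := eval_dvd (x := a) this
      rw [ha, zero_dvd_iff, eval_comp] at this
      simp at this
      exact hs this
    have h1 : (1 : k[X]) ∈ I := hI ▸ Submodule.mem_top
    obtain ⟨p, hp⟩ := h1
    exact ⟨p, by simpa using hp⟩
  obtain ⟨r, s, hs, hrs⟩ := (mem_range_originLift _ _).1 h'
  by_contra hne
  have hp : p ≠ 0 := by rintro rfl; simp at hne
  have hs0 := aeval_ne_zero_of_transcendental (transcendental_inv hx)
        (p := s) (by rintro rfl; exact hs eval_zero)
  rw [eq_div_iff hs0] at hrs
  have hrev (g : k[X]) : aeval x g.reverse = aeval x⁻¹ g * x ^ g.natDegree := by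
    let := invertibleOfNonzero (inv_ne_zero hx0)
    have := eval₂_reverse_mul_pow (algebraMap k E) x⁻¹ g
    rw [invOf_eq_inv, inv_inv] at this
    rw [aeval_def, aeval_def, ← this, mul_assoc, ← mul_pow, inv_mul_cancel₀ hx0, one_pow, mul_one]
  -- This is `x² p(x) = r(1/x) / s(1/x)` with denominators cleared. As `s(0) ≠ 0`, reversal
  -- preserves the degree of `s`, and the left side has degree at least two more than the right.
  have key : X ^ (2 + r.natDegree) * p * s.reverse = r.reverse * X ^ s.natDegree := by
    refine sub_eq_zero.1 ((transcendental_iff.1 hx) _ ?_)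
    simp only [map_sub, map_mul, map_pow, aeval_X, hrev]
    rw [← hrs]
    ring
  have hsr : s.reverse.natDegree = s.natDegree := by
    rw [reverse_natDegree, natTrailingDegree_eq_zero.2 (.inr (by rwa [coeff_zero_eq_eval_zero])),
      Nat.sub_zero]
  have hs' : s ≠ 0 := by rintro rfl; exact hs eval_zero
  have hdeg := congrArg natDegree key
  rw [natDegree_mul (mul_ne_zero (pow_ne_zero _ X_ne_zero) hp) (by simpa using hs'),
    natDegree_mul (pow_ne_zero _ X_ne_zero) hp, natDegree_X_pow, hsr] at hdeg
  have h3 := natDegree_mul_le (p := r.reverse) (q := X ^ s.natDegree)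
  rw [natDegree_X_pow] at h3
  have h4 := reverse_natDegree_le r
  omega

variable {K : Type*} [Field K] [Algebra k K] [Algebra E K] [IsScalarTower k E K]

/-- The trace to the projective line of a regular differential form is zero. -/
theorem trace_eq_zero_of_regular [IsAlgClosed k] [FiniteDimensional E K] [Algebra.IsSeparable E K]
    {x : E} (hx : Transcendental k x) (hgen : IntermediateField.adjoin k {x} = ⊤)
    (D : Derivation k K K) (hDx : D (algebraMap E K x) = 1) (c τ : K)
    (hz : ∀ v : ValuationSubring K, (∀ c : k, algebraMap k K c ∈ v) → ∀ D : Derivation k K K,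
      c * D τ ∈ Submodule.span v (D '' v)) :
    Algebra.trace E K (c * D τ) = 0 := by
  have hx0 : x ≠ 0 := by rintro rfl; exact hx isAlgebraic_zero
  have hx0' : algebraMap E K x ≠ 0 := by simpa using hx0
  refine eq_zero_of_mem_range_originLift hx hgen (fun a => ?_) ?_
  · refine trace_mem_range_originLift _ _ (adjoin_sub_algebraMap a hgen) D ?_ _
      fun v hv => hz v hv D
    rw [map_sub, map_sub, hDx, ← IsScalarTower.algebraMap_apply, Derivation.map_algebraMap, sub_zero]
  -- At infinity the coordinate is `x⁻¹`, and `-x² D` is the derivation with value 1 on it.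
  · have h := trace_mem_range_originLift _ (transcendental_inv hx) (adjoin_inv hgen)
      ((- algebraMap E K x ^ 2) • D) ?_ (c * ((- algebraMap E K x ^ 2) • D) τ) fun v hv => hz v hv _
    · have h2 : c * ((- algebraMap E K x ^ 2) • D) τ = (-x ^ 2) • (c * D τ) := by
        rw [Derivation.smul_apply, Algebra.smul_def (-x ^ 2 : E), smul_eq_mul, map_neg, map_pow]; ring
      rw [h2, map_smul, smul_eq_mul, neg_mul] at h
      simpa using neg_mem h
    · rw [Derivation.smul_apply, map_inv₀, Derivation.leibniz_inv, hDx, smul_eq_mul, smul_eq_mul]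
      field_simp


/-- Euler's formula. -/
lemma trace_aeval_div_derivative_minpoly [FiniteDimensional E K] [Algebra.IsSeparable E K] (z : K)
    (hz : IntermediateField.adjoin E {z} = ⊤) (Q : E[X]) (hQ : Q.natDegree < Module.finrank E K) :
    Algebra.trace E K (aeval z Q * (aeval z (derivative (minpoly E z)))⁻¹) =
      Q.coeff (Module.finrank E K - 1) := by
  classical
  let pb : PowerBasis E K := (IntermediateField.adjoin.powerBasis
    (Algebra.IsIntegral.isIntegral (R := E) z)).map
      ((IntermediateField.equivOfEq hz).trans IntermediateField.topEquiv)
  have hgen : pb.gen = z := by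
    simp [pb, IntermediateField.adjoin.powerBasis_gen]
  have hdim : Module.finrank E K = pb.dim := pb.finrank
  have hpos : 0 < pb.dim := hdim ▸ Module.finrank_pos
  -- The trace dual of the power basis consists of the coefficients of `P(X) / (X - z)` divided by
  -- `P'(z)`. The leading coefficient is 1, so the last dual vector is `1 / P'(z)`.
  have hdual := Module.Basis.traceDual_eq_iff.1
    (funext (Module.Basis.traceDual_powerBasis_eq (K := E) (L := K) pb)) ⟨pb.dim - 1, by omega⟩
  have hlead : (minpolyDiv E pb.gen).coeff (pb.dim - 1) = 1 := by
    have h := (minpolyDiv_monic (Algebra.IsIntegral.isIntegral (R := E) pb.gen)).coeff_natDegree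
    rwa [natDegree_minpolyDiv, pb.natDegree_minpoly] at h
  simp only [hlead, one_div, Algebra.traceForm_apply, PowerBasis.coe_basis] at hdual
  simp only [hgen] at hdual
  rw [aeval_eq_sum_range' hQ, hdim, Finset.sum_range, Finset.sum_mul, map_sum,
    Finset.sum_eq_single ⟨pb.dim - 1, by omega⟩]
  · rw [smul_mul_assoc, map_smul, mul_comm, hdual, if_pos rfl, smul_eq_mul, mul_one]
  · intro i _ hi
    rw [smul_mul_assoc, map_smul, mul_comm, hdual, if_neg hi, smul_zero]
  · intro h
    exact absurd (Finset.mem_univ _) h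

/-- Coprimality of `P` and its derivative survives reduction at `e`, so the reduction has as many
distinct roots in `k` as its degree. Sending `z` to a root is well defined because the polynomials
over `O` that vanish at `z` are the multiples of `P`. The resulting homomorphisms are the points
over `e` of the covering defined by `z`. -/
lemma exists_algHom_of_isCoprime {k E K O : Type*} [Field k] [Field E] [Field K] [Algebra k K]
    [Algebra E K] [CommRing O] [Algebra k O] [IsAlgClosed k]
    (e : O →ₐ[k] k) [Algebra O E] (hinj : Function.Injective (algebraMap O E)) [Algebra O K]
    [IsScalarTower O E K] [IsScalarTower k O K] (z : K) (P : O[X]) (hP : P.Monic)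
    (hPz : P.map (algebraMap O E) = minpoly E z) (hcop : IsCoprime P (derivative P)) {d : ℕ}
    (hd : P.natDegree = d) :
    ∃ (c : Fin d → k) (p : Fin d → ((aeval z : O[X] →ₐ[O] K).range.restrictScalars k →ₐ[k] k)),
      Function.Injective c ∧ ∀ i (Q : O[X])
        (α : (aeval z : O[X] →ₐ[O] K).range.restrictScalars k), (α : K) = aeval z Q →
          p i α = (Q.map e.toRingHom).eval (c i) := by
  classical
  subst hd
  have hsep : (P.map e.toRingHom).Separable := by
    have := hcop.map (mapRingHom e.toRingHom)
    rwa [Separable, derivative_map]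
  have hcard : (P.map e.toRingHom).roots.toFinset.card = P.natDegree := by
    rw [Multiset.toFinset_card_of_nodup (nodup_roots hsep), ← hP.natDegree_map e.toRingHom]
    exact (IsAlgClosed.splits _).natDegree_eq_card_roots.symm
  let c : Fin P.natDegree → k := fun i => ((Finset.equivFinOfCardEq hcard).symm i : _)
  have hc (i) : (P.map e.toRingHom).eval (c i) = 0 := by
    have := ((Finset.equivFinOfCardEq hcard).symm i).2
    rw [Multiset.mem_toFinset, mem_roots'] at this
    exact this.2
  let f : O[X] →ₐ[k] (aeval z : O[X] →ₐ[O] K).range.restrictScalars k :=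
    ((aeval z : O[X] →ₐ[O] K).rangeRestrict).restrictScalars k
  have hf : Function.Surjective f := (aeval z : O[X] →ₐ[O] K).rangeRestrict_surjective
  let g (i) : O[X] →ₐ[k] k := (aeval (c i)).comp (mapAlgHom e)
  have hg (i) (Q) : g i Q = (Q.map e.toRingHom).eval (c i) := by
    rw [← coe_aeval_eq_eval]; rfl
  have hker (i) : RingHom.ker f.toRingHom ≤ RingHom.ker (g i).toRingHom := by
    intro Q hQ
    have hQ' : aeval z Q = 0 := congrArg Subtype.val hQ
    change g i Q = 0
    have hdvd : P ∣ Q := by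
      rw [← map_dvd_map _ hinj hP, hPz]
      refine minpoly.dvd _ _ ?_
      rwa [aeval_map_algebraMap]
    obtain ⟨R, rfl⟩ := hdvd
    rw [map_mul, hg, hc, zero_mul]
  refine ⟨c, fun i => AlgHom.liftOfSurjective f hf (g i) (hker i), ?_, ?_⟩
  · exact Subtype.val_injective.comp (Finset.equivFinOfCardEq hcard).symm.injective
  · intro i Q α hα
    rw [← hg, show α = f Q from Subtype.ext hα]
    exact AlgHom.liftOfSurjective_apply f hf (g i) (hker i) Q

/-- Each rational function has finitely many poles, whereas `k` is infinite. -/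
lemma exists_forall_mem_range_originLift [IsAlgClosed k] {x : E} (hx : Transcendental k x)
    (hgen : IntermediateField.adjoin k {x} = ⊤) (s : Set E) (hs : s.Finite) :
    ∃ a : k, s ⊆ (originLift _ (transcendental_sub_algebraMap hx a)).range := by
  have key (e : E) :
      {a : k | e ∉ (originLift _ (transcendental_sub_algebraMap hx a)).range}.Finite := by
    have he : e ∈ IntermediateField.adjoin k {x} := hgen ▸ IntermediateField.mem_top
    obtain ⟨p, q, rfl⟩ := (IntermediateField.mem_adjoin_simple_iff k e).1 he
    classical
    by_cases hq : q = 0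
    · simp [hq]
    refine (q.roots.toFinset.finite_toSet).subset fun a ha => ?_
    rw [Finset.mem_coe, Multiset.mem_toFinset, mem_roots hq]
    by_contra h
    refine ha ((mem_range_originLift _ _).2 ⟨p.comp (X + C a), q.comp (X + C a), ?_, ?_⟩)
    · simpa [eval_comp] using h
    · simp [aeval_comp]
  have : (⋃ e ∈ s, {a : k | e ∉ (originLift _
      (transcendental_sub_algebraMap hx a)).range}).Finite := hs.biUnion fun e _ => key e
  obtain ⟨a, ha⟩ := this.exists_notMem
  refine ⟨a, fun e he => ?_⟩
  by_contra h
  exact ha (Set.mem_biUnion he h)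


/-- The function `g` cannot be nonzero at exactly one point of a general fibre if `g w` has trace
zero. -/
theorem exists_points_of_trace_eq_zero [IsAlgClosed k] [FiniteDimensional E K]
    [Algebra.IsSeparable E K] {x : E} (hx : Transcendental k x)
    (hgen : IntermediateField.adjoin k {x} = ⊤) (F : Subalgebra k K) (hF : F.FG)
    [IsFractionRing F K] (w : K) (hw : w ≠ 0) :
    ∃ p : Fin (Module.finrank E K) → (F →ₐ[k] k), Function.Injective p ∧
      ∀ g : F, (∀ i : Fin (Module.finrank E K), (i : ℕ) + 1 < Module.finrank E K → p i g = 0) →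
        Algebra.trace E K (g * w) = 0 →
        ∀ i : Fin (Module.finrank E K), (i : ℕ) + 1 = Module.finrank E K → p i g = 0 := by
  classical
  obtain ⟨z, hz⟩ := Field.exists_primitive_element E K
  have hzint : _root_.IsIntegral E z := Algebra.IsIntegral.isIntegral z
  have hrep (κ : K) : ∃ Q : E[X], aeval z Q = κ := by
    have : κ ∈ IntermediateField.adjoin E {z} := hz ▸ IntermediateField.mem_top
    rw [← IntermediateField.mem_toSubalgebra,
      IntermediateField.adjoin_simple_toSubalgebra_of_isAlgebraic hzint.isAlgebraic,
      Algebra.adjoin_singleton_eq_range_aeval] at this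
    exact this
  choose R hR using hrep
  obtain ⟨s, hs⟩ := hF
  obtain ⟨f₁, f₂, hf₂, hf⟩ := IsFractionRing.div_surjective (A := F) z
  have hf₂0 : (f₂ : K) ≠ 0 := by simpa using nonZeroDivisors.ne_zero hf₂
  have hf' : (f₁ : K) / f₂ = z := hf
  have hsepz : (minpoly E z).Separable := Algebra.IsSeparable.isSeparable E z
  have hder : aeval z (derivative (minpoly E z)) ≠ 0 :=
    hsepz.aeval_derivative_ne_zero (minpoly.aeval E z)
  obtain ⟨U, V, hUV⟩ := id hsepz
  -- With this `u`, the product `g * w` equals `g * u / P'(z)`, the shape required by Euler's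
  -- formula.
  let u : K := w * aeval z (derivative (minpoly E z))
  have hu : u ≠ 0 := mul_ne_zero hw hder
  -- All coefficients that have to be regular at the chosen point of the line: those of the minimal
  -- polynomial, of the Bézout identity expressing its separability, and of the generators of `F`.
  -- The inverses ensure that `f₂` and `u` are nonzero at the points above.
  let Γ : Finset E[X] := {minpoly E z, U, V} ∪ (s ∪ {(f₂ : K)⁻¹, u, u⁻¹}).image R
  obtain ⟨a, ha⟩ := exists_forall_mem_range_originLift hx hgen
    (⋃ p ∈ Γ, (p.coeffs ∪ {0} : Finset E))
    (Γ.finite_toSet.biUnion fun p _ => (p.coeffs ∪ {0}).finite_toSet)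
  let O := OriginLocalRing k
  let hy := transcendental_sub_algebraMap hx a
  let alg1 := (originLift _ hy).toRingHom.toAlgebra
  let alg2 := ((algebraMap E K).comp (originLift _ hy).toRingHom).toAlgebra
  have t1 : IsScalarTower O E K := .of_algebraMap_eq fun _ => rfl
  have t2 : IsScalarTower k O K := .of_algebraMap_eq fun c => by
    change _ = algebraMap E K (originLift _ hy (algebraMap k _ c))
    rw [AlgHom.commutes, ← IsScalarTower.algebraMap_apply]
  have hinj : Function.Injective (algebraMap O E) := originLift_injective _ hy
  have hlift (p) (hp : p ∈ Γ) : p ∈ lifts (algebraMap O E) := by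
    rw [lifts_iff_coeff_lifts]
    intro n
    refine ha (Set.mem_biUnion hp ?_)
    rw [Finset.mem_coe, Finset.mem_union, Finset.mem_singleton]
    by_cases h : p.coeff n = 0
    · exact .inr h
    · exact .inl (coeff_mem_coeffs h)
  obtain ⟨P, hPm, hPd, hP⟩ := lifts_and_natDegree_eq_and_monic
    (hlift (minpoly E z) (by simp [Γ])) (minpoly.monic hzint)
  obtain ⟨U', hU⟩ := (mem_lifts _).1 (hlift U (by simp [Γ]))
  obtain ⟨V', hV⟩ := (mem_lifts _).1 (hlift V (by simp [Γ]))
  have hcop : IsCoprime P (derivative P) := by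
    refine ⟨U', V', map_injective _ hinj ?_⟩
    rw [Polynomial.map_add, Polynomial.map_mul, Polynomial.map_mul, ← derivative_map, hU, hV, hPm,
      hUV, Polynomial.map_one]
  have hdeg : P.natDegree = Module.finrank E K := by
    rw [hPd]
    exact (Field.primitive_element_iff_minpoly_natDegree_eq E z).1 hz
  obtain ⟨c, p, hc, hp⟩ := exists_algHom_of_isCoprime OriginLocalRing.eval hinj z P hP hPm hcop hdeg
  let A := (aeval z : O[X] →ₐ[O] K).range.restrictScalars k
  have hmem (κ : K) (h : κ ∈ s ∪ {(f₂ : K)⁻¹, u, u⁻¹}) : κ ∈ A := by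
    obtain ⟨Q, hQ⟩ := (mem_lifts _).1 (hlift (R κ)
      (Finset.mem_union_right _ (Finset.mem_image_of_mem R h)))
    refine ⟨Q, ?_⟩
    change aeval z Q = κ
    rw [← hR κ, ← hQ, aeval_map_algebraMap]
  have hFA : F ≤ A := by
    rw [← hs, Algebra.adjoin_le_iff]
    exact fun κ h => hmem κ (Finset.mem_union_left _ h)
  have hmul (i) (α β : A) (h : (α : K) * β = 1) : p i α ≠ 0 := by
    intro h0
    have : p i (α * β) = 1 := by rw [show α * β = 1 from Subtype.ext h, map_one]
    rw [map_mul, h0, zero_mul] at this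
    exact zero_ne_one this
  refine ⟨fun i => (p i).comp (Subalgebra.inclusion hFA), ?_, ?_⟩
  -- Since `z = f₁ / f₂` with `f₂` nonzero at these points, the values on `F` determine the value of
  -- `z`, hence the root.
  · intro i j hij
    have h1 (g : F) : p i ⟨g, hFA g.2⟩ = p j ⟨g, hFA g.2⟩ := DFunLike.congr_fun hij g
    let Z : A := ⟨z, X, aeval_X z⟩
    have hZ : Z * ⟨f₂, hFA f₂.2⟩ = ⟨f₁, hFA f₁.2⟩ := Subtype.ext (by
      change z * f₂ = f₁
      rw [← hf', div_mul_cancel₀ _ hf₂0])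
    have hZi (i) : p i Z = c i := by
      rw [hp i X Z (aeval_X z).symm, Polynomial.map_X, eval_X]
    have h2 := h1 f₁
    rw [← hZ, map_mul, map_mul, h1 f₂, hZi, hZi] at h2
    refine hc (mul_right_cancel₀ ?_ h2)
    exact hmul j _ ⟨(f₂ : K)⁻¹, hmem _ (by simp)⟩ (mul_inv_cancel₀ hf₂0)
  · intro g hg htr l hl
    obtain ⟨G, hG⟩ := hFA g.2
    obtain ⟨U₁, hU₁⟩ := hmem u (by simp)
    have hG : aeval z G = (g : K) := hG
    have hU₁ : aeval z U₁ = u := hU₁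
    -- The representative of `g * u` of degree less than the degree of the covering; by Euler's
    -- formula its top coefficient is the trace of `g * w`, that is, zero.
    let Q := (G * U₁) %ₘ P
    have hPz : aeval z P = 0 := by
      rw [← aeval_map_algebraMap E, hPm, minpoly.aeval]
    have hQ : aeval z Q = g * u := by
      rw [← hG, ← hU₁, ← map_mul]
      conv_rhs => rw [← modByMonic_add_div (G * U₁) P]
      rw [map_add, map_mul, hPz, zero_mul, add_zero]
    have hdpos : 0 < Module.finrank E K := Module.finrank_pos
    have hQd : Q.natDegree < Module.finrank E K := by
      rw [← hdeg]
      exact natDegree_modByMonic_lt _ hP fun h => by simp [h] at hdeg; omega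
    have hcoeff : Q.coeff (Module.finrank E K - 1) = 0 := by
      have h := trace_aeval_div_derivative_minpoly z hz (Q.map (algebraMap O E))
        (natDegree_map_le.trans_lt hQd)
      rw [aeval_map_algebraMap, hQ, coeff_map, show (g : K) * u *
        (aeval z (derivative (minpoly E z)))⁻¹ = g * w by simp only [u]; field_simp, htr] at h
      exact hinj (by rw [← h, map_zero])
    have hval (i) : (Q.map OriginLocalRing.eval.toRingHom).eval (c i) =
        p i ⟨g, hFA g.2⟩ * p i ⟨u, hmem u (by simp)⟩ := by
      rw [← map_mul]
      exact (hp i Q _ hQ.symm).symm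
    -- The reduction has degree less than `d - 1`, where `d` is the degree of the covering, and
    -- vanishes at the `d - 1` roots other than `c l`.
    have hzero : Q.map OriginLocalRing.eval.toRingHom = 0 := by
      refine Polynomial.eq_zero_of_degree_lt_of_eval_index_eq_zero (Finset.univ.erase l)
        hc.injOn ?_ ?_
      · rw [Finset.card_erase_of_mem (Finset.mem_univ _), Finset.card_univ, Fintype.card_fin]
        refine (degree_lt_iff_coeff_zero _ _).2 fun m hm => ?_
        rw [coeff_map]
        rcases eq_or_lt_of_le hm with rfl | hm
        · rw [hcoeff, map_zero]
        · rw [coeff_eq_zero_of_natDegree_lt (by omega), map_zero]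
      · intro i hi
        have hi' : i ≠ l := Finset.ne_of_mem_erase hi
        have : p i ⟨g, hFA g.2⟩ = 0 := hg i (by
          have := i.2
          have : (i : ℕ) ≠ l := fun h => hi' (Fin.ext h)
          omega)
        rw [hval, this, zero_mul]
    have h := hval l
    rw [hzero, eval_zero, eq_comm, mul_eq_zero] at h
    exact h.resolve_right (hmul l _ ⟨u⁻¹, hmem _ (by simp)⟩ (mul_inv_cancel₀ hu))

end

end

noncomputable section

/-! ### Derivations along formally étale algebras -/

section FormallyEtale

open TensorProduct

variable {k S T : Type*} [CommRing k] [CommRing S] [CommRing T] [Algebra k S] [Algebra k T]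
  [Algebra S T] [IsScalarTower k S T] [Algebra.FormallyEtale S T]

/-- For a formally étale algebra the differentials of `T` are the base change of those of `S`, so a
linear map on the latter extends. -/
lemma exists_derivation_extending_of_formallyEtale (d : Derivation k S T) :
    ∃ D : Derivation k T T, ∀ s, D (algebraMap S T s) = d s := by
  let e := KaehlerDifferential.tensorKaehlerEquivOfFormallyEtale k S T
  let l : Ω[T⁄k] →ₗ[T] T := (AlgebraTensorModule.lift
    ((LinearMap.ringLmapEquivSelf T T _).symm d.liftKaehlerDifferential)).comp e.symm.toLinearMap
  refine ⟨l.compDer (KaehlerDifferential.D k T), fun s => ?_⟩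
  have h : e.symm (KaehlerDifferential.D k T (algebraMap S T s)) =
      1 ⊗ₜ KaehlerDifferential.D k S s :=
    KaehlerDifferential.tensorKaehlerEquivOfFormallyEtale_symm_D_algebraMap k S T s
  refine (congrArg (AlgebraTensorModule.lift _) h).trans ?_
  simp

/-- By the same isomorphism, the differentials of `T` are generated by the differentials of elements
of `S`. -/
lemma derivation_ext_of_formallyEtale {M : Type*} [AddCommGroup M] [Module k M] [Module T M]
    [IsScalarTower k T M] {D₁ D₂ : Derivation k T M}
    (h : ∀ s, D₁ (algebraMap S T s) = D₂ (algebraMap S T s)) : D₁ = D₂ := by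
  let e := KaehlerDifferential.tensorKaehlerEquivOfFormallyEtale k S T
  have hspan : ∀ x : Ω[T⁄k], (D₁ - D₂).liftKaehlerDifferential x = 0 := by
    intro x
    obtain ⟨y, rfl⟩ := e.surjective x
    induction y with
    | zero => simp
    | add a b ha hb => rw [map_add, map_add, ha, hb, add_zero]
    | tmul t ω =>
      have hω : ω ∈ Submodule.span S (Set.range (KaehlerDifferential.D k S)) := by
        rw [KaehlerDifferential.span_range_derivation]; trivial
      induction hω using Submodule.span_induction with
      | zero => simp
      | add a b _ _ ha hb => rw [TensorProduct.tmul_add, map_add, map_add, ha, hb, add_zero]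
      | smul s a _ ha =>
        have : t ⊗ₜ[S] (s • a) = algebraMap S T s • (t ⊗ₜ[S] a) := by
          rw [TensorProduct.tmul_smul, algebraMap_smul]
        rw [this, map_smul, map_smul, ha, smul_zero]
      | mem a ha =>
        obtain ⟨s, rfl⟩ := ha
        rw [KaehlerDifferential.tensorKaehlerEquivOfFormallyEtale_apply,
          KaehlerDifferential.mapBaseChange_tmul, KaehlerDifferential.map_D, map_smul,
          Derivation.liftKaehlerDifferential_comp_D, Derivation.sub_apply, h, sub_self, smul_zero]
  ext t
  have := hspan (KaehlerDifferential.D k T t)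
  rwa [Derivation.liftKaehlerDifferential_comp_D, Derivation.sub_apply, sub_eq_zero] at this

end FormallyEtale

/-! ### Separating elements and removal of inseparability -/

section

open Polynomial IntermediateField

variable {k K : Type*} [Field k] [Field K] [Algebra k K]

/-- The map is the localization from `k[X]` to `k(x)` followed by a separable field extension. -/
lemma formallyEtale_aeval {x : K} (hx : Transcendental k x) [Algebra.IsSeparable k⟮x⟯ K] :
    letI := (aeval (R := k) x).toAlgebra
    Algebra.FormallyEtale k[X] K := by
  let x' : k⟮x⟯ := AdjoinSimple.gen k x
  let alg1 := (aeval (R := k) x').toAlgebra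
  let alg2 := (aeval (R := k) x).toAlgebra
  have hx' : Transcendental k x' := fun h => hx (IsAlgebraic.algebraMap (S := k⟮x⟯) (A := K) h)
  have t1 : IsScalarTower k[X] k⟮x⟯ K := .of_algebraMap_eq fun p => by
    change aeval x p = algebraMap _ K (aeval x' p)
    rw [← aeval_algebraMap_apply]
    rfl
  have : FaithfulSMul k[X] k⟮x⟯ :=
    (faithfulSMul_iff_algebraMap_injective _ _).2 (transcendental_iff_injective.1 hx')
  have : IsFractionRing k[X] k⟮x⟯ := .of_field _ _ fun z => by
    obtain ⟨r, s, h⟩ := (mem_adjoin_simple_iff k (z : K)).1 z.2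
    refine ⟨r, s, Subtype.ext ?_⟩
    rw [h]
    change aeval x r / aeval x s = algebraMap _ K (aeval x' r / aeval x' s)
    rw [map_div₀, ← aeval_algebraMap_apply, ← aeval_algebraMap_apply]
    rfl
  have := Algebra.FormallyEtale.of_isLocalization (Rₘ := k⟮x⟯) (nonZeroDivisors k[X])
  have := Algebra.FormallyEtale.of_isSeparable k⟮x⟯ K
  exact Algebra.FormallyEtale.comp k[X] k⟮x⟯ K

lemma exists_derivation_eq_one {x : K} (hx : Transcendental k x) [Algebra.IsSeparable k⟮x⟯ K] :
    ∃ D : Derivation k K K, D x = 1 := by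
  let alg2 := (aeval (R := k) x).toAlgebra
  have := formallyEtale_aeval hx
  have t : IsScalarTower k k[X] K := .of_algebraMap_eq fun c => (aeval_C x c).symm
  obtain ⟨D, hD⟩ := exists_derivation_extending_of_formallyEtale (k := k) (S := k[X]) (T := K)
    (mkDerivation k 1)
  refine ⟨D, ?_⟩
  have := hD X
  rw [mkDerivation_X] at this
  rw [← this]
  congr 1
  exact (aeval_X x).symm

lemma derivation_ext_of_isSeparable {x : K} (hx : Transcendental k x) [Algebra.IsSeparable k⟮x⟯ K]
    {D₁ D₂ : Derivation k K K} (h : D₁ x = D₂ x) : D₁ = D₂ := by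
  let alg2 := (aeval (R := k) x).toAlgebra
  have := formallyEtale_aeval hx
  have t : IsScalarTower k k[X] K := .of_algebraMap_eq fun c => (aeval_C x c).symm
  refine derivation_ext_of_formallyEtale (k := k) (S := k[X]) fun p => ?_
  change D₁ (aeval x p) = D₂ (aeval x p)
  rw [D₁.map_aeval, D₂.map_aeval, h]

/-- A function with zero differential is a `p`-th power. -/
lemma exists_pow_eq_of_derivation_eq_zero [PerfectField k] (p : ℕ) [Fact p.Prime] [CharP k p]
    {x y : K} [Algebra.IsSeparable k⟮x⟯ K] [FiniteDimensional k⟮x⟯ K]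
    (D : Derivation k K K) (hD : D x = 1) (hy : D y = 0) : ∃ z : K, z ^ p = y := by
  have : CharP K p := charP_of_injective_algebraMap (algebraMap k K).injective p
  have : CharP k⟮x⟯ p := charP_of_injective_algebraMap (algebraMap k k⟮x⟯).injective p
  have : ExpChar K p := .prime Fact.out
  have : ExpChar k p := .prime Fact.out
  have : ExpChar k⟮x⟯ p := .prime Fact.out
  have hp0 : 0 < p := Nat.Prime.pos Fact.out
  let F₀ : Subfield K := (frobenius K p).fieldRange
  have hDF (c : F₀) : D (c : K) = 0 := by
    obtain ⟨c, b, rfl⟩ := c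
    change D (b ^ p) = 0
    rw [D.leibniz_pow]
    simp
  let D' : Derivation F₀ K K := Derivation.mk'
    { toFun := D
      map_add' := D.map_add
      map_smul' := fun c a => by
        change D ((c : K) * a) = c * D a
        rw [D.leibniz, hDF, smul_zero, add_zero, smul_eq_mul] } D.leibniz
  have hint : _root_.IsIntegral F₀ x := ⟨X ^ p - C ⟨x ^ p, x, rfl⟩, monic_X_pow_sub_C _ hp0.ne', by
    simp only [eval₂_sub, eval₂_pow, eval₂_X, eval₂_C]
    exact sub_self _⟩
  have hdeg : (minpoly F₀ x).natDegree ≤ p := by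
    have h1 : (X ^ p - C (⟨x ^ p, x, rfl⟩ : F₀)).natDegree = p := natDegree_X_pow_sub_C
    rw [← h1]
    refine natDegree_le_of_dvd (minpoly.dvd _ _ ?_) (monic_X_pow_sub_C _ hp0.ne').ne_zero
    simp only [map_sub, map_pow, aeval_X, aeval_C]
    exact sub_self _
  -- `K` is generated by `x` over its subfield of `p`-th powers: this subfield contains `k` because
  -- `k` is perfect, and by separability `K` is generated over `k(x)` by the `p`-th power of a
  -- primitive element.
  have htop : ∀ a : K, a ∈ F₀⟮x⟯ := by
    let M : IntermediateField k K :=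
      { F₀⟮x⟯.toSubfield with
        algebraMap_mem' := fun c => by
          obtain ⟨b, hb⟩ := surjective_frobenius k p c
          refine F₀⟮x⟯.algebraMap_mem ⟨algebraMap k K c, algebraMap k K b, ?_⟩
          rw [← hb]
          exact (map_pow _ _ _).symm }
    have hxM : k⟮x⟯ ≤ M := by
      rw [adjoin_le_iff, Set.singleton_subset_iff]
      exact mem_adjoin_simple_self F₀ x
    obtain ⟨z, hz⟩ := Field.exists_primitive_element k⟮x⟯ K
    rw [adjoin_simple_eq_adjoin_pow_expChar_of_isSeparable k⟮x⟯ K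
      (Algebra.IsSeparable.isSeparable k⟮x⟯ z) p] at hz
    let M' : IntermediateField k⟮x⟯ K :=
      { M.toSubfield with algebraMap_mem' := fun c => hxM c.2 }
    have hM' : M' = ⊤ := by
      rw [eq_top_iff, ← hz, adjoin_le_iff, Set.singleton_subset_iff]
      exact F₀⟮x⟯.algebraMap_mem ⟨z ^ p, z, rfl⟩
    intro a
    have : a ∈ M' := hM' ▸ mem_top
    exact this
  obtain ⟨Q, hQ⟩ : ∃ Q : F₀[X], aeval x Q = y := by
    have := htop y
    rw [← mem_toSubalgebra, adjoin_simple_toSubalgebra_of_isAlgebraic hint.isAlgebraic,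
      Algebra.adjoin_singleton_eq_range_aeval] at this
    exact this
  let R := Q %ₘ minpoly F₀ x
  have hR : aeval x R = y := by
    rw [← hQ]
    conv_rhs => rw [← modByMonic_add_div Q (minpoly F₀ x)]
    rw [map_add, map_mul, minpoly.aeval, zero_mul, add_zero]
  have hRd : R.natDegree < (minpoly F₀ x).natDegree :=
    natDegree_modByMonic_lt _ (minpoly.monic hint) (minpoly.ne_one _ _)
  have hder : aeval x (derivative R) = 0 := by
    have h1 : D' (aeval x R) = 0 := by rw [hR]; exact hy
    rw [D'.map_aeval] at h1
    have h2 : D' x = 1 := hD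
    rwa [h2, smul_eq_mul, mul_one] at h1
  have hR0 : derivative R = 0 := by
    by_contra h
    have h1 := natDegree_le_of_dvd (minpoly.dvd _ _ hder) h
    have h2 := natDegree_derivative_le R
    omega
  -- The exponents in `R` are less than `p`, so the positive ones are nonzero in `K`, and a
  -- vanishing derivative leaves only the constant term, which is a `p`-th power.
  have hRc : R = C (R.coeff 0) := by
    refine Polynomial.ext fun n => ?_
    rcases n with _ | n
    · simp
    · rw [coeff_C_succ]
      by_contra h
      have h1 : n + 1 ≤ R.natDegree := le_natDegree_of_ne_zero h
      have h2 := congrArg (coeff · n) hR0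
      simp only [coeff_derivative, coeff_zero, mul_eq_zero, h, false_or] at h2
      have h3 : ((n + 1 : ℕ) : K) = 0 := by
        have := congrArg (algebraMap F₀ K) h2
        simpa using this
      rw [CharP.cast_eq_zero_iff K p] at h3
      have := Nat.le_of_dvd (by omega) h3
      omega
  rw [hRc, aeval_C] at hR
  obtain ⟨b, hb⟩ := (R.coeff 0).2
  exact ⟨b, hb.trans hR⟩


/-- Every `k`-derivation of `K` is a multiple of `D`. One that is linear over `k(x)` kills `x`,
where `D` does not vanish, so it is zero. Hence there are no differentials over `k(x)`, and the
extension is unramified. -/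
lemma isSeparable_of_derivation_ne_zero {x y : K} (hy : Transcendental k y)
    [Algebra.IsSeparable k⟮y⟯ K] [FiniteDimensional k⟮x⟯ K] (D : Derivation k K K) (hDy : D y = 1)
    (hDx : D x ≠ 0) : Algebra.IsSeparable k⟮x⟯ K := by
  have : Algebra.FormallyUnramified k⟮x⟯ K := by
    constructor
    refine subsingleton_of_forall_eq 0 fun ω => ?_
    rw [← Module.forall_dual_apply_eq_zero_iff K]
    intro f
    let δ : Derivation k K K := (f.compDer (KaehlerDifferential.D k⟮x⟯ K)).restrictScalars k
    have hδx : δ x = 0 :=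
      (f.compDer (KaehlerDifferential.D k⟮x⟯ K)).map_algebraMap (AdjoinSimple.gen k x)
    have hδ : δ = δ y • D := derivation_ext_of_isSeparable hy (by
      rw [Derivation.smul_apply, hDy, smul_eq_mul, mul_one])
    have hδy : δ y = 0 := by
      have := DFunLike.congr_fun hδ x
      rw [hδx, Derivation.smul_apply, smul_eq_mul, eq_comm, mul_eq_zero] at this
      exact this.resolve_right hDx
    rw [hδy, zero_smul] at hδ
    have hf : f = 0 := Derivation.liftKaehlerDifferential_unique _ _ (by
      ext t
      exact DFunLike.congr_fun hδ t)
    rw [hf, LinearMap.zero_apply]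
  exact Algebra.FormallyUnramified.isSeparable k⟮x⟯ K

/-- As a rational function `x` has degree 1, which is not a multiple of `p`. -/
lemma notMem_adjoin_of_pow_eq {p : ℕ} (hp : p.Prime) {x z : K} (hx : Transcendental k x)
    (hz : z ^ p = x) : z ∉ k⟮x⟯ := by
  intro h
  obtain ⟨r, s, rfl⟩ := (mem_adjoin_simple_iff k z).1 h
  have hx0 : x ≠ 0 := by rintro rfl; exact hx isAlgebraic_zero
  have hs0 : aeval x s ≠ 0 := by
    intro h0
    rw [h0, div_zero, zero_pow hp.ne_zero] at hz
    exact hx0 hz.symm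
  have hs : s ≠ 0 := by rintro rfl; simp at hs0
  have key : r ^ p = X * s ^ p := by
    refine sub_eq_zero.1 ((transcendental_iff.1 hx) _ ?_)
    rw [map_sub, map_mul, map_pow, map_pow, aeval_X]
    nth_rw 2 [← hz]
    rw [div_pow, div_mul_cancel₀ _ (pow_ne_zero _ hs0), sub_self]
  have hdeg := congrArg natDegree key
  rw [natDegree_mul X_ne_zero (pow_ne_zero _ hs), natDegree_pow, natDegree_pow, natDegree_X] at hdeg
  have h1 : p ∣ 1 := (Nat.dvd_add_left (dvd_mul_right p s.natDegree)).1 ⟨_, hdeg.symm⟩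
  exact hp.one_lt.ne' (Nat.dvd_one.1 h1)

/-- Over a perfect field a separating transcendence basis exists, and comparison with the basis
`{x}` shows that it has one element. -/
lemma exists_separating_element [PerfectField k] {x : K} (hx : Transcendental k x)
    [FiniteDimensional k⟮x⟯ K] : ∃ y : K, Transcendental k y ∧ Algebra.IsSeparable k⟮y⟯ K := by
  have h1 : Algebra.EssFiniteType k k⟮x⟯ := by
    rw [essFiniteType_iff]
    exact fg_adjoin_of_finite (Set.finite_singleton x)
  have h2 : Algebra.EssFiniteType k K := Algebra.EssFiniteType.comp k k⟮x⟯ K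
  obtain ⟨s, hs, hsep⟩ :=
    exists_isTranscendenceBasis_and_isSeparable_of_perfectField (k := k) (K := K)
  have hxb : IsTranscendenceBasis k (Subtype.val : ({x} : Set K) → K) := by
    rw [isTranscendenceBasis_iff_algebraicIndependent_isAlgebraic]
    refine ⟨(algebraicIndependent_singleton_iff ⟨x, rfl⟩).2 hx, ?_⟩
    rw [Subtype.range_coe]
    have : Algebra.IsAlgebraic k⟮x⟯ K := inferInstance
    exact isAlgebraic_adjoin_iff_top.1 this
  have hcard : s.card = 1 := by
    have := hs.cardinalMk_eq hxb
    simpa using this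
  obtain ⟨y, rfl⟩ := Finset.card_eq_one.1 hcard
  rw [Finset.coe_singleton] at hsep
  exact ⟨y, hs.1.transcendental ⟨y, by simp⟩, hsep⟩

lemma finrank_mul_finrank_of_intermediateField {F L : Type*} [Field F] [Field L] [Algebra F L]
    (M : IntermediateField F L) : Module.finrank F M * Module.finrank M L = Module.finrank F L :=
  Module.finrank_mul_finrank F M L

/-- If the differential of `x` is zero, then `x` is a `p`-th power `z ^ p`, and the degree over
`k(z)` is strictly smaller. The descent ends at an element with nonzero differential, over which `K`
is separable. This makes the trace available without raising the degree. -/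
lemma exists_isSeparable_adjoin_finrank_le [PerfectField k] {x : K} (hx : Transcendental k x)
    [FiniteDimensional k⟮x⟯ K] :
    ∃ y : K, Transcendental k y ∧ FiniteDimensional k⟮y⟯ K ∧ Algebra.IsSeparable k⟮y⟯ K ∧
      Module.finrank k⟮y⟯ K ≤ Module.finrank k⟮x⟯ K := by
  rcases CharP.exists' k with h0 | ⟨p, hp, hk⟩
  · have : CharZero k⟮x⟯ := charZero_of_injective_algebraMap (algebraMap k k⟮x⟯).injective
    exact ⟨x, hx, inferInstance, Algebra.IsSeparable.of_integral _ _, le_rfl⟩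
  obtain ⟨y, hy, hsep⟩ := exists_separating_element hx
  obtain ⟨D, hD⟩ := exists_derivation_eq_one hy
  have hyfin : FiniteDimensional k⟮y⟯ K := by
    have h1 : Algebra.EssFiniteType k k⟮x⟯ := by
      rw [essFiniteType_iff]
      exact fg_adjoin_of_finite (Set.finite_singleton x)
    have h2 : Algebra.EssFiniteType k K := Algebra.EssFiniteType.comp k k⟮x⟯ K
    have h3 : Algebra.EssFiniteType k⟮y⟯ K := Algebra.EssFiniteType.of_comp k k⟮y⟯ K
    exact Algebra.finite_of_essFiniteType_of_isAlgebraic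
  induction hn : Module.finrank k⟮x⟯ K using Nat.strong_induction_on generalizing x with
  | _ n ih =>
    subst hn
    by_cases hDx : D x = 0
    · obtain ⟨z, hz⟩ := exists_pow_eq_of_derivation_eq_zero p D hD hDx
      have hzt : Transcendental k z := fun h => hx (hz ▸ h.pow p)
      have hle : k⟮x⟯ ≤ k⟮z⟯ := by
        rw [adjoin_le_iff, Set.singleton_subset_iff, ← hz]
        exact pow_mem (mem_adjoin_simple_self k z) p
      let M : IntermediateField k⟮x⟯ K := extendScalars hle
      have hfin : FiniteDimensional k⟮z⟯ K := inferInstanceAs (FiniteDimensional M K)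
      have hmul : Module.finrank k⟮x⟯ M * Module.finrank M K = Module.finrank k⟮x⟯ K :=
        finrank_mul_finrank_of_intermediateField M
      have hM : Module.finrank k⟮x⟯ M ≠ 1 := by
        intro h
        rw [IntermediateField.finrank_eq_one_iff] at h
        have hzM : z ∈ M := mem_adjoin_simple_self k z
        rw [h, mem_bot] at hzM
        obtain ⟨c, hc⟩ := hzM
        exact notMem_adjoin_of_pow_eq hp.out hx hz (hc ▸ c.2)
      have h1 : 0 < Module.finrank k⟮x⟯ M := Module.finrank_pos
      have h2 : 0 < Module.finrank M K := Module.finrank_pos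
      have hlt : Module.finrank M K < Module.finrank k⟮x⟯ K := by
        rw [← hmul]; nlinarith [Nat.lt_of_le_of_ne h1 hM.symm]
      obtain ⟨w, hw, hw1, hw2, hw3⟩ := ih _ hlt hzt rfl
      exact ⟨w, hw, hw1, hw2, hw3.trans hlt.le⟩
    · exact ⟨x, hx, inferInstance, isSeparable_of_derivation_ne_zero hy D hD hDx, le_rfl⟩


/-! ### Points and places of a function field, and the contradiction on a curve -/

lemma exists_algHom_ker_eq [IsAlgClosed k] {F : Type*} [CommRing F] [Algebra k F]
    [Algebra.FiniteType k F] (m : Ideal F) [hm : m.IsMaximal] :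
    ∃ p : F →ₐ[k] k, RingHom.ker p = m := by
  let := Ideal.Quotient.field m
  have : Algebra.FiniteType k (F ⧸ m) := .of_surjective (Ideal.Quotient.mkₐ k m)
    (Ideal.Quotient.mkₐ_surjective k m)
  have : Module.Finite k (F ⧸ m) := finite_of_finite_type_of_isJacobsonRing k (F ⧸ m)
  have hbij : Function.Bijective (algebraMap k (F ⧸ m)) :=
    IsAlgClosed.algebraMap_bijective_of_isIntegral
  let e : k ≃ₐ[k] F ⧸ m := AlgEquiv.ofBijective (Algebra.ofId k (F ⧸ m)) hbij
  refine ⟨(e.symm : F ⧸ m →ₐ[k] k).comp (Ideal.Quotient.mkₐ k m), ?_⟩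
  ext a
  rw [RingHom.mem_ker]
  change e.symm (Ideal.Quotient.mk m a) = 0 ↔ _
  rw [map_eq_zero_iff _ e.symm.injective, Ideal.Quotient.eq_zero_iff_mem]

/-- With only finitely many points, the product of their maximal ideals would lie in the Jacobson
radical, which is zero. So one of these ideals would vanish, and `F` and `K` would consist of
constants. -/
lemma infinite_algHom [IsAlgClosed k] (F : Subalgebra k K) (hF : F.FG) [IsFractionRing F K] {x : K}
    (hx : Transcendental k x) : Infinite (F →ₐ[k] k) := by
  have : Algebra.FiniteType k F := F.fg_iff_finiteType.1 hF
  by_contra hfin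
  rw [not_infinite_iff_finite] at hfin
  have := Fintype.ofFinite (F →ₐ[k] k)
  have hprod : ∏ p : F →ₐ[k] k, RingHom.ker p ≤ (⊥ : Ideal F) := by
    have hj : Ideal.jacobson (⊥ : Ideal F) = ⊥ := by
      have : IsJacobsonRing F := isJacobsonRing_of_finiteType (A := k)
      exact (this.out Ideal.isPrime_bot.isRadical)
    rw [← hj, Ideal.jacobson]
    refine le_sInf fun m ⟨_, hm⟩ => ?_
    obtain ⟨p, rfl⟩ := exists_algHom_ker_eq (k := k) m
    exact Ideal.prod_le_inf.trans (Finset.inf_le (Finset.mem_univ p))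
  obtain ⟨p, -, hp⟩ := (Ideal.IsPrime.prod_le Ideal.isPrime_bot).1 hprod
  have hinj : Function.Injective p := (RingHom.injective_iff_ker_eq_bot p.toRingHom).2 (le_bot_iff.1 hp)
  have hconst (f : F) : ∃ c : k, algebraMap k K c = f := by
    refine ⟨p f, ?_⟩
    have : algebraMap k F (p f) = f := hinj (by rw [AlgHom.commutes]; rfl)
    conv_rhs => rw [← this]
    rfl
  obtain ⟨a, b, -, hab⟩ := IsFractionRing.div_surjective (A := F) x
  obtain ⟨c, hc⟩ := hconst a
  obtain ⟨d, hd⟩ := hconst b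
  refine hx ?_
  rw [← hab, show algebraMap F K a = algebraMap k K c from hc.symm,
    show algebraMap F K b = algebraMap k K d from hd.symm, ← map_div₀]
  exact isAlgebraic_algebraMap _

/-- An element outside some valuation ring over `k` exists as soon as it is not in the integrally
closed subring `k`. -/
lemma exists_algebraMap_eq_of_forall_mem_valuationSubring [IsAlgClosed k] {a : K}
    (h : ∀ v : ValuationSubring K, (∀ c : k, algebraMap k K c ∈ v) → a ∈ v) :
    ∃ c : k, algebraMap k K c = a := by
  let R : Subring K := (algebraMap k K).range
  have : IsIntegrallyClosedIn R K := by
    rw [Subring.isIntegrallyClosedIn_iff]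
    intro x hx
    have hx' : _root_.IsIntegral k x := by
      obtain ⟨P, hP, hPx⟩ := hx
      have hsurj : Function.Surjective (algebraMap k K).rangeRestrict :=
        (algebraMap k K).rangeRestrict_surjective
      obtain ⟨Q, hQ, -, hQm⟩ := lifts_and_natDegree_eq_and_monic
        (map_surjective _ hsurj P : P ∈ lifts (algebraMap k K).rangeRestrict) hP
      refine ⟨Q, hQm, ?_⟩
      rw [← hQ, eval₂_map] at hPx
      exact hPx
    have := isAlgebraic_adjoin_simple hx'
    obtain ⟨c, hc⟩ := (IsAlgClosed.algebraMap_bijective_of_isIntegral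
      (k := k) (K := k⟮x⟯)).2 (AdjoinSimple.gen k x)
    exact ⟨c, congrArg Subtype.val hc⟩
  by_contra hne
  obtain ⟨v, hv, hav⟩ := Subring.exists_le_valuationSubring_of_isIntegrallyClosedIn
    (R := R) (x := a) fun ⟨c, hc⟩ => hne ⟨c, hc⟩
  exact hav (h v fun c => hv ⟨c, rfl⟩)

/-- The covering provides only `d` points, whereas the hypothesis separates exactly `n`. The gap is
filled with arbitrary new points, and the distinguished last point stays last. -/
lemma exists_injective_extending {P : Type*} [Infinite P] {d n : ℕ} (hd : 0 < d) (hdn : d ≤ n)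
    (p : Fin d → P) (hp : Function.Injective p) : ∃ q : Fin n → P, Function.Injective q ∧
      (∀ i : Fin d, (i : ℕ) + 1 < d → ∃ j : Fin n, (j : ℕ) + 1 < n ∧ q j = p i) ∧
      ∀ j : Fin n, (j : ℕ) + 1 = n → q j = p ⟨d - 1, by omega⟩ := by
  have hinf : ((Set.range p)ᶜ).Infinite := (Set.finite_range p).infinite_compl
  let r := hinf.natEmbedding
  let q : Fin n → P := fun j => if h : (j : ℕ) + 1 < d then p ⟨j, by omega⟩ else
    if (j : ℕ) + 1 = n then p ⟨d - 1, by omega⟩ else r j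
  have hr (m : ℕ) (i : Fin d) : (r m : P) ≠ p i := fun h => (r m).2 ⟨i, h.symm⟩
  refine ⟨q, ?_, ?_, ?_⟩
  · intro a b hab
    simp only [q] at hab
    split_ifs at hab with h1 h2 h3 h4 h5 h6 h7 h8
    · have := congrArg Fin.val (hp hab)
      exact Fin.ext this
    · have := congrArg Fin.val (hp hab)
      simp only at this
      omega
    · exact absurd hab.symm (hr _ _)
    · have := congrArg Fin.val (hp hab)
      simp only at this
      omega
    · exact Fin.ext (by omega)
    · exact absurd hab.symm (hr _ _)
    · exact absurd hab (hr _ _)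
    · exact absurd hab (hr _ _)
    · exact Fin.ext (r.injective (Subtype.ext hab))
  · intro i hi
    refine ⟨⟨i, by omega⟩, by simp only; omega, ?_⟩
    simp only [q]
    rw [dif_pos hi]
  · intro j hj
    simp only [q]
    split_ifs with h1
    · omega
    · rfl

/-- Bounded gonality contradicts separation of points by functions that, after multiplication by
a fixed function, are regular or are coefficients of regular differential forms. -/
theorem false_of_separates_of_finrank_le [IsAlgClosed k] (F : Subalgebra k K) (hF : F.FG)
    [IsFractionRing F K] {γ : ℕ} (hγ : 2 ≤ γ) {x : K} (hx : Transcendental k x)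
    [FiniteDimensional k⟮x⟯ K] (hγx : Module.finrank k⟮x⟯ K ≤ γ) (G : Set F) (h : K) (hh : h ≠ 0)
    (hsep : ∀ p : Fin γ → (F →ₐ[k] k), Function.Injective p → ∃ g ∈ G, ∀ i : Fin γ,
      ((i : ℕ) + 1 < γ → p i g = 0) ∧ ((i : ℕ) + 1 = γ → p i g ≠ 0))
    (hreg : (∃ τ : K, (∀ D : Derivation k K K, D ≠ 0 → D τ ≠ 0) ∧
        ∀ g ∈ G, ∀ v : ValuationSubring K, (∀ c : k, algebraMap k K c ∈ v) →
          ∀ D : Derivation k K K, g * h * D τ ∈ Submodule.span v (D '' v)) ∨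
      ∀ g ∈ G, ∀ v : ValuationSubring K, (∀ c : k, algebraMap k K c ∈ v) → (g : K) * h ∈ v) :
    False := by
  have hinf : Infinite (F →ₐ[k] k) := infinite_algHom F hF hx
  rcases hreg with ⟨τ, hτ, hreg⟩ | hreg
  · obtain ⟨y, hy, hfin, hsepy, hle⟩ := exists_isSeparable_adjoin_finrank_le hx
    obtain ⟨D, hD⟩ := exists_derivation_eq_one hy
    have hDτ : D τ ≠ 0 := hτ D (by rintro rfl; simp at hD)
    let y' : k⟮y⟯ := AdjoinSimple.gen k y
    have hy' : Transcendental k y' :=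
      fun h => hy (IsAlgebraic.algebraMap (S := k⟮y⟯) (A := K) h)
    have hgen : k⟮y'⟯ = ⊤ := by
      rw [eq_top_iff]
      rintro ⟨a, ha⟩ -
      obtain ⟨r, s, rfl⟩ := (mem_adjoin_simple_iff k a).1 ha
      refine (mem_adjoin_simple_iff k _).2 ⟨r, s, Subtype.ext ?_⟩
      change aeval y r / aeval y s = algebraMap k⟮y⟯ K (aeval y' r / aeval y' s)
      rw [map_div₀, ← aeval_algebraMap_apply, ← aeval_algebraMap_apply]
      rfl
    obtain ⟨p, hp, hpt⟩ := exists_points_of_trace_eq_zero hy' hgen F hF (h * D τ)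
      (mul_ne_zero hh hDτ)
    have hpos : 0 < Module.finrank k⟮y⟯ K := Module.finrank_pos
    obtain ⟨q, hq, hq1, hq2⟩ := exists_injective_extending hpos (hle.trans hγx) p hp
    obtain ⟨g, hg, hgq⟩ := hsep q hq
    have htr : Algebra.trace k⟮y⟯ K (g * (h * D τ)) = 0 := by
      rw [← mul_assoc]
      exact trace_eq_zero_of_regular hy' hgen D hD _ τ (hreg g hg)
    have h0 := hpt g (fun i hi => by
      obtain ⟨j, hj, hij⟩ := hq1 i hi
      rw [← hij]
      exact (hgq j).1 hj) htr ⟨Module.finrank k⟮y⟯ K - 1, by omega⟩ (by simp only; omega)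
    refine (hgq ⟨γ - 1, by omega⟩).2 (by simp only; omega) ?_
    rw [hq2 ⟨γ - 1, by omega⟩ (by simp only; omega)]
    exact h0
  · have hconst (g) (hg : g ∈ G) : ∃ c : k, algebraMap k K c = g * h :=
      exists_algebraMap_eq_of_forall_mem_valuationSubring (hreg g hg)
    let q : Fin γ → (F →ₐ[k] k) := fun i => Infinite.natEmbedding _ i
    have hq : Function.Injective q := fun i j hij =>
      Fin.ext ((Infinite.natEmbedding _).injective hij)
    let i₀ : Fin γ := ⟨0, by omega⟩
    let i₁ : Fin γ := ⟨γ - 1, by omega⟩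
    obtain ⟨g, hg, hgq⟩ := hsep q hq
    -- Exchanging the first and the last point yields `g'` that is nonzero where `g` vanishes. But
    -- `g * h` and `g' * h` are constants, so `g` and `g'` are proportional.
    obtain ⟨g', hg', hgq'⟩ := hsep (q ∘ Equiv.swap i₀ i₁) (hq.comp (Equiv.swap i₀ i₁).injective)
    have h1 : q i₁ g ≠ 0 := (hgq i₁).2 (by simp only [i₁]; omega)
    have h2 : q i₀ g = 0 := (hgq i₀).1 (by simp only [i₀]; omega)
    have h3 : q i₀ g' ≠ 0 := by
      have := (hgq' i₁).2 (by simp only [i₁]; omega)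
      simpa using this
    obtain ⟨c, hc⟩ := hconst g hg
    obtain ⟨c', hc'⟩ := hconst g' hg'
    have hc0 : c ≠ 0 := by
      rintro rfl
      rw [map_zero, eq_comm, mul_eq_zero] at hc
      have : g = 0 := Subtype.ext (hc.resolve_right hh)
      rw [this, map_zero] at h1
      exact h1 rfl
    have key : c • g' = c' • g := by
      refine Subtype.ext (mul_right_cancel₀ hh ?_)
      change (c • (g' : K)) * h = (c' • (g : K)) * h
      rw [Algebra.smul_mul_assoc, Algebra.smul_mul_assoc, ← hc, ← hc', Algebra.smul_def,
        Algebra.smul_def, mul_comm]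
    have := congrArg (q i₀) key
    rw [map_smul, map_smul, h2, smul_zero, smul_eq_mul, mul_eq_zero] at this
    exact this.elim hc0 h3

end

end

noncomputable section

/-! ### Derivations prescribed on the base and on an étale coordinate -/

section EtaleCoordinate

open Polynomial

variable {k A R : Type*} [CommRing k] [CommRing A] [CommRing R] [Algebra k A] [Algebra k R]
  [Algebra A R] [IsScalarTower k A R]

/-- The linear map underlying the derivation of a polynomial ring prescribed on the coefficients
and on the variable. -/
def polynomialDerivationAux (δ : Derivation k A R) (t r : R) : A[X] →ₗ[k] R where
  toFun p := p.sum (fun i a => δ a * t ^ i) + aeval t (derivative p) * r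
  map_add' p q := by
    rw [sum_add_index _ _ _ (by simp) (by intros; rw [map_add, add_mul]), derivative_add, map_add]
    ring
  map_smul' c p := by
    rw [sum_smul_index' _ _ _ (by simp), derivative_smul]
    simp only [δ.map_smul, RingHom.id_apply, smul_add, smul_mul_assoc, Polynomial.sum_def,
      Finset.smul_sum]
    rw [← IsScalarTower.algebraMap_smul A c (derivative p), map_smul, algebraMap_smul,
      smul_mul_assoc]

lemma polynomialDerivationAux_monomial (δ : Derivation k A R) (t r : R) (n : ℕ) (a : A) :
    polynomialDerivationAux δ t r (monomial n a) =
      δ a * t ^ n + algebraMap A R a * n * t ^ (n - 1) * r := by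
  change (monomial n a).sum (fun i a => δ a * t ^ i) + aeval t (derivative (monomial n a)) * r = _
  rw [sum_monomial_index _ _ (by simp), derivative_monomial, aeval_monomial, map_mul, map_natCast]

lemma polynomialDerivationAux_mul (δ : Derivation k A R) (t r : R) (p q : A[X]) :
    polynomialDerivationAux δ t r (p * q) =
      aeval t p * polynomialDerivationAux δ t r q + aeval t q * polynomialDerivationAux δ t r p := by
  induction p using Polynomial.induction_on' with
  | add p p' hp hp' => simp only [add_mul, map_add, hp, hp']; ring
  | monomial n a =>
    induction q using Polynomial.induction_on' with
    | add p p' hp hp' => simp only [mul_add, map_add, hp, hp']; ring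
    | monomial m b =>
      rw [monomial_mul_monomial]
      simp only [polynomialDerivationAux_monomial, aeval_monomial, δ.leibniz, Algebra.smul_def,
        map_mul]
      rcases n with _ | n <;> rcases m with _ | m
      · simp
      · simp
        ring
      · simp
        ring
      · rw [show n + 1 + (m + 1) - 1 = n + m + 1 by omega]
        push_cast
        ring

/-- On `A[X]` a derivation may be prescribed freely on the coefficients and on the variable;
étaleness extends it to `R`. -/
lemma exists_derivation_of_etale (t : R) (ht : (aeval t : A[X] →ₐ[A] R).toRingHom.Etale)
    (δ : Derivation k A R) (r : R) :
    ∃ D : Derivation k R R, (∀ a, D (algebraMap A R a) = δ a) ∧ D t = r := by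
  let alg := (aeval t : A[X] →ₐ[A] R).toRingHom.toAlgebra
  have : Algebra.Etale A[X] R := ht
  have : IsScalarTower k A[X] R := .of_algebraMap_eq fun c => by
    change _ = aeval t (algebraMap k A[X] c)
    rw [IsScalarTower.algebraMap_apply k A A[X], ← C_eq_algebraMap, aeval_C,
      ← IsScalarTower.algebraMap_apply]
  let d : Derivation k A[X] R := Derivation.mk' (polynomialDerivationAux δ t r)
    (polynomialDerivationAux_mul δ t r)
  obtain ⟨D, hD⟩ := exists_derivation_extending_of_formallyEtale (k := k) (S := A[X]) (T := R) d
  refine ⟨D, fun a => ?_, ?_⟩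
  · have h1 : algebraMap A[X] R (monomial 0 a) = algebraMap A R a := by
      change aeval t (monomial 0 a) = _
      simp
    rw [← h1, hD]
    change polynomialDerivationAux δ t r _ = _
    rw [polynomialDerivationAux_monomial]
    simp
  · have h1 : algebraMap A[X] R (monomial 1 1) = t := by
      change aeval t (monomial 1 1) = _
      simp
    conv_lhs => rw [← h1, hD]
    change polynomialDerivationAux δ t r _ = _
    rw [polynomialDerivationAux_monomial]
    simp

lemma derivation_ext_of_etale (t : R) (ht : (aeval t : A[X] →ₐ[A] R).toRingHom.Etale) {M : Type*}
    [AddCommGroup M] [Module k M] [Module R M] [IsScalarTower k R M] {D₁ D₂ : Derivation k R M}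
    (h : ∀ a, D₁ (algebraMap A R a) = D₂ (algebraMap A R a)) (h' : D₁ t = D₂ t) : D₁ = D₂ := by
  let alg := (aeval t : A[X] →ₐ[A] R).toRingHom.toAlgebra
  have : Algebra.Etale A[X] R := ht
  have : IsScalarTower k A[X] R := .of_algebraMap_eq fun c => by
    change _ = aeval t (algebraMap k A[X] c)
    rw [IsScalarTower.algebraMap_apply k A A[X], ← C_eq_algebraMap, aeval_C,
      ← IsScalarTower.algebraMap_apply]
  refine derivation_ext_of_formallyEtale (k := k) (S := A[X]) fun p => ?_
  change D₁ (aeval t p) = D₂ (aeval t p)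
  induction p using Polynomial.induction_on' with
  | add p q hp hq => rw [map_add, map_add, map_add, hp, hq]
  | monomial n a => rw [aeval_monomial, D₁.leibniz, D₂.leibniz, D₁.leibniz_pow, D₂.leibniz_pow, h, h']

end EtaleCoordinate

/-! ### Evaluation of forms on derivations in relative coordinates -/

section Coordinates

open Polynomial

variable {k A K : Type*} [Field k] [CommRing A] [Field K] [Algebra k A] [Algebra k K] [Algebra A K]
  [IsScalarTower k A K]

/-- Derivations of `K` that preserve the image of `A`. -/
def IsStableOn (A : Type*) [CommRing A] [Algebra A K] (D : Derivation k K K) : Prop :=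
  ∀ a : A, ∃ a' : A, D (algebraMap A K a) = algebraMap A K a'

/-- `t` behaves like an étale coordinate relative to `A` on the subring `R` of `K`. -/
structure IsRelativeCoordinate (A : Type*) [CommRing A] [Algebra k A] [Algebra A K]
    (R : Subalgebra k K) (t : K) : Prop where
  exists_extension : ∀ δ : Derivation k A A, ∃ D' : Derivation k K K,
    (∀ a : A, D' (algebraMap A K a) = algebraMap A K (δ a)) ∧ D' t = 0
  exists_stable : ∀ D : Derivation k K K, IsStableOn A D → ∃ D' : Derivation k K K,
    (∀ a : A, D' (algebraMap A K a) = D (algebraMap A K a)) ∧ D' t = 0 ∧ ∀ r ∈ R, D' r ∈ R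
  exists_vertical : ∃ D : Derivation k K K,
    (∀ a : A, D (algebraMap A K a) = 0) ∧ D t = 1 ∧ ∀ r ∈ R, D r ∈ R
  ext : ∀ D₁ D₂ : Derivation k K K, (∀ a : A, D₁ (algebraMap A K a) = D₂ (algebraMap A K a)) →
    D₁ t = D₂ t → D₁ = D₂

/-- A derivation given on `A` and on `t` with values in `R` extends to `R` by étaleness and then to
the localization `K`, still preserving `R`. The properties of a coordinate are special cases of
this. -/
lemma isRelativeCoordinate_of_etale {R : Type*} [CommRing R] [Algebra k R] [Algebra A R]
    [Algebra R K] [IsScalarTower k A R] [IsScalarTower k R K] [IsScalarTower A R K]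
    [IsFractionRing R K] (hA : Function.Injective (algebraMap A K)) (t : R)
    (ht : (aeval t : A[X] →ₐ[A] R).toRingHom.Etale) :
    IsRelativeCoordinate (k := k) A (IsScalarTower.toAlgHom k R K).range (algebraMap R K t) := by
  have hfe : Algebra.FormallyEtale R K := Algebra.FormallyEtale.of_isLocalization (nonZeroDivisors R)
  have key (δ : Derivation k A R) (r : R) : ∃ D : Derivation k K K,
      (∀ a, D (algebraMap A K a) = algebraMap R K (δ a)) ∧ D (algebraMap R K t) = algebraMap R K r ∧
        ∀ s ∈ (IsScalarTower.toAlgHom k R K).range, D s ∈ (IsScalarTower.toAlgHom k R K).range := by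
    obtain ⟨D₀, hD₀, hD₀t⟩ := exists_derivation_of_etale t ht δ r
    obtain ⟨D, hD⟩ := exists_derivation_extending_of_formallyEtale (k := k) (S := R) (T := K)
      ((Algebra.linearMap R K).compDer D₀)
    have hD' (s : R) : D (algebraMap R K s) = algebraMap R K (D₀ s) := hD s
    refine ⟨D, fun a => ?_, ?_, ?_⟩
    · rw [IsScalarTower.algebraMap_apply A R K, hD', hD₀]
    · rw [hD', hD₀t]
    · rintro _ ⟨s, rfl⟩
      exact ⟨D₀ s, (hD' s).symm⟩
  refine ⟨fun δ => ?_, fun D hD => ?_, ?_, fun D₁ D₂ h1 h2 => ?_⟩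
  · obtain ⟨D', h1, h2, -⟩ := key ((Algebra.linearMap A R).compDer δ) 0
    refine ⟨D', fun a => ?_, by rw [h2, map_zero]⟩
    rw [h1]
    exact (IsScalarTower.algebraMap_apply A R K _).symm
  · choose δ hδ using hD
    have hsm (c : k) (a : A) : algebraMap A K (c • a) = c • algebraMap A K a :=
      map_smul (IsScalarTower.toAlgHom k A K) c a
    -- As `A` embeds in `K`, a derivation of `K` that preserves its image comes from a derivation of
    -- `A`.
    let δ' : Derivation k A A := Derivation.mk'
      { toFun := δ
        map_add' := fun a b => hA (by rw [← hδ, map_add, map_add, map_add, hδ, hδ])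
        map_smul' := fun c a => hA (by
          rw [← hδ, hsm, D.map_smul, hδ, RingHom.id_apply, hsm]) }
      (fun a b => hA (by
        change algebraMap A K (δ (a * b)) = algebraMap A K (a * δ b + b * δ a)
        rw [← hδ, map_mul, D.leibniz, hδ, hδ, map_add, map_mul, map_mul, smul_eq_mul, smul_eq_mul]))
    obtain ⟨D', h1, h2, h3⟩ := key ((Algebra.linearMap A R).compDer δ') 0
    refine ⟨D', fun a => ?_, by rw [h2, map_zero], h3⟩
    rw [h1, hδ]
    exact (IsScalarTower.algebraMap_apply A R K _).symm
  · obtain ⟨D', h1, h2, h3⟩ := key 0 1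
    exact ⟨D', fun a => by rw [h1]; simp, by rw [h2, map_one], h3⟩
  · refine derivation_ext_of_formallyEtale (k := k) (S := R) fun s => ?_
    have := derivation_ext_of_etale (k := k) t ht (D₁ := D₁.compAlgebraMap R)
      (D₂ := D₂.compAlgebraMap R) (fun a => ?_) h2
    · exact DFunLike.congr_fun this s
    · have := h1 a
      rw [IsScalarTower.algebraMap_apply A R K] at this
      exact this

/-- Evaluation of a `q`-form on `q` derivations. -/
def evalForm (K : Type*) [Field K] [Algebra k K] (q : ℕ) :
    MultilinearMap K (fun _ : Fin q => Derivation k K K) (Module.Dual K (⋀[K]^q Ω[K⁄k])) :=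
  (exteriorPower.alternatingMapToDual K Ω[K⁄k] q).toMultilinearMap.compLinearMap fun _ =>
    (KaehlerDifferential.linearMapEquivDerivation k K).symm.toLinearMap

lemma evalForm_apply_ιMulti {q : ℕ} (D : Fin q → Derivation k K K) (x : Fin q → K) :
    evalForm K q D (exteriorPower.ιMulti K q fun i => KaehlerDifferential.D k K (x i)) =
      (Matrix.of fun i j => D j (x i)).det := by
  change exteriorPower.alternatingMapToDual K Ω[K⁄k] q (fun j => (D j).liftKaehlerDifferential) _ = _
  rw [exteriorPower.alternatingMapToDual_apply_ιMulti]
  simp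

/-- The coordinates of `ω` in a basis of the exterior power are its values on tuples of dual
derivations, and by multilinearity vanishing on a spanning set implies vanishing on all tuples. -/
lemma exists_evalForm_ne_zero [Module.Finite K Ω[K⁄k]] {q : ℕ} {ω : ⋀[K]^q Ω[K⁄k]} (hω : ω ≠ 0)
    {S : Set (Derivation k K K)} (hS : Submodule.span K S = ⊤) :
    ∃ D : Fin q → Derivation k K K, (∀ j, D j ∈ S) ∧ evalForm K q D ω ≠ 0 := by
  classical
  by_contra! hall
  let b := Module.finBasis K Ω[K⁄k]
  have hzero (D : Fin q → Derivation k K K) : evalForm K q D ω = 0 := by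
    let β := Module.Basis.ofSpan hS.ge
    have h0 : (LinearMap.applyₗ ω).compMultilinearMap (evalForm (k := k) K q) = 0 :=
      Module.Basis.ext_multilinear (fun _ => β) fun v => by
        refine hall _ fun j => ?_
        exact Module.Basis.ofSpan_subset hS.ge ⟨v j, rfl⟩
    exact DFunLike.congr_fun h0 D
  refine hω ((b.exteriorPower q).repr.injective ?_)
  ext s
  rw [exteriorPower.basis_repr_apply, map_zero, Finsupp.zero_apply, exteriorPower.ιMultiDual,
    exteriorPower.ιMulti_family, exteriorPower.pairingDual,
    exteriorPower.alternatingMapLinearEquiv_apply_ιMulti]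
  have := hzero fun j => KaehlerDifferential.linearMapEquivDerivation k K
    (b.coord (Set.powersetCard.ofFinEmbEquiv.symm s j))
  change exteriorPower.alternatingMapToDual K Ω[K⁄k] q (fun j =>
    (KaehlerDifferential.linearMapEquivDerivation k K).symm _) ω = 0 at this
  simp only [LinearEquiv.symm_apply_apply] at this
  exact this

/-- The forms on `K` that are combinations, with coefficients in `R`, of exterior products of
differentials of elements of `R`. -/
def regularForms (R : Subalgebra k K) (q : ℕ) : AddSubgroup (⋀[K]^q Ω[K⁄k]) :=
  AddSubgroup.closure {θ | ∃ (r : K) (x : Fin q → K), r ∈ R ∧ (∀ i, x i ∈ R) ∧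
    θ = r • exteriorPower.ιMulti K q fun i => KaehlerDifferential.D k K (x i)}

/-- This is how a `q`-form yields functions or 1-forms along the fibres; `h` and the alternative are
chosen once for all charts. If `ω` is nonzero on a tuple containing the vertical `V`, let `h` be its
value. In a chart, `V` is `V t` times the derivation along `t`, and the other members preserve `R`
up to multiples of that derivation, which drop out since the form is alternating; hence the factor
`r * V t`. If `ω` vanishes on all tuples containing `V`, let `h` be any nonzero value. The tuple can
be changed by multiples of `V` until it preserves `R`, so `u * h` lies in `R`. -/
lemma exists_coordinate_function [Module.Finite K Ω[K⁄k]]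
    (hspan : Submodule.span K {D : Derivation k K K | IsStableOn A D} = ⊤)
    (V : Derivation k K K) (hV : ∀ a : A, V (algebraMap A K a) = 0) {q : ℕ}
    {ω : ⋀[K]^q Ω[K⁄k]} (hω : ω ≠ 0) :
    ∃ h : K, h ≠ 0 ∧
      ((∀ (R : Subalgebra k K) (t : K), IsRelativeCoordinate A R t → ∀ u : K,
          u • ω ∈ regularForms R q → ∃ r ∈ R, u * h = r * V t) ∨
        ∀ (R : Subalgebra k K) (t : K), IsRelativeCoordinate A R t → V t ≠ 0 → ∀ u : K,
          u • ω ∈ regularForms R q → u * h ∈ R) := by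
  by_cases hcase : ∃ D : Fin q → Derivation k K K, (∀ j, IsStableOn A (D j)) ∧ (∃ j, D j = V) ∧
      evalForm K q D ω ≠ 0
  · obtain ⟨D, hD, ⟨l, hl⟩, hne⟩ := hcase
    refine ⟨_, hne, .inl fun R t ht u hu => ?_⟩
    choose D' hD'A hD't hD'R using fun j => ht.exists_stable (D j) (hD j)
    obtain ⟨V', hV'A, hV't, hV'R⟩ := ht.exists_vertical
    have hVV' : V = V t • V' := ht.ext _ _ (fun a => by
      rw [hV, Derivation.smul_apply, hV'A, smul_zero]) (by
      rw [Derivation.smul_apply, hV't, smul_eq_mul, mul_one])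
    have hDD' (j) : D j = D' j + D j t • V' := ht.ext _ _ (fun a => by
      rw [Derivation.add_apply, Derivation.smul_apply, hV'A, smul_zero, add_zero, hD'A]) (by
      rw [Derivation.add_apply, Derivation.smul_apply, hV't, hD't, zero_add, smul_eq_mul, mul_one])
    have key : ∀ θ ∈ regularForms R q, ∃ r ∈ R, evalForm K q D θ = r * V t := by
      intro θ hθ
      induction hθ using AddSubgroup.closure_induction with
      | zero => exact ⟨0, R.zero_mem, by simp⟩
      | add a b _ _ ha hb =>
        obtain ⟨r, hr, hr'⟩ := ha
        obtain ⟨s, hs, hs'⟩ := hb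
        exact ⟨r + s, R.add_mem hr hs, by rw [map_add, hr', hs', add_mul]⟩
      | neg a _ ha =>
        obtain ⟨r, hr, hr'⟩ := ha
        exact ⟨-r, R.neg_mem hr, by rw [map_neg, hr', neg_mul]⟩
      | mem θ hθ =>
        obtain ⟨r, x, hr, hx, rfl⟩ := hθ
        -- All rows are values of derivations that preserve `R`, so the determinant lies in `R`. It
        -- remains to compare it with the determinant for the original tuple.
        let M : Matrix (Fin q) (Fin q) K := .of fun j i => if j = l then V' (x i) else D' j (x i)
        have hM : M.det ∈ R := by
          rw [Matrix.det_apply]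
          refine R.sum_mem fun σ _ => ?_
          have : ∏ i, M (σ i) i ∈ R := R.prod_mem fun i _ => by
            simp only [M, Matrix.of_apply]
            split_ifs
            · exact hV'R _ (hx i)
            · exact hD'R _ _ (hx i)
          rw [Units.smul_def]
          exact zsmul_mem this _
        refine ⟨r * M.det, R.mul_mem hr hM, ?_⟩
        rw [map_smul, evalForm_apply_ιMulti, smul_eq_mul, mul_assoc]
        congr 1
        rw [← Matrix.det_transpose]
        have h1 : (Matrix.of fun j i => if j = l then V t * V' (x i) else D j (x i)).det =
            V t * M.det := by
          have h2 : (Matrix.of fun j i => if j = l then V t * V' (x i) else D j (x i)) =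
              Matrix.updateRow (Matrix.of fun j i => if j = l then V' (x i) else D j (x i)) l
                (V t • fun i => V' (x i)) := by
            ext j i
            by_cases hj : j = l
            · subst hj; simp
            · simp [hj]
          rw [h2, Matrix.det_updateRow_smul]
          congr 1
          -- Replacing `D j` by `D' j` subtracts a multiple of row `l` from row `j`.
          refine Matrix.det_eq_of_forall_row_eq_smul_add_const
            (fun j => if j = l then 0 else D j t) l (by simp) fun j i => ?_
          by_cases hj : j = l
          · subst hj; simp [M]
          · simp only [Matrix.updateRow_ne hj, Matrix.of_apply, M, if_neg hj, if_true]
            conv_lhs => rw [hDD' j]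
            rfl
        rw [mul_comm, ← h1]
        congr 1
        ext j i
        by_cases hj : j = l
        · subst hj
          simp only [Matrix.transpose_apply, Matrix.of_apply, if_true, hl]
          conv_lhs => rw [hVV']
          rfl
        · simp [hj]
    obtain ⟨r, hr, hr'⟩ := key _ hu
    exact ⟨r, hr, by rw [← hr', map_smul, smul_eq_mul]⟩
  · push Not at hcase
    obtain ⟨D, hD, hne⟩ := exists_evalForm_ne_zero hω hspan
    refine ⟨_, hne, .inr fun R t ht hVt u hu => ?_⟩
    choose D' hD'A hD't hD'R using fun j => ht.exists_stable (D j) (hD j)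
    have hDD' (j) : D j = D' j + (D j t * (V t)⁻¹) • V := ht.ext _ _ (fun a => by
      rw [Derivation.add_apply, Derivation.smul_apply, hV, smul_zero, add_zero, hD'A]) (by
      rw [Derivation.add_apply, Derivation.smul_apply, hD't, zero_add, smul_eq_mul,
        inv_mul_cancel_right₀ hVt])
    have hD' (j) : IsStableOn A (D' j) := fun a => by rw [hD'A]; exact hD j a
    have hVs : IsStableOn A V := fun a => ⟨0, by rw [hV, map_zero]⟩
    -- Each replacement of `D j` by `D' j` changes the value by a multiple of a value on a tuple
    -- containing `V`, which is zero in this case.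
    have hswap (s : Finset (Fin q)) :
        evalForm K q (fun j => if j ∈ s then D' j else D j) ω = evalForm K q D ω := by
      induction s using Finset.induction_on with
      | empty => simp
      | insert j s hj ih =>
        rw [← ih]
        let E : Fin q → Derivation k K K := fun j => if j ∈ s then D' j else D j
        have h1 : (fun i => if i ∈ insert j s then D' i else D i) = Function.update E j (D' j) := by
          funext i
          by_cases hi : i = j
          · subst hi; simp
          · simp [hi, E]
        have h2 : E = Function.update E j (D' j + (D j t * (V t)⁻¹) • V) := by
          rw [← hDD', eq_comm, Function.update_eq_self_iff]
          simp [E, hj]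
        rw [h1]
        change _ = evalForm K q E ω
        conv_rhs => rw [h2]
        rw [MultilinearMap.map_update_add, MultilinearMap.map_update_smul, LinearMap.add_apply,
          LinearMap.smul_apply, hcase (Function.update E j V) (fun i => ?_) ⟨j, by simp⟩, smul_zero,
          add_zero]
        by_cases hi : i = j
        · subst hi; simpa using hVs
        · rw [Function.update_of_ne hi]
          simp only [E]
          split_ifs
          · exact hD' i
          · exact hD i
    have h1 : evalForm K q D ω = evalForm K q D' ω := by
      rw [← hswap Finset.univ]
      simp
    have key : ∀ θ ∈ regularForms R q, evalForm K q D' θ ∈ R := by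
      intro θ hθ
      induction hθ using AddSubgroup.closure_induction with
      | zero => rw [map_zero]; exact R.zero_mem
      | add a b _ _ ha hb => rw [map_add]; exact R.add_mem ha hb
      | neg a _ ha => rw [map_neg]; exact R.neg_mem ha
      | mem θ hθ =>
        obtain ⟨r, x, hr, hx, rfl⟩ := hθ
        rw [map_smul, evalForm_apply_ιMulti, smul_eq_mul, Matrix.det_apply]
        refine R.mul_mem hr (R.sum_mem fun σ _ => ?_)
        rw [Units.smul_def]
        exact zsmul_mem (R.prod_mem fun i _ => hD'R _ _ (hx _)) _
    have := key _ hu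
    rwa [map_smul, smul_eq_mul, ← h1] at this

/-- Derivations of `K` that preserve `A` span all derivations. -/
lemma span_isStableOn_eq_top [IsDomain A] [Algebra.FiniteType k A]
    (hA : Function.Injective (algebraMap A K)) {R : Subalgebra k K} {t : K}
    (ht : IsRelativeCoordinate A R t) :
    Submodule.span K {D : Derivation k K K | IsStableOn A D} = ⊤ := by
  classical
  have : FaithfulSMul A K := (faithfulSMul_iff_algebraMap_injective _ _).2 hA
  let L := FractionRing A
  let := FractionRing.liftAlgebra A K
  have t1 : IsScalarTower A L K := FractionRing.isScalarTower_liftAlgebra A K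
  have t2 : IsScalarTower k L K := .of_algebraMap_eq fun c => by
    rw [IsScalarTower.algebraMap_apply k A L, ← IsScalarTower.algebraMap_apply A L K,
      ← IsScalarTower.algebraMap_apply]
  have : Algebra.EssFiniteType A L := Algebra.EssFiniteType.of_isLocalization L (nonZeroDivisors A)
  have : Algebra.EssFiniteType k L := Algebra.EssFiniteType.comp k A L
  let b := Module.finBasis L Ω[L⁄k]
  let δ (j) : Derivation k L L := (b.coord j).compDer (KaehlerDifferential.D k L)
  have hδ (j) : ∃ (c : A) (δ' : Derivation k A A), c ≠ 0 ∧
      ∀ a, algebraMap A L (δ' a) = algebraMap A L c * δ j (algebraMap A L a) := by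
    obtain ⟨s, hs⟩ := (‹Algebra.FiniteType k A›).out
    obtain ⟨c, hc⟩ := IsLocalization.exist_integer_multiples_of_finset (nonZeroDivisors A)
      (s.image fun a => δ j (algebraMap A L a))
    have hmem (a : A) : ∃ a', algebraMap A L a' = algebraMap A L c * δ j (algebraMap A L a) := by
      have ha : a ∈ Algebra.adjoin k (s : Set A) := hs ▸ Algebra.mem_top
      induction ha using Algebra.adjoin_induction with
      | mem a ha =>
        obtain ⟨a', ha'⟩ := hc _ (Finset.mem_image_of_mem _ ha)
        exact ⟨a', by rw [ha', Algebra.smul_def]⟩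
      | algebraMap c =>
        exact ⟨0, by rw [← IsScalarTower.algebraMap_apply, Derivation.map_algebraMap, mul_zero,
          map_zero]⟩
      | add x y _ _ hx hy =>
        obtain ⟨x', hx'⟩ := hx
        obtain ⟨y', hy'⟩ := hy
        exact ⟨x' + y', by rw [map_add, map_add, map_add, mul_add, hx', hy']⟩
      | mul x y _ _ hx hy =>
        obtain ⟨x', hx'⟩ := hx
        obtain ⟨y', hy'⟩ := hy
        refine ⟨x * y' + y * x', ?_⟩
        rw [map_mul, Derivation.leibniz, map_add, map_mul, map_mul, hx', hy', smul_eq_mul,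
          smul_eq_mul]
        ring
    choose d hd using hmem
    have hinj := IsFractionRing.injective A L
    have hsm (c : k) (a : A) : algebraMap A L (c • a) = c • algebraMap A L a :=
      map_smul (IsScalarTower.toAlgHom k A L) c a
    refine ⟨c, Derivation.mk'
      { toFun := d
        map_add' := fun x y => hinj (by rw [map_add, hd, hd, hd, map_add, map_add, mul_add])
        map_smul' := fun e a => hinj (by
          rw [RingHom.id_apply, hsm, hd, hd, hsm, (δ j).map_smul, mul_smul_comm]) }
      fun x y => hinj ?_, nonZeroDivisors.coe_ne_zero c, hd⟩
    change algebraMap A L (d (x * y)) = algebraMap A L (x * d y + y * d x)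
    rw [hd, map_mul, Derivation.leibniz, map_add, map_mul, map_mul, hd, hd, smul_eq_mul,
      smul_eq_mul]
    ring
  choose c δ' hc0 hδ' using hδ
  choose D' hD' hD't using fun j => ht.exists_extension (δ' j)
  obtain ⟨V, hV, hVt, -⟩ := ht.exists_vertical
  rw [eq_top_iff]
  rintro D -
  let l := (D.compAlgebraMap L).liftKaehlerDifferential
  have hl (a : L) : D (algebraMap L K a) = l (KaehlerDifferential.D k L a) :=
    ((D.compAlgebraMap L).liftKaehlerDifferential_comp_D a).symm
  have hcK (j) : algebraMap A K (c j) ≠ 0 := fun h => hc0 j (hA (by rw [h, map_zero]))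
  -- The sum agrees with `D` on `A`, by the expansion of differentials of `A` in the basis `b`, and
  -- vanishes on `t`; the multiple of `V` corrects the value at `t`.
  have hD : D = ∑ j, ((algebraMap A K (c j))⁻¹ * l (b j)) • D' j + D t • V := by
    have hsum (x : K) (E : _ → Derivation k K K) :
        (∑ j, E j) x = ∑ j : Fin (Module.finrank L Ω[L⁄k]), E j x := by
      rw [← Derivation.coeFnAddMonoidHom_apply, map_sum, Finset.sum_apply]
      rfl
    refine ht.ext _ _ (fun a => ?_) ?_
    · rw [Derivation.add_apply, Derivation.smul_apply, hV, smul_zero, add_zero, hsum,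
        IsScalarTower.algebraMap_apply A L K, hl, ← b.sum_repr (KaehlerDifferential.D k L _), map_sum]
      refine Finset.sum_congr rfl fun j _ => ?_
      rw [map_smul, Derivation.smul_apply, ← IsScalarTower.algebraMap_apply A L K, hD',
        IsScalarTower.algebraMap_apply A L K (δ' j a), hδ', map_mul,
        ← IsScalarTower.algebraMap_apply A L K, smul_eq_mul, Algebra.smul_def]
      change algebraMap L K (δ j _) * _ = _
      field_simp [hcK j]
    · rw [Derivation.add_apply, Derivation.smul_apply, hVt, hsum]
      simp [hD't]
  rw [hD]
  refine Submodule.add_mem _ (Submodule.sum_mem _ fun j _ => Submodule.smul_mem _ _ ?_)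
    (Submodule.smul_mem _ _ ?_)
  · exact Submodule.subset_span fun a => ⟨_, hD' j a⟩
  · exact Submodule.subset_span fun a => ⟨0, by rw [hV, map_zero]⟩

end Coordinates

end

noncomputable section

/-! ### Irreducibility of polynomials under specialization -/

section Factorization

open Polynomial

/-- The polynomial in two variables, monic of degree `i` in the second one, with given
coefficients. -/
def monicBivariate {S : Type*} [CommRing S] (i N : ℕ) (g : ℕ → ℕ → S) : S[X][X] :=
  X ^ i + ∑ j ∈ Finset.range i, C (∑ l ∈ Finset.range (N + 1), C (g j l) * X ^ l) * X ^ j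

lemma monicBivariate_map {S T : Type*} [CommRing S] [CommRing T] (φ : S →+* T) (i N : ℕ)
    (g : ℕ → ℕ → S) : (monicBivariate i N g).map (mapRingHom φ) =
      monicBivariate i N fun j l => φ (g j l) := by
  simp [monicBivariate, Polynomial.map_sum]

lemma monicBivariate_degree_lt {S : Type*} [CommRing S] (i N : ℕ) (g : ℕ → ℕ → S) :
    (∑ j ∈ Finset.range i, C (∑ l ∈ Finset.range (N + 1), C (g j l) * X ^ l) * X ^ j :
      S[X][X]).degree < i := by
  rw [degree_lt_iff_coeff_zero]
  intro m hm
  rw [finsetSum_coeff]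
  refine Finset.sum_eq_zero fun j hj => ?_
  rw [coeff_C_mul_X_pow, if_neg]
  rintro rfl
  exact absurd (Finset.mem_range.1 hj) (not_lt.2 hm)

lemma monic_monicBivariate {S : Type*} [CommRing S] (i N : ℕ) (g : ℕ → ℕ → S) :
    (monicBivariate i N g).Monic := monic_X_pow_add (monicBivariate_degree_lt i N g)

lemma natDegree_monicBivariate {S : Type*} [CommRing S] [Nontrivial S] (i N : ℕ) (g : ℕ → ℕ → S) :
    (monicBivariate i N g).natDegree = i := by
  rw [monicBivariate, natDegree_add_eq_left_of_degree_lt, natDegree_X_pow]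
  rw [degree_X_pow]
  exact monicBivariate_degree_lt i N g

lemma monicBivariate_coeff {S : Type*} [CommRing S] {N : ℕ} {G : S[X][X]} (hG : G.Monic)
    (hN : ∀ j, (G.coeff j).natDegree ≤ N) :
    monicBivariate G.natDegree N (fun j l => (G.coeff j).coeff l) = G := by
  conv_rhs => rw [hG.as_sum]
  rw [monicBivariate]
  congr 1
  refine Finset.sum_congr rfl fun j _ => ?_
  conv_rhs => rw [as_sum_range_C_mul_X_pow' (G.coeff j) (Nat.lt_succ_of_le (hN j))]

lemma coeff_coeff_swap {S : Type*} [CommRing S] (p : S[X][X]) (i j : ℕ) :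
    ((Bivariate.swap p).coeff i).coeff j = (p.coeff j).coeff i := by
  induction p using Polynomial.induction_on' with
  | add p q hp hq => simp only [map_add, coeff_add, hp, hq]
  | monomial n f =>
    induction f using Polynomial.induction_on' with
    | add p q hp hq => simp only [map_add, coeff_add, hp, hq]
    | monomial m r =>
      rw [Bivariate.swap_monomial_monomial]
      simp only [coeff_monomial]
      by_cases h1 : m = i <;> by_cases h2 : n = j <;> simp [h1, h2, coeff_monomial]

/-- After the two variables are exchanged, the degree in the inner one is additive on products. Thus
a factorization has a bounded number of unknown coefficients. -/
lemma natDegree_coeff_le_of_mul_eq {K : Type*} [Field K] {G H P : K[X][X]} (h : G * H = P)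
    (hP : P ≠ 0) {N : ℕ} (hN : ∀ j, (P.coeff j).natDegree ≤ N) (j : ℕ) :
    (G.coeff j).natDegree ≤ N := by
  have h1 : (Bivariate.swap P).natDegree ≤ N := by
    rw [natDegree_le_iff_coeff_eq_zero]
    intro l hl
    ext j
    rw [coeff_coeff_swap, coeff_zero]
    exact coeff_eq_zero_of_natDegree_lt ((hN j).trans_lt hl)
  have hG : G ≠ 0 := by rintro rfl; exact hP (by rw [← h, zero_mul])
  have hH : H ≠ 0 := by rintro rfl; exact hP (by rw [← h, mul_zero])
  have h2 : (Bivariate.swap G).natDegree ≤ N := by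
    rw [← h, map_mul, natDegree_mul (by simpa using hG) (by simpa using hH)] at h1
    omega
  rw [natDegree_le_iff_coeff_eq_zero]
  intro l hl
  rw [← coeff_coeff_swap, coeff_eq_zero_of_natDegree_lt (h2.trans_lt hl), coeff_zero]

/-- Factorizations of a fixed shape appear only on a proper closed subset. -/
lemma exists_ne_zero_forall_natDegree_ne {A : Type u} [CommRing A] [IsDomain A] (P : A[X][X])
    (hP : P.Monic)
    (h : ∀ (K : Type u) [Field K] (φ : A →+* K), Function.Injective φ →
      Irreducible (P.map (mapRingHom φ))) (i : ℕ) (hi0 : 0 < i) (hi : i < P.natDegree) :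
    ∃ a : A, a ≠ 0 ∧ ∀ (K : Type u) [Field K] (φ : A →+* K), φ a ≠ 0 → ∀ f g : K[X][X],
      f.Monic → g.Monic → f * g = P.map (mapRingHom φ) → g.natDegree ≠ i := by
  obtain ⟨N, hN⟩ : ∃ N, ∀ j, (P.coeff j).natDegree ≤ N := by
    refine ⟨P.support.sup fun j => (P.coeff j).natDegree, fun j => ?_⟩
    by_cases hj : P.coeff j = 0
    · simp [hj]
    · exact Finset.le_sup (f := fun j => (P.coeff j).natDegree) (mem_support_iff.2 hj)
  -- The coefficients of two unknown monic factors are the variables of `U`, and `I` is generated by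
  -- the equations making their product `P`. Homomorphisms that kill `I` correspond to
  -- factorizations.
  let U := MvPolynomial (Bool × ℕ × ℕ) A
  let G : U[X][X] := monicBivariate (P.natDegree - i) N fun j l => MvPolynomial.X (true, j, l)
  let H : U[X][X] := monicBivariate i N fun j l => MvPolynomial.X (false, j, l)
  let Δ : U[X][X] := G * H - P.map (mapRingHom (algebraMap A U))
  let I : Ideal U := Ideal.span {u | ∃ m n, u = (Δ.coeff m).coeff n}
  have hΔ {S : Type u} [CommRing S] (φ : U →+* S) (hφ : ∀ u ∈ I, φ u = 0) :
      (G.map (mapRingHom φ)) * (H.map (mapRingHom φ)) =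
        P.map (mapRingHom (φ.comp (algebraMap A U))) := by
    rw [← Polynomial.map_mul, ← sub_eq_zero, ← mapRingHom_comp, ← Polynomial.map_map,
      ← Polynomial.map_sub]
    ext m n
    rw [coeff_map, coe_mapRingHom, coeff_map, coeff_zero, coeff_zero]
    exact hφ _ (Ideal.subset_span ⟨m, n, rfl⟩)
  by_cases hcase : ∃ a : A, a ≠ 0 ∧ algebraMap A U a ∈ I
  · obtain ⟨a, ha, haI⟩ := hcase
    refine ⟨a, ha, fun K _ φ hφ f g hf hg hfg hgi => hφ ?_⟩
    have hdeg : (P.map (mapRingHom φ)).natDegree = P.natDegree := hP.natDegree_map _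
    have hP0 : P.map (mapRingHom φ) ≠ 0 := (hP.map _).ne_zero
    have hN' (j) : ((P.map (mapRingHom φ)).coeff j).natDegree ≤ N := by
      rw [coeff_map]
      exact natDegree_map_le.trans (hN j)
    have hfdeg : f.natDegree = P.natDegree - i := by
      rw [← hfg, hf.natDegree_mul hg] at hdeg
      omega
    let ψ : U →+* K := MvPolynomial.eval₂Hom φ fun b =>
      if b.1 then (f.coeff b.2.1).coeff b.2.2 else (g.coeff b.2.1).coeff b.2.2
    have hψA (a : A) : ψ (algebraMap A U a) = φ a := MvPolynomial.eval₂Hom_C _ _ _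
    have hψX (b) : ψ (MvPolynomial.X b) =
      if b.1 then (f.coeff b.2.1).coeff b.2.2 else (g.coeff b.2.1).coeff b.2.2 :=
      MvPolynomial.eval₂Hom_X' _ _ _
    have hGf : G.map (mapRingHom ψ) = f := by
      rw [monicBivariate_map]
      simp only [hψX, if_true]
      rw [← hfdeg]
      exact monicBivariate_coeff hf (natDegree_coeff_le_of_mul_eq hfg hP0 hN')
    have hHg : H.map (mapRingHom ψ) = g := by
      rw [monicBivariate_map]
      simp only [hψX, Bool.false_eq_true, if_false]
      rw [← hgi]
      exact monicBivariate_coeff hg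
        (natDegree_coeff_le_of_mul_eq ((mul_comm _ _).trans hfg) hP0 hN')
    have hψA' : ψ.comp (algebraMap A U) = φ := RingHom.ext hψA
    have hker : I ≤ RingHom.ker ψ := by
      rw [Ideal.span_le]
      rintro _ ⟨m, n, rfl⟩
      have h0 : Δ.map (mapRingHom ψ) = 0 := by
        rw [Polynomial.map_sub, Polynomial.map_mul, hGf, hHg, hfg, Polynomial.map_map,
          mapRingHom_comp, hψA', sub_self]
      have := congrArg (fun p => (p.coeff m).coeff n) h0
      simpa [coeff_map] using this
    rw [← hψA]
    exact hker haI
  · exfalso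
    push Not at hcase
    -- If `I` contains no nonzero element of `A`, some prime over `I` does not either, and its
    -- residue field is an extension of the fraction field of `A` over which `P` factors.
    have hdisj : Disjoint (I : Set U) ((nonZeroDivisors A).map (algebraMap A U) : Set U) := by
      rw [Set.disjoint_left]
      rintro _ hI ⟨a, ha, rfl⟩
      exact hcase a (nonZeroDivisors.ne_zero ha) hI
    obtain ⟨p, hp, hIp, hpd⟩ := Ideal.exists_le_prime_disjoint I _ hdisj
    let K := FractionRing (U ⧸ p)
    let ψ : U →+* K := (algebraMap (U ⧸ p) K).comp (Ideal.Quotient.mk p)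
    have hψ (u : U) : ψ u = 0 ↔ u ∈ p := by
      rw [← Ideal.Quotient.eq_zero_iff_mem]
      exact map_eq_zero_iff _ (IsFractionRing.injective (U ⧸ p) K)
    have hfac := hΔ ψ fun u hu => (hψ u).2 (hIp hu)
    have hinj : Function.Injective (ψ.comp (algebraMap A U)) := by
      rw [injective_iff_map_eq_zero]
      intro a ha
      by_contra ha0
      exact Set.disjoint_left.1 hpd ((hψ _).1 ha) ⟨a, mem_nonZeroDivisors_of_ne_zero ha0, rfl⟩
    have hirr := h K _ hinj
    rw [← hfac] at hirr
    rw [monicBivariate_map, monicBivariate_map] at hirr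
    have hm1 := monic_monicBivariate (P.natDegree - i) N fun j l => ψ (MvPolynomial.X (true, j, l))
    have hm2 := monic_monicBivariate i N fun j l => ψ (MvPolynomial.X (false, j, l))
    rcases hirr.isUnit_or_isUnit rfl with hu | hu
    · have h1 := hm1.eq_one_of_isUnit hu
      have h2 := natDegree_monicBivariate (P.natDegree - i) N
        fun j l => ψ (MvPolynomial.X (true, j, l))
      rw [h1, natDegree_one] at h2
      omega
    · have h1 := hm2.eq_one_of_isUnit hu
      have h2 := natDegree_monicBivariate i N fun j l => ψ (MvPolynomial.X (false, j, l))
      rw [h1, natDegree_one] at h2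
      omega

/-- A polynomial that is geometrically irreducible over the generic point is irreducible over all
points of a nonempty open subset. -/
theorem exists_ne_zero_forall_irreducible {A : Type u} [CommRing A] [IsDomain A] (P : A[X][X])
    (hP : P.Monic)
    (h : ∀ (K : Type u) [Field K] (φ : A →+* K), Function.Injective φ →
      Irreducible (P.map (mapRingHom φ))) :
    ∃ a : A, a ≠ 0 ∧ ∀ (K : Type u) [Field K] (φ : A →+* K), φ a ≠ 0 →
      Irreducible (P.map (mapRingHom φ)) := by
  have key (i : ℕ) : ∃ a : A, a ≠ 0 ∧ (0 < i → i < P.natDegree → ∀ (K : Type u) [Field K]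
      (φ : A →+* K), φ a ≠ 0 → ∀ f g : K[X][X],
      f.Monic → g.Monic → f * g = P.map (mapRingHom φ) → g.natDegree ≠ i) := by
    by_cases hi : 0 < i ∧ i < P.natDegree
    · obtain ⟨a, ha, ha'⟩ := exists_ne_zero_forall_natDegree_ne P hP h i hi.1 hi.2
      exact ⟨a, ha, fun _ _ => ha'⟩
    · exact ⟨1, one_ne_zero, fun h1 h2 => absurd ⟨h1, h2⟩ hi⟩
  choose a ha ha' using key
  refine ⟨∏ i ∈ Finset.range P.natDegree, a i, Finset.prod_ne_zero_iff.2 fun i _ => ha i,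
    fun K _ φ hφ => ?_⟩
  have hpos : 0 < P.natDegree := by
    rw [Nat.pos_iff_ne_zero]
    intro h0
    have hirr := h (FractionRing A) _ (IsFractionRing.injective A (FractionRing A))
    rw [eq_one_of_monic_natDegree_zero hP h0, Polynomial.map_one] at hirr
    exact hirr.not_isUnit isUnit_one
  rw [(hP.map _).irreducible_iff_natDegree', hP.natDegree_map]
  refine ⟨fun h1 => ?_, fun f g hf hg hfg hi => ?_⟩
  · have := hP.natDegree_map (mapRingHom φ)
    rw [h1, natDegree_one] at this
    omega
  · rw [Finset.mem_Ioc] at hi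
    have hi2 : g.natDegree < P.natDegree := by omega
    refine ha' g.natDegree hi.1 hi2 K φ (fun h0 => hφ ?_) f g hf hg hfg rfl
    rw [map_prod]
    exact Finset.prod_eq_zero (Finset.mem_range.2 hi2) h0

end Factorization

/-! ### Integrality and dimension of the fibres of an étale algebra over the relative line -/

section BertiniNoether

open Polynomial TensorProduct

lemma flat_of_injective_field {A K : Type*} [CommRing A] [Field K] [Algebra A K]
    (h : Function.Injective (algebraMap A K)) : Module.Flat A K := by
  have : IsDomain A := h.isDomain (algebraMap A K)
  have : FaithfulSMul A K := (faithfulSMul_iff_algebraMap_injective A K).2 h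
  let _ : Algebra (FractionRing A) K := FractionRing.liftAlgebra A K
  have : IsScalarTower A (FractionRing A) K := FractionRing.isScalarTower_liftAlgebra A K
  have : Module.Flat A (FractionRing A) := IsLocalization.flat _ (nonZeroDivisors A)
  exact Module.Flat.trans A (FractionRing A) K

/-- A generically finite separable extension of domains has a primitive element with a monic
minimal polynomial; up to denominators it generates the extension. -/
lemma exists_primitive_element_of_isFractionRing {S R : Type*} [CommRing S] [CommRing R]
    [IsDomain S] [IsDomain R] [Algebra S R] [Algebra.FiniteType S R] (F L : Type*) [Field F]
    [Field L] [Algebra S F] [IsFractionRing S F] [Algebra R L] [IsFractionRing R L] [Algebra F L]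
    [Algebra S L] [IsScalarTower S F L] [IsScalarTower S R L] [FiniteDimensional F L]
    [Algebra.IsSeparable F L] :
    ∃ (z : R) (P : S[X]), P.Monic ∧ aeval z P = 0 ∧ (∀ Q : S[X], aeval z Q = 0 → P ∣ Q) ∧
      ∃ c : S, c ≠ 0 ∧ ∀ r : R, ∃ (N : ℕ) (Q : S[X]), aeval z Q = c ^ N • r := by
  obtain ⟨α, hα⟩ := Field.exists_primitive_element F L
  obtain ⟨r, s, hs, rfl⟩ := IsFractionRing.div_surjective (A := R) α
  have hs0 : s ≠ 0 := nonZeroDivisors.ne_zero hs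
  have halg (x : R) : IsAlgebraic S x := by
    have h1 : IsAlgebraic S (algebraMap R L x) :=
      (IsFractionRing.isAlgebraic_iff S F L).2 (Algebra.IsAlgebraic.isAlgebraic _)
    exact (isAlgebraic_algebraMap_iff (IsFractionRing.injective R L)).1 h1
  obtain ⟨e, he, s', hs'⟩ := (halg s).exists_nonzero_dvd hs
  let y := r * s'
  have hyα : algebraMap R L y = algebraMap F L (algebraMap S F e) *
      (algebraMap R L r / algebraMap R L s) := by
    have : algebraMap R L s ≠ 0 := by simpa using hs0
    rw [← IsScalarTower.algebraMap_apply, IsScalarTower.algebraMap_apply S R L, hs']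
    field_simp
    simp only [y, map_mul]
    ring
  have he' : algebraMap S F e ≠ 0 := by simpa using he
  -- scale so that the minimal polynomial has integral coefficients
  obtain ⟨⟨d, hd⟩, hd'⟩ := IsLocalization.exist_integer_multiples (nonZeroDivisors S)
    (Finset.range ((minpoly F (algebraMap R L y)).natDegree))
    (minpoly F (algebraMap R L y)).coeff
  have hd0 : d ≠ 0 := nonZeroDivisors.ne_zero hd
  have hd0' : algebraMap S F d ≠ 0 := by simpa using hd0
  have hyint : _root_.IsIntegral F (algebraMap R L y) := Algebra.IsIntegral.isIntegral _
  let z := d • y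
  have hz : algebraMap R L z = algebraMap F L (algebraMap S F d) * algebraMap R L y := by
    simp only [z, Algebra.smul_def, map_mul, ← IsScalarTower.algebraMap_apply]
  have hP0 : (minpoly F (algebraMap R L y)).scaleRoots (algebraMap S F d) ∈
      lifts (algebraMap S F) := by
    rw [lifts_iff_coeff_lifts]
    intro i
    rw [coeff_scaleRoots]
    rcases lt_trichotomy i (minpoly F (algebraMap R L y)).natDegree with hi | hi | hi
    · obtain ⟨c, hc⟩ := hd' i (Finset.mem_range.2 hi)
      refine ⟨c * d ^ ((minpoly F (algebraMap R L y)).natDegree - i - 1), ?_⟩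
      rw [map_mul, hc, map_pow]
      obtain ⟨m, hm⟩ := Nat.exists_eq_add_of_lt hi
      rw [show (minpoly F (algebraMap R L y)).natDegree - i = m + 1 by omega, pow_succ,
        Nat.add_sub_cancel, Algebra.smul_def]
      ring
    · subst hi
      rw [Nat.sub_self, pow_zero, mul_one, (minpoly.monic hyint).coeff_natDegree]
      exact ⟨1, map_one _⟩
    · rw [coeff_eq_zero_of_natDegree_lt hi, zero_mul]
      exact ⟨0, map_zero _⟩
  have hP1 := (monic_scaleRoots_iff (algebraMap S F d)).2 (minpoly.monic hyint)
  obtain ⟨P, hPmap, hPdeg, hP⟩ := lifts_and_natDegree_eq_and_monic hP0 hP1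
  have hPz : aeval z P = 0 := by
    apply IsFractionRing.injective R L
    rw [map_zero, ← aeval_algebraMap_apply, ← aeval_map_algebraMap F, hPmap, hz]
    exact scaleRoots_aeval_eq_zero (minpoly.aeval _ _)
  have hgen : IntermediateField.adjoin F {algebraMap R L z} = ⊤ := by
    rw [← top_le_iff, ← hα, IntermediateField.adjoin_simple_le_iff]
    have h1 : algebraMap R L r / algebraMap R L s = algebraMap F L ((algebraMap S F d)⁻¹ *
        (algebraMap S F e)⁻¹) * algebraMap R L z := by
      rw [hz, hyα, map_mul, map_inv₀, map_inv₀]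
      have h2 : algebraMap F L (algebraMap S F d) ≠ 0 := by simpa using hd0'
      have h3 : algebraMap F L (algebraMap S F e) ≠ 0 := by simpa using he'
      field_simp
    rw [h1]
    exact mul_mem (IntermediateField.algebraMap_mem _ _)
      (IntermediateField.mem_adjoin_simple_self _ _)
  have hzint : _root_.IsIntegral F (algebraMap R L z) := Algebra.IsIntegral.isIntegral _
  have hyz : IntermediateField.adjoin F {algebraMap R L y} = ⊤ := by
    rw [← top_le_iff, ← hgen, IntermediateField.adjoin_simple_le_iff, hz]
    exact mul_mem (IntermediateField.algebraMap_mem _ _)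
      (IntermediateField.mem_adjoin_simple_self _ _)
  have hmin : P.map (algebraMap S F) = minpoly F (algebraMap R L z) := by
    refine eq_of_monic_of_dvd_of_natDegree_le (minpoly.monic hzint) (hP.map _) (minpoly.dvd _ _ ?_)
      ?_
    · rw [aeval_map_algebraMap, aeval_algebraMap_apply, hPz, map_zero]
    · rw [hP.natDegree_map, hPdeg, natDegree_scaleRoots,
        (Field.primitive_element_iff_minpoly_natDegree_eq F _).1 hyz,
        (Field.primitive_element_iff_minpoly_natDegree_eq F _).1 hgen]
  refine ⟨z, P, hP, hPz, fun Q hQ => ?_, ?_⟩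
  · rw [← map_dvd_map (algebraMap S F) (IsFractionRing.injective S F) hP, hmin]
    apply minpoly.dvd
    rw [aeval_map_algebraMap, aeval_algebraMap_apply, hQ, map_zero]
  · -- denominators
    have hint (x : L) : ∃ c : S, c ≠ 0 ∧ ∃ Q : S[X], algebraMap R L (aeval z Q) = c • x := by
      have hx : x ∈ IntermediateField.adjoin F {algebraMap R L z} := by rw [hgen]; trivial
      rw [← IntermediateField.mem_toSubalgebra,
        IntermediateField.adjoin_simple_toSubalgebra_of_isAlgebraic hzint.isAlgebraic,
        Algebra.adjoin_singleton_eq_range_aeval] at hx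
      obtain ⟨q, rfl⟩ := hx
      obtain ⟨b, hb, hb'⟩ := IsLocalization.integerNormalization_spec (nonZeroDivisors S) q
      refine ⟨b, nonZeroDivisors.ne_zero hb,
        IsLocalization.integerNormalization (nonZeroDivisors S) q, ?_⟩
      rw [← aeval_algebraMap_apply, ← aeval_map_algebraMap F, hb']
      exact AlgHom.map_smul_of_tower _ _ _
    obtain ⟨G, hG⟩ := (inferInstance : Algebra.FiniteType S R).out
    choose c hc Q hQ using fun x : R => hint (algebraMap R L x)
    have hQ' (x : R) : aeval z (Q x) = c x • x := by
      apply IsFractionRing.injective R L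
      rw [hQ, Algebra.smul_def, Algebra.smul_def, map_mul, ← IsScalarTower.algebraMap_apply]
    refine ⟨∏ x ∈ G, c x, Finset.prod_ne_zero_iff.2 fun x _ => hc x, fun r => ?_⟩
    have hr : r ∈ Algebra.adjoin S (G : Set R) := by rw [hG]; trivial
    induction hr using Algebra.adjoin_induction with
    | mem x hx =>
      obtain ⟨e, he⟩ := Finset.dvd_prod_of_mem c hx
      refine ⟨1, C e * Q x, ?_⟩
      rw [map_mul, hQ', he, aeval_C, pow_one, mul_comm (c x), mul_smul, Algebra.smul_def e]
    | algebraMap s => exact ⟨0, C s, by simp⟩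
    | add x y _ _ hx hy =>
      obtain ⟨N, Q, hQ⟩ := hx
      obtain ⟨M, Q', hQ'⟩ := hy
      refine ⟨N + M, C ((∏ x ∈ G, c x) ^ M) * Q + C ((∏ x ∈ G, c x) ^ N) * Q', ?_⟩
      rw [map_add, map_mul, map_mul, hQ, hQ', aeval_C, aeval_C, ← Algebra.smul_def,
        ← Algebra.smul_def, smul_smul, smul_smul, ← pow_add, ← pow_add, smul_add, add_comm M]
    | mul x y _ _ hx hy =>
      obtain ⟨N, Q, hQ⟩ := hx
      obtain ⟨M, Q', hQ'⟩ := hy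
      exact ⟨N + M, Q * Q', by rw [map_mul, hQ, hQ', smul_mul_smul_comm, pow_add]⟩

/-- An unramified algebra of finite type induces a finite separable extension of fraction fields,
which has a primitive element. -/
lemma exists_primitive_element_of_unramified {S R : Type*} [CommRing S] [CommRing R] [IsDomain S]
    [IsDomain R] [Algebra S R] [Algebra.FormallyUnramified S R] [Algebra.FiniteType S R]
    (hinj : Function.Injective (algebraMap S R)) :
    ∃ (z : R) (P : S[X]), P.Monic ∧ aeval z P = 0 ∧ (∀ Q : S[X], aeval z Q = 0 → P ∣ Q) ∧
      ∃ c : S, c ≠ 0 ∧ ∀ r : R, ∃ (N : ℕ) (Q : S[X]), aeval z Q = c ^ N • r := by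
  let F := FractionRing S
  let L := FractionRing R
  have hfaith : FaithfulSMul S R := (faithfulSMul_iff_algebraMap_injective S R).2 hinj
  have : FaithfulSMul S L := FaithfulSMul.trans S R L
  let algFL : Algebra F L := FractionRing.liftAlgebra S L
  have : IsScalarTower S F L := FractionRing.isScalarTower_liftAlgebra S L
  have : Algebra.FormallyUnramified R L :=
    Algebra.FormallyUnramified.of_isLocalization (nonZeroDivisors R)
  have : Algebra.FormallyUnramified S L := Algebra.FormallyUnramified.comp S R L
  have : Algebra.FormallyUnramified F L := Algebra.FormallyUnramified.of_restrictScalars S F L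
  have : Algebra.EssFiniteType R L := Algebra.EssFiniteType.of_isLocalization L (nonZeroDivisors R)
  have : Algebra.EssFiniteType S L := Algebra.EssFiniteType.comp S R L
  have : Algebra.EssFiniteType F L := Algebra.EssFiniteType.of_comp S F L
  have : FiniteDimensional F L := Algebra.FormallyUnramified.finite_of_free F L
  have : Algebra.IsSeparable F L := Algebra.FormallyUnramified.isSeparable F L
  exact exists_primitive_element_of_isFractionRing F L

lemma eval₂_aeval_eq_sum {K T : Type*} [CommRing K] [CommRing T] [Algebra K T] (t z : T)
    (f : K[X][X]) {N d : ℕ} (hN : ∀ j, (f.coeff j).natDegree < N) (hd : f.natDegree < d) :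
    eval₂ (aeval (R := K) t).toRingHom z f =
      ∑ i ∈ Finset.range N ×ˢ (Finset.univ : Finset (Fin d)),
        (f.coeff i.2).coeff i.1 • (t ^ i.1 * z ^ (i.2 : ℕ)) := by
  rw [Finset.sum_product_right, eval₂_eq_sum_range' _ hd, Finset.sum_range]
  refine Finset.sum_congr rfl fun j _ => ?_
  rw [AlgHom.toRingHom_eq_coe, RingHom.coe_coe, aeval_eq_sum_range' (hN j), Finset.sum_mul]
  simp only [smul_mul_assoc]

lemma linearIndependent_X_pow_smul_pow {A R : Type*} [CommRing A] [CommRing R] [Nontrivial A]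
    [Algebra A R] [Algebra A[X] R] [IsScalarTower A A[X] R] {z : R} {P : A[X][X]} (hP : P.Monic)
    (hmin : ∀ Q : A[X][X], aeval z Q = 0 → P ∣ Q) :
    LinearIndependent A fun j : ℕ × Fin P.natDegree => (X ^ j.1 : A[X]) • z ^ (j.2 : ℕ) := by
  have h1 : LinearIndependent A fun l : ℕ => (X ^ l : A[X]) := by
    simpa [X_pow_eq_monomial] using (basisMonomials A).linearIndependent
  have h2 : LinearIndependent A[X] fun j : Fin P.natDegree => z ^ (j : ℕ) := by
    rw [Fintype.linearIndependent_iff]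
    intro g hg i
    have h3 : aeval z (∑ j : Fin P.natDegree, C (g j) * X ^ (j : ℕ)) = 0 := by
      rw [← hg, map_sum]
      simp [Algebra.smul_def]
    have h4 : (∑ j : Fin P.natDegree, C (g j) * X ^ (j : ℕ)) = 0 := by
      by_contra h0
      refine hP.not_dvd_of_degree_lt h0 ?_ (hmin _ h3)
      rw [degree_eq_natDegree hP.ne_zero]
      exact degree_sum_fin_lt _
    have h5 := congrArg (fun p => p.coeff i) h4
    simpa [finsetSum_coeff, coeff_C_mul, coeff_X_pow, Fin.val_inj] using h5
  exact linearIndependent_smul (b := fun l : ℕ => (X ^ l : A[X]))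
    (c := fun j : Fin P.natDegree => z ^ (j : ℕ)) h1 h2

/-- If `R` stays a domain after the extension of the constants from `A` to `K`, then the minimal
polynomial of an element of `R` over `A[X]` stays irreducible over `K`. -/
lemma irreducible_map_of_isDomain_tensorProduct {A R : Type*} [CommRing A] [CommRing R]
    [IsDomain A] [IsDomain R] [Algebra A R] [Algebra A[X] R] [IsScalarTower A A[X] R]
    {z : R} {P : A[X][X]} (hP : P.Monic) (hz : aeval z P = 0)
    (hmin : ∀ Q : A[X][X], aeval z Q = 0 → P ∣ Q) (K : Type*) [Field K] [Algebra A K]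
    [Module.Flat A K] [IsDomain (K ⊗[A] R)] :
    Irreducible (P.map (mapRingHom (algebraMap A K))) := by
  have hlin := linearIndependent_X_pow_smul_pow hP hmin
  have hlinK := Module.Flat.linearIndependent_one_tmul (S := K) hlin
  let t : K ⊗[A] R := 1 ⊗ₜ algebraMap A[X] R X
  let ev : K[X][X] →+* K ⊗[A] R := eval₂RingHom (aeval t).toRingHom (1 ⊗ₜ z)
  -- Flatness preserves the independence of the monomials in `X` and `z` below the degree of `P`, so
  -- no nonzero polynomial of smaller degree vanishes. In a domain this leaves `P` no proper monic
  -- factors.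
  have hev0 (f : K[X][X]) (hf : f.natDegree < P.natDegree) (h0 : ev f = 0) : f = 0 := by
    obtain ⟨N, hN⟩ : ∃ N, ∀ j, (f.coeff j).natDegree < N := by
      refine ⟨(f.support.sup fun j => (f.coeff j).natDegree) + 1, fun j => Nat.lt_succ_of_le ?_⟩
      by_cases hj : f.coeff j = 0
      · simp [hj]
      · exact Finset.le_sup (f := fun j => (f.coeff j).natDegree) (mem_support_iff.2 hj)
    have h1 : ∑ i ∈ Finset.range N ×ˢ (Finset.univ : Finset (Fin P.natDegree)),
        ((f.coeff i.2).coeff i.1) • ((1 : K) ⊗ₜ[A] ((X ^ i.1 : A[X]) • z ^ (i.2 : ℕ))) = 0 := by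
      rw [← h0]
      refine Eq.trans ?_ (eval₂_aeval_eq_sum t (1 ⊗ₜ z) f hN hf).symm
      refine Finset.sum_congr rfl fun j _ => ?_
      rw [Algebra.smul_def (X ^ j.1 : A[X]), map_pow, Algebra.TensorProduct.tmul_pow,
        Algebra.TensorProduct.tmul_pow, Algebra.TensorProduct.tmul_mul_tmul, one_pow, one_pow,
        one_mul]
    rw [linearIndependent_iff'] at hlinK
    ext j l
    rcases lt_or_ge j P.natDegree with hj | hj
    · rcases lt_or_ge l N with hl | hl
      · exact hlinK _ _ h1 (l, ⟨j, hj⟩) (by simpa using hl)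
      · rw [coeff_eq_zero_of_natDegree_lt ((hN j).trans_le hl)]
        simp
    · rw [coeff_eq_zero_of_natDegree_lt (hf.trans_le hj)]
      simp
  have hevP : ev (P.map (mapRingHom (algebraMap A K))) = 0 := by
    have h1 : (eval₂RingHom (aeval t).toRingHom (1 ⊗ₜ z) : K[X][X] →+* K ⊗[A] R).comp
        (mapRingHom (mapRingHom (algebraMap A K))) =
        (Algebra.TensorProduct.includeRight : R →ₐ[A] K ⊗[A] R).toRingHom.comp
          (aeval z : A[X][X] →ₐ[A[X]] R).toRingHom := by
      ext x
      · simp only [t, RingHom.comp_apply, coe_mapRingHom, map_C, coe_eval₂RingHom, eval₂_C,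
          AlgHom.toRingHom_eq_coe, RingHom.coe_coe, aeval_C,
          Algebra.TensorProduct.includeRight_apply]
        rw [← IsScalarTower.algebraMap_apply A K, ← algebraMap_eq (R := A),
          ← IsScalarTower.algebraMap_apply A A[X]]
        exact (Algebra.TensorProduct.tmul_one_eq_one_tmul x)
      · simp [t]
      · simp
    have h2 := congrArg (fun φ => φ P) h1
    exact h2.trans (by simp [hz])
  have hP0 : 0 < P.natDegree := by
    rw [Nat.pos_iff_ne_zero]
    intro h0
    rw [eq_one_of_monic_natDegree_zero hP h0, map_one] at hz
    exact one_ne_zero hz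
  rw [(hP.map _).irreducible_iff_natDegree', hP.natDegree_map]
  refine ⟨fun h1 => ?_, fun f g hf hg hfg hi => ?_⟩
  · have := hP.natDegree_map (mapRingHom (algebraMap A K))
    rw [h1, natDegree_one] at this
    omega
  · rw [Finset.mem_Ioc] at hi
    have hdeg := hf.natDegree_mul hg
    rw [hfg, hP.natDegree_map] at hdeg
    rw [← hfg, map_mul, mul_eq_zero] at hevP
    rcases hevP with h0 | h0
    · exact hf.ne_zero (hev0 f (by omega) h0)
    · exact hg.ne_zero (hev0 g (by omega) h0)

lemma aeval_mem_map_of_map_eq_zero {A R : Type*} [CommRing A] [CommRing R] [Algebra A R]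
    [Algebra A[X] R] [IsScalarTower A A[X] R] (m : Ideal A) (z : R) {Q : A[X][X]}
    (hQ : Q.map (mapRingHom (Ideal.Quotient.mk m)) = 0) :
    aeval z Q ∈ m.map (algebraMap A R) := by
  rw [aeval_eq_sum_range]
  refine Ideal.sum_mem _ fun j _ => ?_
  rw [Algebra.smul_def]
  refine Ideal.mul_mem_right _ _ ?_
  have h1 : Q.coeff j ∈ m.map (C : A →+* A[X]) := by
    rw [Ideal.mem_map_C_iff]
    intro l
    have := congrArg (fun p => (p.coeff j).coeff l) hQ
    simpa [coeff_map, Ideal.Quotient.eq_zero_iff_mem] using this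
  rw [IsScalarTower.algebraMap_eq A A[X] R, ← Ideal.map_map]
  exact Ideal.mem_map_of_mem _ h1

/-- The quotient of `R` is flat over the domain `A[X] / m A[X]`, so the nonzero class of `c` acts
injectively on it. -/
lemma mem_map_of_smul_mem_map {A R : Type*} [CommRing A] [CommRing R] [Algebra A R]
    [Algebra A[X] R] [IsScalarTower A A[X] R] [Module.Flat A[X] R] (m : Ideal A) [m.IsPrime]
    {c : A[X]} (hc : c.map (Ideal.Quotient.mk m) ≠ 0) {r : R}
    (hr : c • r ∈ m.map (algebraMap A R)) : r ∈ m.map (algebraMap A R) := by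
  let I : Ideal A[X] := m.map (C : A →+* A[X])
  have hI : m.map (algebraMap A R) = I.map (algebraMap A[X] R) := by
    rw [IsScalarTower.algebraMap_eq A A[X] R, ← Ideal.map_map]
    rfl
  have hIp : I.IsPrime := Ideal.isPrime_map_C_of_isPrime
  have hcI : Ideal.Quotient.mk I c ≠ 0 := by
    rw [Ne, Ideal.Quotient.eq_zero_iff_mem, Ideal.mem_map_C_iff]
    intro h
    refine hc ?_
    ext l
    rw [coeff_map, coeff_zero, Ideal.Quotient.eq_zero_iff_mem]
    exact h l
  rw [hI] at hr ⊢
  have hflat : Module.Flat (A[X] ⧸ I) (R ⧸ I.map (algebraMap A[X] R)) :=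
    Module.Flat.of_linearEquiv
      (Algebra.TensorProduct.quotIdealMapEquivQuotTensor R I).toLinearEquiv
  have hreg : IsSMulRegular (R ⧸ I.map (algebraMap A[X] R)) (Ideal.Quotient.mk I c) :=
    Module.Flat.isSMulRegular_of_nonZeroDivisors (mem_nonZeroDivisors_of_ne_zero hcI)
  rw [← Ideal.Quotient.eq_zero_iff_mem] at hr ⊢
  apply hreg
  simp only [smul_zero]
  rw [← hr]
  rfl

/-- **Bertini–Noether**: if `R` is étale over `A[X]` and geometrically integral over the generic
point of `A`, then its fibres over the points of a nonempty open subset of `A` are integral. -/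
theorem exists_ne_zero_forall_isPrime_map {A R : Type u} [CommRing A] [CommRing R] [IsDomain A]
    [IsDomain R] [Algebra A R] [Algebra A[X] R] [IsScalarTower A A[X] R] [Algebra.Etale A[X] R]
    (hG : ∀ (K : Type u) [Field K] [Algebra A K], Function.Injective (algebraMap A K) →
      IsDomain (K ⊗[A] R)) :
    ∃ a : A, a ≠ 0 ∧ ∀ m : Ideal A, m.IsMaximal → a ∉ m → (m.map (algebraMap A R)).IsPrime := by
  have hfaith : FaithfulSMul A[X] R := inferInstance
  have hinj := FaithfulSMul.algebraMap_injective A[X] R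
  obtain ⟨z, P, hP, hz, hmin, c, hc, hc'⟩ :=
    exists_primitive_element_of_unramified (S := A[X]) (R := R) hinj
  obtain ⟨a₁, ha₁, hirr⟩ := exists_ne_zero_forall_irreducible P hP fun K _ φ hφ => by
    let _ : Algebra A K := φ.toAlgebra
    have := hG K hφ
    have := flat_of_injective_field (A := A) (K := K) hφ
    exact irreducible_map_of_isDomain_tensorProduct hP hz hmin K
  obtain ⟨l, hl⟩ : ∃ l, c.coeff l ≠ 0 := by
    by_contra! h
    exact hc (ext h)
  -- The factor `a₁` keeps the reduction of `P` irreducible, and the nonzero coefficient keeps the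
  -- common denominator `c` nonzero modulo `m`.
  refine ⟨a₁ * c.coeff l, mul_ne_zero ha₁ hl, fun m hm ham => ?_⟩
  let _ : Field (A ⧸ m) := Ideal.Quotient.field m
  have hP' : Irreducible (P.map (mapRingHom (Ideal.Quotient.mk m))) := by
    refine hirr (A ⧸ m) (Ideal.Quotient.mk m) fun h => ham ?_
    exact m.mul_mem_right _ (Ideal.Quotient.eq_zero_iff_mem.1 h)
  have hPprime : Prime (P.map (mapRingHom (Ideal.Quotient.mk m))) := by
    exact UniqueFactorizationMonoid.irreducible_iff_prime.1 hP'
  have hcm : c.map (Ideal.Quotient.mk m) ≠ 0 := by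
    intro h
    refine ham (m.mul_mem_left _ ?_)
    rw [← Ideal.Quotient.eq_zero_iff_mem, ← coeff_map, h, coeff_zero]
  have hPmon : (P.map (mapRingHom (Ideal.Quotient.mk m))).Monic := hP.map _
  have hPc (M : ℕ) : ¬ P.map (mapRingHom (Ideal.Quotient.mk m)) ∣
      C (c.map (Ideal.Quotient.mk m) ^ M) := by
    intro h
    have h1 := natDegree_le_of_dvd h (by simpa using pow_ne_zero M hcm)
    rw [natDegree_C, Nat.le_zero] at h1
    exact hPprime.not_isUnit (by rw [eq_one_of_monic_natDegree_zero hPmon h1]; exact isUnit_one)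
  -- Up to a power of `c`, an element of `m R` is a polynomial in `z` with coefficients in `m`. So
  -- membership in `m R` becomes divisibility by the reduction of `P`, which is prime and does not
  -- divide powers of `c`.
  have hmem {Q : A[X][X]} (hQ : aeval z Q ∈ m.map (algebraMap A R)) :
      P.map (mapRingHom (Ideal.Quotient.mk m)) ∣ Q.map (mapRingHom (Ideal.Quotient.mk m)) := by
    suffices h : ∃ (M : ℕ) (Q' : A[X][X]), aeval z Q' = c ^ M • aeval z Q ∧
        Q'.map (mapRingHom (Ideal.Quotient.mk m)) = 0 by
      obtain ⟨M, Q', h1, h2⟩ := h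
      have h3 : P ∣ C (c ^ M) * Q - Q' := hmin _ <| by
        rw [map_sub, map_mul, h1, aeval_C, Algebra.smul_def, sub_self]
      have h4 := Polynomial.map_dvd (mapRingHom (Ideal.Quotient.mk m)) h3
      rw [Polynomial.map_sub, h2, sub_zero, Polynomial.map_mul, map_C, coe_mapRingHom,
        Polynomial.map_pow] at h4
      exact (hPprime.dvd_or_dvd h4).resolve_left (hPc M)
    generalize aeval z Q = x at hQ
    induction hQ using Submodule.span_induction with
    | mem x hx =>
      obtain ⟨y, hy, rfl⟩ := hx
      refine ⟨0, C (C y), ?_, ?_⟩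
      · rw [aeval_C, C_eq_algebraMap, ← IsScalarTower.algebraMap_apply, pow_zero, one_smul]
      · rw [map_C, coe_mapRingHom, map_C, Ideal.Quotient.eq_zero_iff_mem.2 hy, C_0, C_0]
    | zero => exact ⟨0, 0, by simp, by simp⟩
    | add x y _ _ hx hy =>
      obtain ⟨M, Q, h1, h2⟩ := hx
      obtain ⟨N, Q', h1', h2'⟩ := hy
      refine ⟨M + N, C (c ^ N) * Q + C (c ^ M) * Q', ?_, ?_⟩
      · rw [map_add, map_mul, map_mul, h1, h1', aeval_C, aeval_C, ← Algebra.smul_def,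
          ← Algebra.smul_def, smul_smul, smul_smul, ← pow_add, ← pow_add, smul_add, add_comm M]
      · rw [Polynomial.map_add, Polynomial.map_mul, Polynomial.map_mul, h2, h2', mul_zero,
          mul_zero, add_zero]
    | smul r x _ hx =>
      obtain ⟨M, Q, h1, h2⟩ := hx
      obtain ⟨N, Q', h1'⟩ := hc' r
      refine ⟨N + M, Q' * Q, ?_, ?_⟩
      · rw [map_mul, h1, h1', smul_mul_smul_comm, pow_add, smul_eq_mul]
      · rw [Polynomial.map_mul, h2, mul_zero]
  refine ⟨?_, fun {x y} hxy => ?_⟩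
  · intro htop
    have h1 : aeval z (1 : A[X][X]) ∈ m.map (algebraMap A R) := by
      rw [htop]
      trivial
    have h2 := hmem h1
    rw [Polynomial.map_one] at h2
    exact hPprime.not_isUnit (isUnit_of_dvd_one h2)
  · obtain ⟨N, Q, hQ⟩ := hc' x
    obtain ⟨M, Q', hQ'⟩ := hc' y
    have hfin {x : R} {N : ℕ} {Q : A[X][X]} (hQ : aeval z Q = c ^ N • x)
        (h : P.map (mapRingHom (Ideal.Quotient.mk m)) ∣
          Q.map (mapRingHom (Ideal.Quotient.mk m))) : x ∈ m.map (algebraMap A R) := by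
      obtain ⟨G, hG⟩ := h
      obtain ⟨G', rfl⟩ := Polynomial.map_surjective (mapRingHom (Ideal.Quotient.mk m))
        (Polynomial.map_surjective (Ideal.Quotient.mk m) Ideal.Quotient.mk_surjective) G
      have h1 : aeval z (Q - P * G') ∈ m.map (algebraMap A R) :=
        aeval_mem_map_of_map_eq_zero m z (by
          rw [Polynomial.map_sub, Polynomial.map_mul]
          exact sub_eq_zero.2 hG)
      rw [map_sub, map_mul, hz, zero_mul, sub_zero, hQ] at h1
      refine mem_map_of_smul_mem_map m ?_ h1
      rw [Polynomial.map_pow]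
      exact pow_ne_zero N hcm
    have h1 := hmem (Q := Q * Q') (by
      rw [map_mul, hQ, hQ', smul_mul_smul_comm, Algebra.smul_def]
      exact Ideal.mul_mem_left _ _ hxy)
    rw [Polynomial.map_mul] at h1
    exact (hPprime.dvd_or_dvd h1).imp (hfin hQ) (hfin hQ')

lemma isAlgebraic_of_formallyUnramified {S R : Type*} [CommRing S] [CommRing R] [IsDomain S]
    [IsDomain R] [Algebra S R] [Algebra.FormallyUnramified S R] [Algebra.FiniteType S R]
    (hinj : Function.Injective (algebraMap S R)) : Algebra.IsAlgebraic S R := by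
  let F := FractionRing S
  let L := FractionRing R
  have hfaith : FaithfulSMul S R := (faithfulSMul_iff_algebraMap_injective S R).2 hinj
  have : FaithfulSMul S L := FaithfulSMul.trans S R L
  let algFL : Algebra F L := FractionRing.liftAlgebra S L
  have : IsScalarTower S F L := FractionRing.isScalarTower_liftAlgebra S L
  have : Algebra.FormallyUnramified R L :=
    Algebra.FormallyUnramified.of_isLocalization (nonZeroDivisors R)
  have : Algebra.FormallyUnramified S L := Algebra.FormallyUnramified.comp S R L
  have : Algebra.FormallyUnramified F L := Algebra.FormallyUnramified.of_restrictScalars S F L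
  have : Algebra.EssFiniteType R L := Algebra.EssFiniteType.of_isLocalization L (nonZeroDivisors R)
  have : Algebra.EssFiniteType S L := Algebra.EssFiniteType.comp S R L
  have : Algebra.EssFiniteType F L := Algebra.EssFiniteType.of_comp S F L
  have : FiniteDimensional F L := Algebra.FormallyUnramified.finite_of_free F L
  refine ⟨fun x => (isAlgebraic_algebraMap_iff (IsFractionRing.injective R L)).1 ?_⟩
  exact (IsFractionRing.isAlgebraic_iff S F L).2 (Algebra.IsAlgebraic.isAlgebraic _)

/-- A domain that is unramified and of finite type over a one-dimensional domain is at most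
one-dimensional. -/
lemma isMaximal_of_formallyUnramified {S R : Type*} [CommRing S] [CommRing R] [IsDomain S]
    [IsDomain R] [Algebra S R] [Algebra.FormallyUnramified S R] [Algebra.FiniteType S R]
    [Ring.DimensionLEOne S] (hinj : Function.Injective (algebraMap S R)) (P : Ideal R) [P.IsPrime]
    (hP : P ≠ ⊥) : P.IsMaximal := by
  obtain ⟨r, hr, hr0⟩ := Submodule.exists_mem_ne_zero_of_ne_bot hP
  have halg := isAlgebraic_of_formallyUnramified hinj
  obtain ⟨e, he, hdvd⟩ := (halg.isAlgebraic r).exists_nonzero_dvd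
    (mem_nonZeroDivisors_of_ne_zero hr0)
  have hmax : (P.under S).IsMaximal := by
    refine Ideal.IsPrime.isMaximal inferInstance fun h0 => he ?_
    have : e ∈ P.under S := P.mem_of_dvd hdvd hr
    rwa [h0] at this
  let _ : Field (S ⧸ P.under S) := Ideal.Quotient.field _
  have : Algebra.FormallyUnramified S (R ⧸ P) :=
    Algebra.FormallyUnramified.comp S R (R ⧸ P)
  have : Algebra.FormallyUnramified (S ⧸ P.under S) (R ⧸ P) :=
    Algebra.FormallyUnramified.of_restrictScalars S _ _
  have : Algebra.FiniteType S (R ⧸ P) := Algebra.FiniteType.trans (S := R) inferInstance inferInstance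
  have : Algebra.FiniteType (S ⧸ P.under S) (R ⧸ P) :=
    Algebra.FiniteType.of_restrictScalars_finiteType S _ _
  have : Module.Finite (S ⧸ P.under S) (R ⧸ P) := Algebra.FormallyUnramified.finite_of_free _ _
  exact Ideal.Quotient.maximal_of_isField _ (isField_of_isIntegral_of_isField'
    (Field.toIsField (S ⧸ P.under S)))

lemma injective_algebraMap_of_flat (S R : Type*) [CommRing S] [CommRing R] [IsDomain S] [IsDomain R]
    [Algebra S R] [Module.Flat S R] : Function.Injective (algebraMap S R) :=
  FaithfulSMul.algebraMap_injective S R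

/-- The integral fibres of an étale algebra over `A[X]` are one-dimensional. -/
lemma isMaximal_of_map_lt {A R : Type*} [CommRing A] [CommRing R] [Algebra A R]
    [Algebra A[X] R] [IsScalarTower A A[X] R] [Algebra.Etale A[X] R] {m : Ideal A}
    (hm : m.IsMaximal) (hp : (m.map (algebraMap A R)).IsPrime) :
    ¬ (m.map (algebraMap A R)).IsMaximal ∧
      ∀ P : Ideal R, P.IsPrime → m.map (algebraMap A R) < P → P.IsMaximal := by
  let I : Ideal A[X] := m.map (C : A →+* A[X])
  have hI : m.map (algebraMap A R) = I.map (algebraMap A[X] R) := by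
    rw [IsScalarTower.algebraMap_eq A A[X] R, ← Ideal.map_map]
    rfl
  have hIp : I.IsPrime := Ideal.isPrime_map_C_of_isPrime
  let _ : Field (A ⧸ m) := Ideal.Quotient.field m
  let e : (A ⧸ m)[X] ≃+* A[X] ⧸ I := Ideal.polynomialQuotientEquivQuotientPolynomial m
  rw [hI] at hp ⊢
  have : Algebra.Etale (A[X] ⧸ I) (R ⧸ I.map (algebraMap A[X] R)) :=
    Algebra.Etale.of_equiv (A := (A[X] ⧸ I) ⊗[A[X]] R)
      (Algebra.TensorProduct.quotIdealMapEquivQuotTensor R I).symm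
  have : Module.Flat (A[X] ⧸ I) (R ⧸ I.map (algebraMap A[X] R)) := inferInstance
  have hinj := injective_algebraMap_of_flat (A[X] ⧸ I) (R ⧸ I.map (algebraMap A[X] R))
  have : IsPrincipalIdealRing (A[X] ⧸ I) := IsPrincipalIdealRing.of_surjective e e.surjective
  refine ⟨fun hmax => ?_, fun P hP hlt => ?_⟩
  -- A residue field would be finite over `A / m` by the Nullstellensatz, hence integral over the
  -- polynomial ring inside it, which would then be a field.
  · have hfield := (Ideal.Quotient.maximal_ideal_iff_isField_quotient _).1 hmax
    let _ := hfield.toField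
    let g := algebraMap (A[X] ⧸ I) (R ⧸ I.map (algebraMap A[X] R))
    let c : A ⧸ m →+* A[X] ⧸ I := e.toRingHom.comp C
    have hc : c.FiniteType :=
      (RingHom.FiniteType.of_surjective _ e.surjective).comp
        (RingHom.finiteType_algebraMap (A := A ⧸ m) (B := (A ⧸ m)[X]) |>.2 inferInstance)
    have hg : g.FiniteType := RingHom.finiteType_algebraMap.2 inferInstance
    let _ : Algebra (A ⧸ m) (R ⧸ I.map (algebraMap A[X] R)) := (g.comp c).toAlgebra
    have hft : Algebra.FiniteType (A ⧸ m) (R ⧸ I.map (algebraMap A[X] R)) := hg.comp hc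
    have hfin : Module.Finite (A ⧸ m) (R ⧸ I.map (algebraMap A[X] R)) :=
      finite_of_finite_type_of_isJacobsonRing _ _
    have hint : (g.comp c).IsIntegral := RingHom.Finite.to_isIntegral hfin
    have : Algebra.IsIntegral (A[X] ⧸ I) (R ⧸ I.map (algebraMap A[X] R)) :=
      ⟨RingHom.IsIntegral.tower_top c g hint⟩
    have hF := isField_of_isIntegral_of_isField hinj hfield
    exact Polynomial.not_isField (A ⧸ m) (e.toMulEquiv.isField hF)
  · have h1 : (P.map (Ideal.Quotient.mk (I.map (algebraMap A[X] R)))).IsPrime :=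
      Ideal.map_isPrime_of_surjective Ideal.Quotient.mk_surjective (by
        rw [Ideal.mk_ker]; exact hlt.le)
    have h2 := isMaximal_of_formallyUnramified hinj
      (P.map (Ideal.Quotient.mk (I.map (algebraMap A[X] R)))) fun h0 => hlt.not_ge <| by
        rwa [Ideal.map_eq_bot_iff_le_ker, Ideal.mk_ker] at h0
    have h3 := Ideal.comap_isMaximal_of_surjective (Ideal.Quotient.mk (I.map (algebraMap A[X] R)))
      Ideal.Quotient.mk_surjective (K := P.map (Ideal.Quotient.mk (I.map (algebraMap A[X] R))))
    rwa [Ideal.comap_map_mk hlt.le] at h3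

end BertiniNoether

end

noncomputable section

/-! ### Forms on an algebra and on its function field -/

section Forms

open KaehlerDifferential

/-- Forms are sums of the forms `r dx₁ ∧ ⋯ ∧ dx_q`. -/
lemma form_induction {k R : Type*} [CommRing k] [CommRing R] [Algebra k R] {q : ℕ}
    {motive : ⋀[R]^q Ω[R⁄k] → Prop}
    (smul_mk : ∀ (r : R) (x : Fin q → R), motive (r • exteriorPower.ιMulti R q fun i => D k R (x i)))
    (add : ∀ θ θ', motive θ → motive θ' → motive (θ + θ')) (θ : ⋀[R]^q Ω[R⁄k]) : motive θ := by
  have hspan := exteriorPower.ιMulti_span_of_span R q (Ω[R⁄k]) (span_range_derivation k R)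
  have hθ : θ ∈ Submodule.span R (exteriorPower.ιMulti R q ''
      {a : Fin q → Ω[R⁄k] | Set.range a ⊆ Set.range (D k R)}) := by
    rw [hspan]
    trivial
  suffices h : ∀ r : R, motive (r • θ) by simpa using h 1
  have zero : motive 0 := by simpa using smul_mk 0 0
  induction hθ using Submodule.span_induction with
  | mem θ hθ =>
    obtain ⟨a, ha, rfl⟩ := hθ
    choose x hx using fun i => ha (Set.mem_range_self i)
    obtain rfl : (fun i => D k R (x i)) = a := funext hx
    exact fun r => smul_mk r x
  | zero => simpa using zero
  | add θ θ' _ _ h h' =>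
    intro r
    rw [smul_add]
    exact add _ _ (h r) (h' r)
  | smul a θ _ h =>
    intro r
    rw [smul_smul]
    exact h _

variable (k R K : Type*) [Field k] [CommRing R] [Field K] [Algebra k R] [Algebra R K] [Algebra k K]
  [IsScalarTower k R K] (q : ℕ)

/-- The `R`-linear map `⋀^q Ω_R → ⋀^q Ω_K`. -/
def formMap : ⋀[R]^q Ω[R⁄k] →ₗ[R] ⋀[K]^q Ω[K⁄k] :=
  exteriorPower.alternatingMapLinearEquiv
    { (((exteriorPower.ιMulti K q (M := Ω[K⁄k])).toMultilinearMap.restrictScalars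
        R).compLinearMap fun _ => KaehlerDifferential.map k k R K) with
      map_eq_zero_of_eq' := fun m _ _ h hij =>
        (exteriorPower.ιMulti K q (M := Ω[K⁄k])).map_eq_zero_of_eq
          (fun i => KaehlerDifferential.map k k R K (m i)) (congrArg _ h) hij }

variable {k R q}

lemma formMap_ιMulti (m : Fin q → Ω[R⁄k]) :
    formMap k R K q (exteriorPower.ιMulti R q m) =
      exteriorPower.ιMulti K q fun i => KaehlerDifferential.map k k R K (m i) :=
  exteriorPower.alternatingMapLinearEquiv_apply_ιMulti _ _

lemma formMap_smul (r : R) (θ : ⋀[R]^q Ω[R⁄k]) :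
    formMap k R K q (r • θ) = algebraMap R K r • formMap k R K q θ := by
  rw [map_smul, algebraMap_smul]

lemma formMap_smul_ιMulti (r : R) (x : Fin q → R) :
    formMap k R K q (r • exteriorPower.ιMulti R q fun i => D k R (x i)) =
      algebraMap R K r • exteriorPower.ιMulti K q fun i => D k K (algebraMap R K (x i)) := by
  rw [map_smul, formMap_ιMulti, ← algebraMap_smul K r]
  simp only [map_D]

lemma formMap_mem_regularForms (S : Subalgebra k K) (hS : ∀ r : R, algebraMap R K r ∈ S)
    (θ : ⋀[R]^q Ω[R⁄k]) : formMap k R K q θ ∈ regularForms S q := by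
  induction θ using form_induction with
  | smul_mk r x =>
    exact AddSubgroup.subset_closure
      ⟨_, fun i => algebraMap R K (x i), hS r, fun i => hS _, formMap_smul_ιMulti K r x⟩
  | add θ θ' h h' =>
    rw [map_add]
    exact add_mem h h'

/-- After inverting an element, the module of differentials is spanned by differentials that are
linearly independent over the function field. -/
lemma exists_span_D_eq_top (k R K : Type*) [Field k] [CommRing R] [IsDomain R] [Field K]
    [Algebra k R] [Algebra R K] [Algebra k K] [IsScalarTower k R K] [IsFractionRing R K]
    [Algebra.FiniteType k R] :
    ∃ (r : R) (n : ℕ) (x : Fin n → R), r ≠ 0 ∧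
      (LinearIndependent K fun i => D k K (algebraMap R K (x i))) ∧
      ∀ (R' : Type _) [CommRing R'] [Algebra R R'] [Algebra k R'] [IsScalarTower k R R']
        [IsLocalization.Away r R'],
        Submodule.span R' (Set.range fun i => D k R' (algebraMap R R' (x i))) = ⊤ := by
  have hK := span_range_map_derivation_of_isLocalization k R K (nonZeroDivisors R)
  obtain ⟨G, hG⟩ := (inferInstance : Algebra.FiniteType k R).out
  have : Algebra.EssFiniteType R K := Algebra.EssFiniteType.of_isLocalization K (nonZeroDivisors R)
  have : Algebra.EssFiniteType k K := Algebra.EssFiniteType.comp k R K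
  have : Module.Finite K Ω[K⁄k] := inferInstance
  obtain ⟨b, hb, hbspan, hbli⟩ := exists_linearIndependent K
    (Set.range (KaehlerDifferential.map k k R K ∘ D k R))
  rw [hK] at hbspan
  have hfin : Finite b := hbli.finite
  obtain ⟨n, ⟨e⟩⟩ := Finite.exists_equiv_fin b
  choose x hx using fun i : Fin n => hb (e.symm i).2
  simp only [Function.comp_apply, KaehlerDifferential.map_D] at hx
  have hli : LinearIndependent K fun i => D k K (algebraMap R K (x i)) := by
    simp only [hx]
    exact hbli.comp _ e.symm.injective
  have hspan : Submodule.span K (Set.range fun i => D k K (algebraMap R K (x i))) = ⊤ := by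
    simp only [hx]
    rw [← hbspan]
    congr 1
    ext y
    exact ⟨fun ⟨i, hi⟩ => hi ▸ (e.symm i).2, fun hy => ⟨e ⟨y, hy⟩, by simp⟩⟩
  let N : Submodule R Ω[R⁄k] := Submodule.span R (Set.range fun i => D k R (x i))
  have key (y : R) : ∃ c : R, c ≠ 0 ∧ c • D k R y ∈ N := by
    have hy : D k K (algebraMap R K y) ∈
        Submodule.span K (Set.range fun i => D k K (algebraMap R K (x i))) := by
      rw [hspan]; trivial
    rw [Submodule.mem_span_range_iff_exists_fun] at hy
    obtain ⟨c, hc⟩ := hy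
    obtain ⟨⟨d, hd⟩, hd'⟩ := IsLocalization.exist_integer_multiples (nonZeroDivisors R)
      Finset.univ c
    choose a ha using fun i => hd' i (Finset.mem_univ i)
    have h0 : KaehlerDifferential.map k k R K (d • D k R y - ∑ i, a i • D k R (x i)) = 0 := by
      rw [map_sub, map_smul, map_sum, map_D, ← hc, Finset.smul_sum, ← Finset.sum_sub_distrib]
      refine Finset.sum_eq_zero fun i _ => ?_
      rw [map_smul, map_D, ← algebraMap_smul K (a i), ha i, smul_assoc, sub_self]
    obtain ⟨⟨c', hc'⟩, h1⟩ :=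
      (IsLocalizedModule.eq_zero_iff (nonZeroDivisors R) (KaehlerDifferential.map k k R K)).1 h0
    refine ⟨c' * d, mul_ne_zero (nonZeroDivisors.ne_zero hc') (nonZeroDivisors.ne_zero hd), ?_⟩
    rw [Submonoid.mk_smul, smul_sub, sub_eq_zero] at h1
    rw [mul_smul, h1]
    exact N.smul_mem _ (Submodule.sum_mem _ fun i _ =>
      N.smul_mem _ (Submodule.subset_span ⟨i, rfl⟩))
  choose c hc hcN using key
  refine ⟨∏ y ∈ G, c y, n, x, Finset.prod_ne_zero_iff.2 fun y _ => hc y, hli, ?_⟩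
  have hall (y : R) : (∏ y ∈ G, c y) • D k R y ∈ N := by
    have hy : y ∈ Algebra.adjoin k (G : Set R) := by rw [hG]; trivial
    induction hy using Algebra.adjoin_induction with
    | mem y hy =>
      obtain ⟨e, he⟩ := Finset.dvd_prod_of_mem c hy
      rw [he, mul_comm, mul_smul]
      exact N.smul_mem _ (hcN y)
    | algebraMap a => simp
    | add y z _ _ hy hz => rw [map_add, smul_add]; exact N.add_mem hy hz
    | mul y z _ _ hy hz =>
      rw [Derivation.leibniz, smul_add, smul_comm _ y, smul_comm _ z]
      exact N.add_mem (N.smul_mem _ hz) (N.smul_mem _ hy)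
  intro R' _ _ _ _ _
  rw [eq_top_iff, ← span_range_map_derivation_of_isLocalization k R R'
    (Submonoid.powers (∏ y ∈ G, c y)), Submodule.span_le]
  rintro _ ⟨y, rfl⟩
  have h1 : ∀ z ∈ N, KaehlerDifferential.map k k R R' z ∈
      Submodule.span R' (Set.range fun i => D k R' (algebraMap R R' (x i))) := by
    intro z hz
    induction hz using Submodule.span_induction with
    | mem z hz =>
      obtain ⟨i, rfl⟩ := hz
      rw [map_D]
      exact Submodule.subset_span ⟨i, rfl⟩
    | zero => simp
    | add z z' _ _ h h' => rw [map_add]; exact Submodule.add_mem _ h h'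
    | smul a z _ h =>
      rw [map_smul, ← algebraMap_smul R' a]
      exact Submodule.smul_mem _ _ h
  have h2 := h1 _ (hall y)
  rw [map_smul, ← algebraMap_smul R' (∏ y ∈ G, c y)] at h2
  have hu : IsUnit (algebraMap R R' (∏ y ∈ G, c y)) :=
    IsLocalization.Away.algebraMap_isUnit _
  rw [Submodule.smul_mem_iff_of_isUnit _ hu] at h2
  exact h2

/-- The exterior products of the `d xᵢ` generate the forms over `R` and remain independent over `K`,
so no relation with coefficients in `R` is lost. -/
lemma formMap_injective {n : ℕ} (x : Fin n → R)
    (hli : LinearIndependent K fun i => D k K (algebraMap R K (x i)))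
    (hinj : Function.Injective (algebraMap R K))
    (hspan : Submodule.span R (Set.range fun i => D k R (x i)) = ⊤) :
    Function.Injective (formMap k R K q) := by
  rw [injective_iff_map_eq_zero]
  intro θ hθ
  have h1 : θ ∈ Submodule.span R (Set.range
      (exteriorPower.ιMulti_family R q fun i => D k R (x i))) := by
    rw [exteriorPower.ιMulti_family_span_of_span R hspan]
    trivial
  rw [Submodule.mem_span_range_iff_exists_fun] at h1
  obtain ⟨c, rfl⟩ := h1
  have h2 := exteriorPower.ιMulti_family_linearIndependent_field (n := q) hli
  rw [Fintype.linearIndependent_iff] at h2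
  have h3 := h2 (fun s => algebraMap R K (c s)) (by
    rw [← hθ, map_sum]
    refine Finset.sum_congr rfl fun s _ => ?_
    simp only [map_smul, exteriorPower.ιMulti_family, formMap_ιMulti, algebraMap_smul,
      Function.comp_def, map_D])
  refine Finset.sum_eq_zero fun s _ => ?_
  rw [(map_eq_zero_iff _ hinj).1 (h3 s), zero_smul]

end Forms

end

noncomputable section

/-! ### Sections of the sheaf of forms and line bundles inside it -/

section Sections

variable {𝕜 : Type u} [Field 𝕜] {X : Scheme.{u}} [X.Over (Spec (.of 𝕜))]

instance sectionsAlgebra (W : X.Opens) : Algebra 𝕜 Γ(X, W) :=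
  ((structurePresheafHom (X ↘ Spec (.of 𝕜))).app (op W)).hom.toAlgebra

instance stalkAlgebra (x : X) : Algebra 𝕜 (X.presheaf.stalk x) :=
  ((structurePresheafHom (X ↘ Spec (.of 𝕜))).app (op ⊤) ≫ X.presheaf.germ ⊤ x trivial).hom.toAlgebra

lemma map_algebraMap_sections {W W' : X.Opens} (i : W' ⟶ W) (c : 𝕜) :
    X.presheaf.map i.op (algebraMap 𝕜 Γ(X, W) c) = algebraMap 𝕜 Γ(X, W') c :=
  (ConcreteCategory.congr_hom
    ((structurePresheafHom (X ↘ Spec (.of 𝕜))).naturality i.op) c).symm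

lemma germ_algebraMap_sections {W : X.Opens} (x : X) (hx : x ∈ W) (c : 𝕜) :
    X.presheaf.germ W x hx (algebraMap 𝕜 Γ(X, W) c) = algebraMap 𝕜 (X.presheaf.stalk x) c := by
  have h := map_algebraMap_sections (𝕜 := 𝕜) (homOfLE (le_top : W ≤ ⊤)) c
  rw [← h, TopCat.Presheaf.germ_res_apply]
  rfl

instance isScalarTower_functionField [IsIntegral X] (W : X.Opens) [Nonempty W] :
    IsScalarTower 𝕜 Γ(X, W) X.functionField :=
  IsScalarTower.of_algebraMap_eq fun c => (germ_algebraMap_sections _ _ c).symm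

/-- The functions regular on a nonempty open subset, as a subalgebra of the function field. -/
def regularFunctions (𝕜 : Type u) [Field 𝕜] {X : Scheme.{u}} [X.Over (Spec (.of 𝕜))]
    [IsIntegral X] (W : X.Opens) [Nonempty W] : Subalgebra 𝕜 X.functionField :=
  (IsScalarTower.toAlgHom 𝕜 Γ(X, W) X.functionField).range

lemma genericPoint_mem [IsIntegral X] (W : X.Opens) [hW : Nonempty W] : genericPoint X ∈ W :=
  ((genericPoint_spec X).mem_open_set_iff W.isOpen).mpr (by simpa using hW)

lemma algebraMap_mem_regularFunctions [IsIntegral X] (W : X.Opens) [Nonempty W] (r : Γ(X, W)) :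
    algebraMap Γ(X, W) X.functionField r ∈ regularFunctions 𝕜 W := ⟨r, rfl⟩

lemma algebraMap_map_sections [IsIntegral X] {W W' : X.Opens} [Nonempty W] [Nonempty W']
    (i : W' ⟶ W) (r : Γ(X, W)) : algebraMap Γ(X, W') X.functionField (X.presheaf.map i.op r) =
      algebraMap Γ(X, W) X.functionField r :=
  TopCat.Presheaf.germ_res_apply X.presheaf i (genericPoint X) (genericPoint_mem W') r

lemma regularFunctions_mono [IsIntegral X] {W W' : X.Opens} [Nonempty W] [Nonempty W']
    (h : W' ≤ W) : regularFunctions 𝕜 W ≤ regularFunctions 𝕜 W' := by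
  rintro _ ⟨r, rfl⟩
  exact ⟨X.presheaf.map (homOfLE h).op r, algebraMap_map_sections _ _⟩

variable (𝕜 X) in
/-- The presheaf of forms. -/
abbrev presheafOfForms (q : ℕ) : PresheafOfModules.{u} (X.presheaf ⋙ forget₂ CommRingCat RingCat) :=
  exteriorPowerPresheaf (PresheafOfModules.DifferentialsConstruction.relativeDifferentials'
    (structurePresheafHom (X ↘ Spec (.of 𝕜)))) q

variable (𝕜 X) in
/-- The map from the presheaf of forms to the sheaf of forms. -/
def toSheafOfForms (q : ℕ) : (presheafOfForms 𝕜 X q).presheaf ⟶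
    (sheafOfForms (X ↘ Spec (.of 𝕜)) q).presheaf :=
  CategoryTheory.toSheafify (Opens.grothendieckTopology X) (presheafOfForms 𝕜 X q).presheaf

instance (q : ℕ) :
    Presheaf.IsLocallyInjective (Opens.grothendieckTopology X) (toSheafOfForms 𝕜 X q) :=
  inferInstanceAs (Presheaf.IsLocallyInjective _ (CategoryTheory.toSheafify _ _))

instance (q : ℕ) :
    Presheaf.IsLocallySurjective (Opens.grothendieckTopology X) (toSheafOfForms 𝕜 X q) :=
  inferInstanceAs (Presheaf.IsLocallySurjective _ (CategoryTheory.toSheafify _ _))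

variable {q : ℕ}

/-- The section of the sheaf of forms defined by a form. -/
def sectionOfForm {W : X.Opens} : ⋀[Γ(X, W)]^q Ω[Γ(X, W)⁄𝕜] →ₗ[Γ(X, W)]
    Γ(sheafOfForms (X ↘ Spec (.of 𝕜)) q, W) :=
  ((PresheafOfModules.sheafificationAdjunction (𝟙 X.ringCatSheaf.obj)).unit.app
    (presheafOfForms 𝕜 X q) |>.app (op W)).hom

/-- The restriction of forms. -/
def restrictForm {W W' : X.Opens} (i : W' ⟶ W) :
    ⋀[Γ(X, W)]^q Ω[Γ(X, W)⁄𝕜] →+ ⋀[Γ(X, W')]^q Ω[Γ(X, W')⁄𝕜] :=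
  ((presheafOfForms 𝕜 X q).presheaf.map i.op).hom

lemma restrictForm_smul_ιMulti {W W' : X.Opens} (i : W' ⟶ W) (r : Γ(X, W)) (x : Fin q → Γ(X, W)) :
    restrictForm (𝕜 := 𝕜) i
      (r • exteriorPower.ιMulti _ q fun j => KaehlerDifferential.D 𝕜 Γ(X, W) (x j)) =
      X.presheaf.map i.op r • exteriorPower.ιMulti _ q fun j =>
        KaehlerDifferential.D 𝕜 Γ(X, W') (X.presheaf.map i.op (x j)) := by
  refine ((presheafOfForms 𝕜 X q).map_smul i.op r _).trans ?_
  refine congrArg (X.presheaf.map i.op r • ·) ?_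
  refine (exteriorPowerMapAlong_mk (X.presheaf.map i.op) _ _).trans ?_
  refine congrArg (exteriorPower.ιMulti Γ(X, W') q) (funext fun j => ?_)
  exact PresheafOfModules.DifferentialsConstruction.relativeDifferentials'_map_d
    (structurePresheafHom (X ↘ Spec (.of 𝕜))) i.op (x j)

lemma formMap_restrictForm [IsIntegral X] {W W' : X.Opens} [Nonempty W] [Nonempty W'] (i : W' ⟶ W)
    (θ : ⋀[Γ(X, W)]^q Ω[Γ(X, W)⁄𝕜]) :
    formMap 𝕜 Γ(X, W') X.functionField q (restrictForm i θ) =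
      formMap 𝕜 Γ(X, W) X.functionField q θ := by
  induction θ using form_induction with
  | smul_mk r x =>
    rw [restrictForm_smul_ιMulti, formMap_smul_ιMulti, formMap_smul_ιMulti, algebraMap_map_sections]
    simp only [algebraMap_map_sections]
  | add θ θ' h h' => rw [map_add, map_add, map_add, h, h']

lemma formMap_smul_restrictForm [IsIntegral X] {W W' : X.Opens} [Nonempty W] [Nonempty W']
    (i : W' ⟶ W) (a : Γ(X, W)) (θ : ⋀[Γ(X, W)]^q Ω[Γ(X, W)⁄𝕜]) :
    formMap 𝕜 Γ(X, W') X.functionField q (X.presheaf.map i.op a • restrictForm i θ) =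
      algebraMap Γ(X, W) X.functionField a • formMap 𝕜 Γ(X, W) X.functionField q θ := by
  rw [formMap_smul, formMap_restrictForm, algebraMap_map_sections]

lemma sectionOfForm_restrictForm {W W' : X.Opens} (i : W' ⟶ W)
    (θ : ⋀[Γ(X, W)]^q Ω[Γ(X, W)⁄𝕜]) :
    sectionOfForm (restrictForm i θ) =
      (sheafOfForms (X ↘ Spec (.of 𝕜)) q).presheaf.map i.op (sectionOfForm θ) :=
  ConcreteCategory.congr_hom ((toSheafOfForms 𝕜 X q).naturality i.op) θ

lemma exists_sectionOfForm_eq {W : X.Opens} (s : Γ(sheafOfForms (X ↘ Spec (.of 𝕜)) q, W)) {x : X}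
    (hx : x ∈ W) : ∃ (W' : X.Opens) (i : W' ⟶ W) (θ : ⋀[Γ(X, W')]^q Ω[Γ(X, W')⁄𝕜]), x ∈ W' ∧
      sectionOfForm θ = (sheafOfForms (X ↘ Spec (.of 𝕜)) q).presheaf.map i.op s := by
  obtain ⟨W', i, ⟨θ, hθ⟩, hx'⟩ := Presheaf.imageSieve_mem (Opens.grothendieckTopology X)
    (toSheafOfForms 𝕜 X q) s x hx
  exact ⟨W', i, θ, hx', hθ⟩

lemma exists_restrictForm_eq {W : X.Opens} {θ θ' : ⋀[Γ(X, W)]^q Ω[Γ(X, W)⁄𝕜]}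
    (h : sectionOfForm θ = sectionOfForm θ') {x : X} (hx : x ∈ W) :
    ∃ (W' : X.Opens) (i : W' ⟶ W), x ∈ W' ∧ restrictForm i θ = restrictForm i θ' := by
  obtain ⟨W', i, hi, hx'⟩ := Presheaf.equalizerSieve_mem (Opens.grothendieckTopology X)
    (toSheafOfForms 𝕜 X q) θ θ' h x hx
  exact ⟨W', i, hx', hi⟩

/-- Equality in the sheafification means equality after restriction to small open sets, and
restriction does not change the form at the generic point. -/
lemma formMap_eq_of_sectionOfForm_eq [IsIntegral X] {W : X.Opens} [hW : Nonempty W]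
    {θ θ' : ⋀[Γ(X, W)]^q Ω[Γ(X, W)⁄𝕜]} (h : sectionOfForm θ = sectionOfForm θ') :
    formMap 𝕜 Γ(X, W) X.functionField q θ = formMap 𝕜 Γ(X, W) X.functionField q θ' := by
  have ⟨x, hx⟩ := hW
  obtain ⟨W', i, hx', h'⟩ := exists_restrictForm_eq h hx
  have : Nonempty W' := ⟨x, hx'⟩
  rw [← formMap_restrictForm i, h', formMap_restrictForm]

lemma finiteType_sections [LocallyOfFiniteType (X ↘ Spec (.of 𝕜))] {V : X.Opens}
    (hV : IsAffineOpen V) : Algebra.FiniteType 𝕜 Γ(X, V) := by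
  have h := LocallyOfFiniteType.finiteType_appLE (f := X ↘ Spec (.of 𝕜)) (isAffineOpen_top _) hV
    le_top
  have h2 : algebraMap 𝕜 Γ(X, V) = (Scheme.Hom.appLE (X ↘ Spec (.of 𝕜)) ⊤ V le_top).hom.comp
      (Scheme.ΓSpecIso (.of 𝕜)).inv.hom := by
    rw [← CommRingCat.hom_comp]
    rfl
  rw [← RingHom.finiteType_algebraMap, h2]
  exact h.comp (RingHom.FiniteType.of_surjective _
    (ConcreteCategory.bijective_of_isIso (Scheme.ΓSpecIso (.of 𝕜)).inv).2)

/-- The kernel of the passage to the generic point is torsion. It disappears on an open set where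
the differentials are generated by elements independent over the function field. -/
lemma exists_restrictForm_eq_zero [IsIntegral X] [LocallyOfFiniteType (X ↘ Spec (.of 𝕜))]
    {W : X.Opens} [hW : Nonempty W] {θ : ⋀[Γ(X, W)]^q Ω[Γ(X, W)⁄𝕜]}
    (h : formMap 𝕜 Γ(X, W) X.functionField q θ = 0) :
    ∃ (W' : X.Opens) (i : W' ⟶ W), Nonempty W' ∧ restrictForm i θ = 0 := by
  have ⟨x, hx⟩ := hW
  obtain ⟨_, ⟨V, hV, rfl⟩, hxV, hVW⟩ := X.isBasis_affineOpens.exists_subset_of_mem_open hx W.isOpen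
  have hV : IsAffineOpen V := hV
  have : Nonempty V := ⟨x, hxV⟩
  have := functionField_isFractionRing_of_isAffineOpen X V hV
  have : Algebra.FiniteType 𝕜 Γ(X, V) := finiteType_sections hV
  obtain ⟨r, n, y, hr, hli, hspan⟩ := exists_span_D_eq_top 𝕜 Γ(X, V) X.functionField
  have : Nonempty (X.basicOpen r) := by
    by_contra h0
    refine hr ((basicOpen_eq_bot_iff r).1 ?_)
    rw [not_nonempty_iff] at h0
    exact TopologicalSpace.Opens.ext (Set.isEmpty_coe_sort.1 h0)
  have hle : X.basicOpen r ≤ V := X.basicOpen_le r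
  let _ : Algebra Γ(X, V) Γ(X, X.basicOpen r) := (X.presheaf.map (homOfLE hle).op).hom.toAlgebra
  have : IsScalarTower 𝕜 Γ(X, V) Γ(X, X.basicOpen r) :=
    IsScalarTower.of_algebraMap_eq fun c => (map_algebraMap_sections _ c).symm
  have : IsLocalization.Away r Γ(X, X.basicOpen r) := hV.isLocalization_basicOpen r
  have halg (z : Γ(X, V)) : algebraMap Γ(X, X.basicOpen r) X.functionField
      (algebraMap Γ(X, V) Γ(X, X.basicOpen r) z) = algebraMap Γ(X, V) X.functionField z :=
    algebraMap_map_sections _ z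
  have hinj := formMap_injective (q := q) (k := 𝕜) (R := Γ(X, X.basicOpen r)) X.functionField
    (fun i => algebraMap Γ(X, V) Γ(X, X.basicOpen r) (y i)) (by simpa only [halg] using hli)
    (X.germToFunctionField_injective _) (hspan _)
  let i : X.basicOpen r ⟶ W := homOfLE (hle.trans hVW)
  refine ⟨X.basicOpen r, i, inferInstance, hinj ?_⟩
  rw [formMap_restrictForm, h, map_zero]

/-- A line bundle is generated by one section near every point. -/
structure IsGenerator {L : X.Modules} {W : X.Opens} (e : Γ(L, W)) : Prop where
  exists_smul_eq : ∀ {W' : X.Opens} (i : W' ⟶ W) (s : Γ(L, W')),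
    ∃ a : Γ(X, W'), s = a • L.presheaf.map i.op e
  eq_zero : ∀ {W' : X.Opens} (i : W' ⟶ W) (a : Γ(X, W')), a • L.presheaf.map i.op e = 0 → a = 0

lemma IsGenerator.map {L : X.Modules} {W W' : X.Opens} {e : Γ(L, W)} (he : IsGenerator e)
    (i : W' ⟶ W) : IsGenerator (L.presheaf.map i.op e) where
  exists_smul_eq j s := by
    rw [← ConcreteCategory.comp_apply, ← Functor.map_comp, ← op_comp]
    exact he.exists_smul_eq _ s
  eq_zero j a h := by
    rw [← ConcreteCategory.comp_apply, ← Functor.map_comp, ← op_comp] at h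
    exact he.eq_zero _ a h

lemma exists_isGenerator {L : X.Modules} (hL : IsLineBundle L) (x : X) :
    ∃ (W : X.Opens) (e : Γ(L, W)), x ∈ W ∧ IsGenerator e := by
  obtain ⟨U, hxU, ⟨φ₀⟩⟩ := hL x
  let O : U.toScheme.Modules := SheafOfModules.unit U.toScheme.ringCatSheaf
  let φ : L.restrict U.ι ≅ O := φ₀
  let one (V : U.toScheme.Opens) : Γ(O, V) := (1 : Γ(U.toScheme, V))
  let e : Γ(L.restrict U.ι, ⊤) := φ.inv.app ⊤ (one ⊤)
  have hinv (V : U.toScheme.Opens) (s : Γ(L.restrict U.ι, V)) :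
      φ.inv.app V (φ.hom.app V s) = s := by
    rw [← ConcreteCategory.comp_apply, ← Scheme.Modules.Hom.comp_app, φ.hom_inv_id]
    rfl
  have hinv' (V : U.toScheme.Opens) (s : Γ(O, V)) : φ.hom.app V (φ.inv.app V s) = s := by
    rw [← ConcreteCategory.comp_apply, ← Scheme.Modules.Hom.comp_app, φ.inv_hom_id]
    rfl
  have hone (V : U.toScheme.Opens) (i : V ⟶ ⊤) :
      φ.inv.app V (one V) = (L.restrict U.ι).presheaf.map i.op e := by
    have h1 : one V = O.presheaf.map i.op (one ⊤) :=
      (map_one (U.toScheme.presheaf.map i.op).hom).symm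
    rw [h1]
    exact ConcreteCategory.congr_hom (φ.inv.mapPresheaf.naturality i.op) (one ⊤)
  have hsmul (V : U.toScheme.Opens) (a : Γ(U.toScheme, V)) : φ.inv.app V (a • one V) =
      a • φ.inv.app V (one V) := φ.inv.app_smul a _
  have hV {W' : X.Opens} (i : W' ⟶ U.ι ''ᵁ ⊤) : ∃ V : U.toScheme.Opens, W' = U.ι ''ᵁ V := by
    refine ⟨U.ι ⁻¹ᵁ W', ?_⟩
    rw [Scheme.Hom.image_preimage_eq_opensRange_inf]
    exact (inf_eq_right.2 (i.le.trans (by rw [Scheme.Hom.image_top_eq_opensRange]))).symm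
  refine ⟨U.ι ''ᵁ ⊤, e, ?_, ?_, ?_⟩
  · rw [Scheme.Hom.image_top_eq_opensRange, Scheme.Opens.opensRange_ι]
    exact hxU
  · intro W' i s
    obtain ⟨V, rfl⟩ := hV i
    let a : Γ(U.toScheme, V) := φ.hom.app V s
    refine ⟨(U.ι.appIso V).inv a, ?_⟩
    have h1 : s = a • φ.inv.app V (one V) := by
      rw [← hsmul]
      have h2 : a • one V = φ.hom.app V s := mul_one a
      rw [h2]
      exact (hinv V s).symm
    rw [hone V (homOfLE le_top)] at h1
    exact h1
  · intro W' i a h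
    obtain ⟨V, rfl⟩ := hV i
    let a' : Γ(U.toScheme, V) := (U.ι.appIso V).hom a
    have ha' : (U.ι.appIso V).inv a' = a := by
      simp only [a', ← ConcreteCategory.comp_apply, Iso.hom_inv_id]
      rfl
    have h1 : a' • φ.inv.app V (one V) = 0 := by
      have h0 : (U.ι.appIso V).inv a' • L.presheaf.map i.op e = 0 := by rw [ha', h]
      rw [hone V (homOfLE le_top)]
      exact h0
    rw [← hsmul] at h1
    have h2 : a' • one V = 0 := by
      rw [← hinv' V (a' • one V), h1, map_zero]
    have h3 : a' = 0 := (mul_one a').symm.trans h2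
    rw [← ha', h3, map_zero]

/-- Vanishing of a section in terms of a local generator. -/
lemma vanishesAt_iff {L : X.Modules} {W : X.Opens} {e : Γ(L, W)} (he : IsGenerator e) {x : X}
    (hx : x ∈ W) (s : Γ(L, ⊤)) (a : Γ(X, W))
    (hs : L.presheaf.map (homOfLE (le_top : W ≤ ⊤)).op s = a • e) :
    VanishesAt L s x ↔ X.presheaf.germ W x hx a ∈ IsLocalRing.maximalIdeal (X.presheaf.stalk x) := by
  -- The germ of `e` is a free generator of the stalk: `hgen` shows generation and `hzero` freeness.
  have hgen (y : ↑(TopCat.Presheaf.stalk L.presheaf x)) : ∃ r : X.presheaf.stalk x,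
      y = r • L.presheaf.germ W x hx e := by
    obtain ⟨W', hx', s', rfl⟩ := L.presheaf.exists_germ_eq y
    obtain ⟨a', ha'⟩ := he.exists_smul_eq (homOfLE inf_le_left : W ⊓ W' ⟶ W)
      (L.presheaf.map (homOfLE inf_le_right : W ⊓ W' ⟶ W').op s')
    refine ⟨X.presheaf.germ (W ⊓ W') x ⟨hx, hx'⟩ a', ?_⟩
    rw [← TopCat.Presheaf.germ_res_apply L.presheaf (homOfLE inf_le_right : W ⊓ W' ⟶ W') x
      ⟨hx, hx'⟩ s', ha', ← TopCat.Presheaf.germ_res_apply L.presheaf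
      (homOfLE inf_le_left : W ⊓ W' ⟶ W) x ⟨hx, hx'⟩ e]
    exact PresheafOfModules.germ_smul (R := X.presheaf) L.val x _ _ _ _
  have hzero (r : X.presheaf.stalk x) (h : r • L.presheaf.germ W x hx e = 0) : r = 0 := by
    obtain ⟨W', hx', a', rfl⟩ := X.presheaf.exists_germ_eq r
    let W₁ := W ⊓ W'
    let i : W₁ ⟶ W := homOfLE inf_le_left
    let i' : W₁ ⟶ W' := homOfLE inf_le_right
    have hx₁ : x ∈ W₁ := ⟨hx, hx'⟩
    have h1 : L.presheaf.germ W₁ x hx₁ (X.presheaf.map i'.op a' • L.presheaf.map i.op e) =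
        L.presheaf.germ W₁ x hx₁ 0 := by
      rw [map_zero, ← h, ← TopCat.Presheaf.germ_res_apply X.presheaf i' x hx₁ a',
        ← TopCat.Presheaf.germ_res_apply L.presheaf i x hx₁ e]
      exact PresheafOfModules.germ_smul (R := X.presheaf) L.val x _ _ _ _
    obtain ⟨W₂, hx₂, j, j', h2⟩ := L.presheaf.germ_eq x hx₁ hx₁ _ _ h1
    rw [map_zero, Scheme.Modules.map_smul] at h2
    have h3 := (he.map i).eq_zero j _ h2
    rw [← TopCat.Presheaf.germ_res_apply X.presheaf i' x hx₁ a',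
      ← TopCat.Presheaf.germ_res_apply X.presheaf j x hx₂, h3, map_zero]
  have hs' : L.presheaf.germ ⊤ x trivial s =
      X.presheaf.germ W x hx a • L.presheaf.germ W x hx e := by
    rw [← TopCat.Presheaf.germ_res_apply L.presheaf (homOfLE le_top) x hx s, hs]
    exact PresheafOfModules.germ_smul (R := X.presheaf) L.val x _ _ _ _
  rw [VanishesAt, hs']
  constructor
  · intro h
    have key : ∀ y ∈ IsLocalRing.maximalIdeal (X.presheaf.stalk x) •
        (⊤ : Submodule (X.presheaf.stalk x) ↑(TopCat.Presheaf.stalk L.presheaf x)),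
        ∃ r ∈ IsLocalRing.maximalIdeal (X.presheaf.stalk x),
          y = r • L.presheaf.germ W x hx e := by
      intro y hy
      induction hy using Submodule.smul_induction_on' with
      | smul r hr y _ =>
        obtain ⟨r', rfl⟩ := hgen y
        exact ⟨r * r', Ideal.mul_mem_right _ _ hr, (mul_smul _ _ _).symm⟩
      | add y _ z _ hy hz =>
        obtain ⟨r, hr, rfl⟩ := hy
        obtain ⟨r', hr', rfl⟩ := hz
        exact ⟨r + r', add_mem hr hr', (add_smul _ _ _).symm⟩
    obtain ⟨r, hr, h1⟩ := key _ h
    rw [← sub_eq_zero, ← sub_smul] at h1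
    rwa [sub_eq_zero.1 (hzero _ h1)]
  · intro h
    exact Submodule.smul_mem_smul h trivial

/-- A line bundle of `q`-forms consists, up to a nonzero factor, of the multiples of one form of the
function field. -/
theorem exists_form_of_mono [IsIntegral X] [LocallyOfFiniteType (X ↘ Spec (.of 𝕜))]
    {L : X.Modules} (hL : IsLineBundle L) (φ : L ⟶ sheafOfForms (X ↘ Spec (.of 𝕜)) q) [Mono φ]
    (U : X.Opens) (hU : (U : Set X).Nonempty) :
    ∃ (W₀ : X.Opens) (_ : Nonempty W₀) (ω : ⋀[X.functionField]^q Ω[X.functionField⁄𝕜])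
      (g : Γ(L, ⊤) → Γ(X, W₀)), W₀ ≤ U ∧ ω ≠ 0 ∧
      (∀ s (x : X) (hx : x ∈ W₀), VanishesAt L s x ↔
        X.presheaf.germ W₀ x hx (g s) ∈ IsLocalRing.maximalIdeal (X.presheaf.stalk x)) ∧
      ∀ x : X, ∃ (W : X.Opens) (_ : Nonempty W), x ∈ W ∧ ∀ s,
        algebraMap Γ(X, W₀) X.functionField (g s) • ω ∈ regularForms (regularFunctions 𝕜 W) q := by
  -- local generators whose images are given by forms
  have hloc (x : X) : ∃ (W : X.Opens) (e : Γ(L, W)) (θ : ⋀[Γ(X, W)]^q Ω[Γ(X, W)⁄𝕜]), x ∈ W ∧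
      IsGenerator e ∧ sectionOfForm θ = φ.app W e := by
    obtain ⟨W, e, hx, he⟩ := exists_isGenerator hL x
    obtain ⟨W', i, θ, hx', hθ⟩ := exists_sectionOfForm_eq (φ.app W e) hx
    refine ⟨W', L.presheaf.map i.op e, θ, hx', he.map i, hθ.trans ?_⟩
    exact (ConcreteCategory.congr_hom (φ.mapPresheaf.naturality i.op) e).symm
  have hres {W W' : X.Opens} (i : W' ⟶ W) {e : Γ(L, W)} {θ : ⋀[Γ(X, W)]^q Ω[Γ(X, W)⁄𝕜]}
      (h : sectionOfForm θ = φ.app W e) :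
      sectionOfForm (restrictForm i θ) = φ.app W' (L.presheaf.map i.op e) := by
    rw [sectionOfForm_restrictForm, h]
    exact (ConcreteCategory.congr_hom (φ.mapPresheaf.naturality i.op) e).symm
  have hres' {W W' : X.Opens} (i : W' ⟶ W) {e : Γ(L, W)} {θ : ⋀[Γ(X, W)]^q Ω[Γ(X, W)⁄𝕜]}
      (h : sectionOfForm θ = φ.app W e) {s : Γ(L, ⊤)} {a : Γ(X, W)}
      (hs : L.presheaf.map (homOfLE le_top).op s = a • e) :
      sectionOfForm (X.presheaf.map i.op a • restrictForm i θ) =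
        φ.app W' (L.presheaf.map (homOfLE le_top).op s) := by
    refine (sectionOfForm.map_smul _ _).trans ((congrArg _ (hres i h)).trans
      ((φ.app_smul _ _).symm.trans (congrArg _ ?_)))
    rw [← Scheme.Modules.map_smul, ← hs, ← ConcreteCategory.comp_apply, ← Functor.map_comp]
    rfl
  have hmono (W : X.Opens) : Function.Injective (φ.app W) := by
    have h1 : Mono ((Scheme.Modules.toPresheaf X).map φ) := inferInstance
    have h2 : Mono (((Scheme.Modules.toPresheaf X).map φ).app (op W)) := inferInstance
    exact (AddCommGrpCat.mono_iff_injective _).1 h2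
  obtain ⟨x₀, hx₀⟩ := hU
  obtain ⟨W₁, e₁, θ₁, hx₁, he₁, hθ₁⟩ := hloc x₀
  obtain ⟨W₂, hW₂, hW₂', hx₂⟩ : ∃ W₂ : X.Opens, W₂ ≤ W₁ ∧ W₂ ≤ U ∧ x₀ ∈ W₂ :=
    ⟨W₁ ⊓ U, inf_le_left, inf_le_right, hx₁, hx₀⟩
  let i₀ : W₂ ⟶ W₁ := homOfLE hW₂
  let e₀ := L.presheaf.map i₀.op e₁
  have he₀ : IsGenerator e₀ := he₁.map i₀
  let θ₀ := restrictForm i₀ θ₁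
  have hθ₀ : sectionOfForm θ₀ = φ.app _ e₀ := hres i₀ hθ₁
  have hne : Nonempty W₂ := ⟨x₀, hx₂⟩
  have hg (s : Γ(L, ⊤)) : ∃ a : Γ(X, W₂), L.presheaf.map (homOfLE le_top).op s = a • e₀ := by
    obtain ⟨a, ha⟩ := he₀.exists_smul_eq (𝟙 _) (L.presheaf.map (homOfLE le_top).op s)
    refine ⟨a, ha.trans ?_⟩
    rw [op_id, CategoryTheory.Functor.map_id]
    rfl
  choose g hg using hg
  refine ⟨W₂, hne, formMap 𝕜 _ _ q θ₀, g, hW₂', fun h0 => ?_,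
    fun s x hx => vanishesAt_iff he₀ hx s _ (hg s), fun x => ?_⟩
  -- If `ω` were zero, the generator would map to zero on a smaller nonempty open set, against the
  -- injectivity of `φ`.
  · obtain ⟨W', i, hne', h1⟩ := exists_restrictForm_eq_zero h0
    have h2 := hres i hθ₀
    rw [h1, map_zero] at h2
    have h3 : L.presheaf.map i.op e₀ = 0 := hmono W' (h2.symm.trans (map_zero _).symm)
    have h4 := he₀.eq_zero i 1 (by rw [h3, smul_zero])
    exact one_ne_zero h4
  · obtain ⟨W, e, θ, hxW, he, hθ⟩ := hloc x
    have hneW : Nonempty W := ⟨x, hxW⟩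
    refine ⟨W, hneW, hxW, fun s => ?_⟩
    obtain ⟨a, ha⟩ := he.exists_smul_eq (𝟙 _) (L.presheaf.map (homOfLE le_top).op s)
    have ha' : L.presheaf.map (homOfLE le_top).op s = a • e := by
      refine ha.trans ?_
      rw [op_id, CategoryTheory.Functor.map_id]
      rfl
    obtain ⟨W₃, hW₃, hW₃', hneI⟩ : ∃ W₃ : X.Opens, W₃ ≤ W₂ ∧ W₃ ≤ W ∧ Nonempty W₃ :=
      ⟨W₂ ⊓ W, inf_le_left, inf_le_right, genericPoint X, genericPoint_mem W₂, genericPoint_mem W⟩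
    let j : W₃ ⟶ W₂ := homOfLE hW₃
    let j' : W₃ ⟶ W := homOfLE hW₃'
    -- Both sides represent the image of `s` on the intersection, once in terms of each local
    -- generator.
    have h1 : sectionOfForm (X.presheaf.map j.op (g s) • restrictForm j θ₀) =
        sectionOfForm (X.presheaf.map j'.op a • restrictForm j' θ) :=
      (hres' j hθ₀ (hg s)).trans (hres' j' hθ ha').symm
    have h2 := formMap_eq_of_sectionOfForm_eq h1
    have h3 : algebraMap Γ(X, W₂) X.functionField (g s) • formMap 𝕜 _ X.functionField q θ₀ =
        formMap 𝕜 _ X.functionField q (a • θ) :=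
      (formMap_smul_restrictForm j (g s) θ₀).symm.trans
        (h2.trans ((formMap_smul_restrictForm j' a θ).trans (formMap_smul _ a θ).symm))
    rw [h3]
    exact formMap_mem_regularForms _ _ (algebraMap_mem_regularFunctions W) _

end Sections

end

/-! ### Étale coordinates on algebras with smooth generic fibre -/

noncomputable section
open Polynomial

/-- By Krull's intersection theorem every nonzero element is a unit times a power of `π`. -/
lemma isDomain_of_maximalIdeal_eq_span {T : Type*} [CommRing T] [IsLocalRing T] [IsNoetherianRing T]
    (π : T) (hπ : IsLocalRing.maximalIdeal T = Ideal.span {π}) (h0 : π = 0 ∨ π ∈ nonZeroDivisors T) :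
    IsDomain T := by
  have key (x : T) (hx : x ≠ 0) : ∃ n : ℕ, ∃ y : T, IsUnit y ∧ x = π ^ n * y := by
    have hf : FiniteMultiplicity π x := by
      by_contra hf
      apply hx
      have : x ∈ (⨅ i : ℕ, IsLocalRing.maximalIdeal T ^ i) := by
        rw [Ideal.mem_iInf]
        intro i
        rw [hπ, Ideal.span_singleton_pow, Ideal.mem_span_singleton]
        exact FiniteMultiplicity.not_iff_forall.mp hf i
      rwa [Ideal.iInf_pow_eq_bot_of_isLocalRing _ (IsLocalRing.maximalIdeal.isMaximal T).ne_top] at this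
    obtain ⟨c, hc, hd⟩ := hf.exists_eq_pow_mul_and_not_dvd
    refine ⟨_, c, ?_, hc⟩
    rw [← Ideal.mem_span_singleton, ← hπ, IsLocalRing.mem_maximalIdeal, mem_nonunits_iff, not_not]
      at hd
    exact hd
  have : NoZeroDivisors T := by
    refine ⟨fun {x y} hxy ↦ ?_⟩
    by_contra! hne
    obtain ⟨n, a, ha, rfl⟩ := key x hne.1
    obtain ⟨m, b, hb, rfl⟩ := key y hne.2
    rw [mul_mul_mul_comm, ← pow_add] at hxy
    have h1 : π ^ (n + m) = 0 := (ha.mul hb).mul_left_eq_zero.mp hxy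
    rcases h0 with h0 | h0
    · subst h0
      have h2 : n + m ≠ 0 := by
        intro h
        rw [h, pow_zero] at h1
        exact one_ne_zero h1
      rcases Nat.eq_zero_or_pos n with hn | hn
      · have hm : m ≠ 0 := by omega
        exact hne.2 (by rw [zero_pow hm, zero_mul])
      · exact hne.1 (by rw [zero_pow hn.ne', zero_mul])
    · have := pow_mem h0 (n + m)
      rw [h1] at this
      exact zero_notMem_nonZeroDivisors this
  exact NoZeroDivisors.to_isDomain T

/-- The prime below is principal. Its generator generates the maximal ideal above because the
algebra is unramified, and it is zero or a nonzerodivisor because the algebra is flat. -/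
lemma isDomain_localization_of_etale_polynomial {K S : Type u} [Field K] [CommRing S]
    [Algebra K[X] S] [Algebra.Etale K[X] S] (q : Ideal S) [q.IsPrime] :
    IsDomain (Localization.AtPrime q) := by
  let p := q.under K[X]
  let := Localization.AtPrime.algebraOfLiesOver p q
  have : IsScalarTower K[X] (Localization.AtPrime p) (Localization.AtPrime q) := inferInstance
  have : Algebra.FormallyUnramified K[X] (Localization.AtPrime q) :=
    Algebra.FormallyUnramified.comp _ S _
  have : Algebra.FormallyUnramified (Localization.AtPrime p) (Localization.AtPrime q) :=
    Algebra.FormallyUnramified.of_restrictScalars K[X] _ _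
  have : Algebra.EssFiniteType K[X] (Localization.AtPrime q) := Algebra.EssFiniteType.comp _ S _
  have : Algebra.EssFiniteType (Localization.AtPrime p) (Localization.AtPrime q) :=
    Algebra.EssFiniteType.of_comp K[X] _ _
  have : IsLocalHom (algebraMap (Localization.AtPrime p) (Localization.AtPrime q)) := inferInstance
  have : IsNoetherianRing S := Algebra.FiniteType.isNoetherianRing K[X] S
  have : IsNoetherianRing (Localization.AtPrime q) := IsLocalization.isNoetherianRing q.primeCompl _ this
  obtain ⟨π, hπ⟩ := (IsPrincipalIdealRing.principal p).principal
  rw [← Ideal.span] at hπ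
  have hm : IsLocalRing.maximalIdeal (Localization.AtPrime q) =
      Ideal.span {algebraMap K[X] (Localization.AtPrime q) π} := by
    rw [← Algebra.FormallyUnramified.map_maximalIdeal (R := Localization.AtPrime p),
      ← Localization.AtPrime.map_eq_maximalIdeal, Ideal.map_map,
      ← IsScalarTower.algebraMap_eq, hπ, Ideal.map_span, Set.image_singleton]
  refine isDomain_of_maximalIdeal_eq_span _ hm ?_
  by_cases h0 : π = 0
  · left
    rw [h0, map_zero]
  · right
    have : Module.Flat K[X] S := inferInstance
    have : Module.Flat K[X] (Localization.AtPrime q) := Module.Flat.trans _ S _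
    have h1 : IsSMulRegular (Localization.AtPrime q) π :=
      Module.Flat.isSMulRegular_of_nonZeroDivisors (mem_nonZeroDivisors_of_ne_zero h0)
    rw [mem_nonZeroDivisors_iff_right]
    intro x hx
    exact h1 (show π • x = π • 0 by rw [smul_zero, Algebra.smul_def, mul_comm, hx])

/-- A finite type algebra that is smooth of relative dimension one over the generic point of the base
is étale over the affine line around each prime over the generic point. -/
lemma exists_etale_away {A R : Type u} [CommRing A] [IsDomain A] [IsNoetherianRing A] [CommRing R]
    [Algebra A R] [Algebra.FiniteType A R]
    (h : RingHom.Locally (RingHom.IsStandardSmoothOfRelativeDimension 1)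
      (algebraMap (FractionRing A) (TensorProduct A (FractionRing A) R)))
    (q : Ideal R) [q.IsPrime] (hq : q.comap (algebraMap A R) = ⊥) :
    ∃ (f : R) (_ : f ∉ q) (R' : Type u) (_ : CommRing R') (_ : Algebra R R') (_ : Algebra A R')
      (_ : IsScalarTower A R R') (_ : IsLocalization.Away f R') (t : R'),
      (aeval t : A[X] →ₐ[A] R').toRingHom.Etale := by
  let κ := FractionRing A
  let S := TensorProduct A κ R
  obtain ⟨s, hs, hst⟩ := h
  let Lq := Localization.AtPrime q
  have hAL : ∀ a : nonZeroDivisors A, IsUnit (algebraMap A Lq a) := by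
    intro a
    rw [IsScalarTower.algebraMap_apply A R Lq]
    refine IsLocalization.map_units Lq (⟨algebraMap A R a, fun h ↦ ?_⟩ : q.primeCompl)
    have h1 : (a : A) ∈ q.comap (algebraMap A R) := h
    rw [hq, Ideal.mem_bot] at h1
    exact nonZeroDivisors.coe_ne_zero a h1
  let σ : κ →ₐ[A] Lq := IsLocalization.liftAlgHom (M := nonZeroDivisors A) (f := Algebra.ofId A Lq) hAL
  -- As `q` lies over zero, nonzero elements of `A` are invertible at `q`, so the local ring at `q`
  -- receives a map from the generic fibre. One of the standard smooth pieces then contains the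
  -- point.
  let ρ₀ : S →ₐ[A] Lq := Algebra.TensorProduct.lift σ (IsScalarTower.toAlgHom A R Lq)
    (fun _ _ ↦ Commute.all _ _)
  obtain ⟨w, hws, hw⟩ : ∃ w ∈ s, IsUnit (ρ₀ w) := by
    by_contra! hne
    have h1 : Ideal.span s ≤ (IsLocalRing.maximalIdeal Lq).comap ρ₀ :=
      Ideal.span_le.mpr fun w hw ↦ (IsLocalRing.mem_maximalIdeal _).mpr (hne w hw)
    rw [hs, top_le_iff, Ideal.comap_eq_top_iff] at h1
    exact (IsLocalRing.maximalIdeal.isMaximal Lq).ne_top h1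
  let Sw := Localization.Away w
  let ρ : Sw →+* Lq := IsLocalization.Away.lift w (g := ρ₀.toRingHom) hw
  have hρ (z : S) : ρ (algebraMap S Sw z) = ρ₀ z := IsLocalization.Away.lift_eq w hw z
  obtain ⟨g, hgC, hg⟩ := (hst w hws).exists_etale_mvPolynomial
  -- The étale coordinate of the generic fibre, viewed at `q`, is a fraction `c / d`; it is spread
  -- out to the function `t₁` on the localization at `d`.
  obtain ⟨⟨c, d⟩, hcd⟩ := IsLocalization.surj q.primeCompl (ρ (g (MvPolynomial.X 0)))
  let R₁ := Localization.Away (d : R)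
  let t₁ : R₁ := IsLocalization.mk' R₁ c ⟨(d : R), Submonoid.mem_powers _⟩
  have hd : IsUnit (algebraMap R Lq d) := IsLocalization.map_units Lq d
  let ι : R₁ →ₐ[R] Lq := IsLocalization.liftAlgHom (M := Submonoid.powers (d : R))
    (f := Algebra.ofId R Lq) (by rintro ⟨_, n, rfl⟩; simpa using hd.pow n)
  have hι : ι t₁ = ρ (g (MvPolynomial.X 0)) := by
    refine hd.mul_right_cancel ?_
    rw [hcd, ← ι.commutes, ← map_mul]
    refine (congrArg ι (IsLocalization.mk'_spec R₁ c ⟨(d : R), Submonoid.mem_powers _⟩)).trans ?_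
    exact ι.commutes c
  let q₁ : Ideal R₁ := (IsLocalRing.maximalIdeal Lq).comap ι
  have hq₁ : q₁.comap (algebraMap R R₁) = q := by
    refine Eq.trans ?_ (Localization.AtPrime.under_maximalIdeal (I := q))
    ext x
    change ι (algebraMap R R₁ x) ∈ IsLocalRing.maximalIdeal Lq ↔ _
    rw [ι.commutes]
    rfl
  let L₁ := Localization.AtPrime q₁
  let := (aeval t₁ : A[X] →ₐ[A] R₁).toRingHom.toAlgebra
  have : IsScalarTower A A[X] R₁ := .of_algebraMap_eq' (by ext a; exact (AlgHom.commutes (aeval t₁ : A[X] →ₐ[A] R₁) a).symm)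
  have : Algebra.FinitePresentation A[X] R₁ := by
    have : Algebra.FiniteType A R₁ := Algebra.FiniteType.trans (S := R) ‹_›
      (IsLocalization.finiteType_of_monoid_fg (Submonoid.powers (d : R)) R₁)
    have : Algebra.FiniteType A[X] R₁ := Algebra.FiniteType.of_restrictScalars_finiteType A _ _
    exact Algebra.FinitePresentation.of_finiteType.mp this
  -- The map to the local ring factors through `κ[X]` and the standard smooth piece `Sw`, and each
  -- factor is formally étale.
  have : Algebra.IsEtaleAt A[X] q₁ := by
    have hL₁ : ∀ x : q.primeCompl, IsUnit (algebraMap R L₁ x) := by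
      intro x
      rw [IsScalarTower.algebraMap_apply R R₁ L₁]
      refine IsLocalization.map_units L₁ (⟨algebraMap R R₁ x, fun h ↦ x.2 (hq₁.le h)⟩ : q₁.primeCompl)
    let ν : Lq →ₐ[R] L₁ := IsLocalization.liftAlgHom (M := q.primeCompl) (f := Algebra.ofId R L₁) hL₁
    have hνι : ν.comp ι = IsScalarTower.toAlgHom R R₁ L₁ :=
      IsLocalization.algHom_ext (Submonoid.powers (d : R)) (by ext)
    have hSw : ((ν.toRingHom.comp ρ).comp (algebraMap S Sw)).comp
        (Algebra.TensorProduct.includeRight : R →ₐ[A] S).toRingHom = algebraMap R L₁ := by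
      ext x
      change ν (ρ (algebraMap S Sw (1 ⊗ₜ x))) = _
      rw [hρ]
      change ν (Algebra.TensorProduct.lift σ (IsScalarTower.toAlgHom A R Lq) _ (1 ⊗ₜ x)) = _
      rw [Algebra.TensorProduct.lift_tmul, map_one, one_mul]
      exact ν.commutes x
    have h1 : (ν.toRingHom.comp ρ).FormallyEtale := by
      let : Algebra R S := (Algebra.TensorProduct.includeRight : R →ₐ[A] S).toRingHom.toAlgebra
      have : Algebra.FormallyEtale A κ := .of_isLocalization (nonZeroDivisors A)
      have : Algebra.FormallyEtale R S := .of_equiv (A := TensorProduct A R κ)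
        { (Algebra.TensorProduct.comm A R κ) with commutes' := fun _ ↦ rfl }
      have : Algebra.FormallyEtale S Sw := .of_isLocalization (.powers w)
      have : Algebra.FormallyEtale R Sw := .comp R S Sw
      let := (ν.toRingHom.comp ρ).toAlgebra
      have : IsScalarTower R Sw L₁ := .of_algebraMap_eq' (by
        rw [IsScalarTower.algebraMap_eq R S Sw]
        exact hSw.symm)
      have : Algebra.FormallyEtale R R₁ := .of_isLocalization (.powers (d : R))
      have : Algebra.FormallyEtale R₁ L₁ := .of_isLocalization q₁.primeCompl
      have : Algebra.FormallyEtale R L₁ := .comp R R₁ L₁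
      exact Algebra.FormallyEtale.of_restrictScalars (R := R)
    let e := (MvPolynomial.uniqueAlgEquiv κ (Fin 1)).symm
    have h2 : (g.comp e.toRingEquiv.toRingHom).FormallyEtale := by
      have h6 : e.toRingEquiv.toRingHom.Etale := .of_bijective e.bijective
      have h7 := RingHom.Etale.stableUnderComposition _ _ h6 hg
      exact @Algebra.Etale.formallyEtale _ _ _ _ _ h7
    have h3 : (Polynomial.mapRingHom (algebraMap A κ)).FormallyEtale := by
      let := Polynomial.algebra A κ
      have := Polynomial.isLocalization (nonZeroDivisors A) κ
      have := Algebra.FormallyEtale.of_isLocalization (Rₘ := κ[X]) ((nonZeroDivisors A).map C)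
      exact this
    have h4 := (h3.comp h2).comp h1
    have h5 : (ν.toRingHom.comp ρ).comp ((g.comp e.toRingEquiv.toRingHom).comp
        (Polynomial.mapRingHom (algebraMap A κ))) = algebraMap A[X] L₁ := by
      rw [IsScalarTower.algebraMap_eq A[X] R₁ L₁]
      refine Polynomial.ringHom_ext' ?_ ?_
      · ext a
        have h6 : g (MvPolynomial.C (algebraMap A κ a)) = algebraMap S Sw (algebraMap A S a) := by
          rw [← RingHom.comp_apply, hgC, RingHom.comp_apply]
          rfl
        have h7 : e (C (algebraMap A κ a)) = MvPolynomial.C (algebraMap A κ a) := by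
          simp [e]
        have h8 : (algebraMap A[X] R₁) (C a) = algebraMap A R₁ a :=
          AlgHom.commutes (aeval t₁ : A[X] →ₐ[A] R₁) a
        simp only [RingHom.comp_apply, Polynomial.coe_mapRingHom,
          Polynomial.map_C]
        refine (congrArg (fun z ↦ ν (ρ (g z))) h7).trans ?_
        rw [h6, h8, hρ, ρ₀.commutes]
        rw [IsScalarTower.algebraMap_apply A R Lq, ν.commutes, IsScalarTower.algebraMap_apply A R R₁,
          ← IsScalarTower.algebraMap_apply R R₁ L₁]
      · have h7 : e X = MvPolynomial.X 0 := by simp [e]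
        have h8 : (algebraMap A[X] R₁) X = t₁ := aeval_X t₁
        simp only [RingHom.comp_apply, Polynomial.coe_mapRingHom,
          Polynomial.map_X]
        refine (congrArg (fun z ↦ ν (ρ (g z))) h7).trans ?_
        rw [h8, ← hι]
        exact DFunLike.congr_fun hνι t₁
    rw [h5, RingHom.formallyEtale_algebraMap] at h4
    exact h4
  -- Étaleness at a prime holds on a principal open set; clearing denominators turns it into a
  -- localization of `R` itself.
  obtain ⟨f₁, hf₁, hf₁'⟩ := Algebra.exists_etale_of_isEtaleAt (R := A[X]) q₁
  obtain ⟨⟨e, m⟩, hem⟩ := IsLocalization.surj (Submonoid.powers (d : R)) f₁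
  obtain ⟨_, n, rfl⟩ := m
  dsimp only at hem
  have hass : Associated (algebraMap R R₁ e) f₁ := by
    refine Associated.symm ⟨((IsLocalization.map_units R₁
      (⟨(d : R) ^ n, n, rfl⟩ : Submonoid.powers (d : R))).unit), ?_⟩
    exact hem
  let R' := Localization.Away (algebraMap R R₁ e)
  have hle : IsLocalization.Away ((d : R) * e) R' := IsLocalization.Away.mul' R₁ R' (d : R) e
  have het : Algebra.Etale A[X] R' := by
    have : IsLocalization.Away f₁ R' := (IsLocalization.Away.iff_of_associated hass).mp inferInstance
    exact .of_equiv ((IsLocalization.algEquiv (.powers f₁) (Localization.Away f₁) R').restrictScalars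
      A[X])
  refine ⟨d * e, ?_, R', inferInstance, inferInstance, inferInstance, ?_, hle, algebraMap R₁ R' t₁, ?_⟩
  · refine (‹q.IsPrime›).mul_notMem d.2 fun h ↦ hf₁ ?_
    rw [← hq₁, Ideal.mem_comap, ← hem] at h
    exact (Ideal.mul_unit_mem_iff_mem _ (IsLocalization.map_units R₁
      (⟨(d : R) ^ n, n, rfl⟩ : Submonoid.powers (d : R)))).mp h
  · infer_instance
  · have h6 : (aeval (algebraMap R₁ R' t₁) : A[X] →ₐ[A] R').toRingHom = algebraMap A[X] R' := by
      rw [IsScalarTower.algebraMap_eq A[X] R₁ R']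
      refine Polynomial.ringHom_ext' ?_ ?_
      · ext a
        have h8 : (algebraMap A[X] R₁) (C a) = algebraMap A R₁ a :=
          AlgHom.commutes (aeval t₁ : A[X] →ₐ[A] R₁) a
        rw [RingHom.comp_apply, RingHom.comp_apply, RingHom.comp_apply, h8]
        exact AlgHom.commutes (aeval (algebraMap R₁ R' t₁) : A[X] →ₐ[A] R') a
      · have h8 : (algebraMap A[X] R₁) X = t₁ := aeval_X t₁
        rw [RingHom.comp_apply, h8]
        exact aeval_X _
    rw [h6, RingHom.etale_algebraMap]
    exact het

end

/-! ### Geometric integrality of the generic fibre -/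

noncomputable section
open Limits TensorProduct

section
variable {X B : Scheme.{u}} (f : X ⟶ B)

/-- A field-valued point over `η` factors through the residue field, so the pullback is a base
change of the fibre at `η`. -/
lemma connectedSpace_and_smooth_of_isPullback (η : B) [SmoothOfRelativeDimension 1 (f.fiberToSpecResidueField η)]
    [GeometricallyConnected (f.fiberToSpecResidueField η)] {K : Type u} [Field K]
    (x : Spec (.of K) ⟶ B) (hx : ∀ y, x y = η) {P : Scheme.{u}} (a : P ⟶ X) (p : P ⟶ Spec (.of K))
    (h : IsPullback a p f x) : ConnectedSpace P ∧ SmoothOfRelativeDimension 1 p := by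
  obtain ⟨r, hr⟩ : ∃ r : Spec (.of K) ⟶ Spec (B.residueField η), r ≫ B.fromSpecResidueField η = x := by
    have h0 := hx (IsLocalRing.closedPoint K)
    subst h0
    exact ⟨_, Scheme.descResidueField_stalkClosedPointTo_fromSpecResidueField K B x⟩
  have h1 : IsPullback (f.fiberι η) (f.fiberToSpecResidueField η) f (B.fromSpecResidueField η) :=
    .of_hasPullback _ _
  have h2 := IsPullback.of_right' (h₂₁ := r) (hr.symm ▸ h) h1
  have := smoothOfRelativeDimension_isStableUnderBaseChange (n := 1)
  exact ⟨GeometricallyConnected.geometrically_connectedSpace _ _ _ h2,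
    MorphismProperty.of_isPullback (P := @SmoothOfRelativeDimension 1) h2 inferInstance⟩

variable {U : B.Opens} (hU : IsAffineOpen U) {W : X.Opens}

lemma exists_isOpenImmersion_of_isPullback (hW : IsAffineOpen W) (e : W ≤ f ⁻¹ᵁ U) {K : Type u} [Field K] [Algebra Γ(B, U) K]
    [Algebra Γ(B, U) Γ(X, W)] (hR : algebraMap Γ(B, U) Γ(X, W) = (f.appLE U W e).hom)
    {P : Scheme.{u}} (a : P ⟶ X) (p : P ⟶ Spec (.of K))
    (h : IsPullback a p f (Spec.map (CommRingCat.ofHom (algebraMap Γ(B, U) K)) ≫ hU.fromSpec)) :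
    ∃ j : Spec (.of (K ⊗[Γ(B, U)] Γ(X, W))) ⟶ P, IsOpenImmersion j ∧
      j ≫ p = Spec.map (CommRingCat.ofHom (algebraMap K (K ⊗[Γ(B, U)] Γ(X, W)))) ∧
      Set.range j = a ⁻¹' W := by
  have h1 := (isPullback_SpecMap_of_isPushout _ _ _ _
    (CommRingCat.isPushout_tensorProduct Γ(B, U) K Γ(X, W))).flip
  have h2 : Spec.map (CommRingCat.ofHom (algebraMap Γ(B, U) Γ(X, W))) ≫ hU.fromSpec =
      hW.fromSpec ≫ f := by
    rw [hR]
    exact hU.SpecMap_appLE_fromSpec f hW e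
  have h3 := PullbackCone.isLimitOfCompMono _ _ hU.fromSpec _ h1.isLimit
  have h4 : IsPullback (Spec.map (CommRingCat.ofHom (Algebra.TensorProduct.includeRight.toRingHom :
      Γ(X, W) →+* K ⊗[Γ(B, U)] Γ(X, W)))) (Spec.map (CommRingCat.ofHom (algebraMap K (K ⊗[Γ(B, U)] Γ(X, W)))))
      (hW.fromSpec ≫ f)
      (Spec.map (CommRingCat.ofHom (algebraMap Γ(B, U) K)) ≫ hU.fromSpec) := by
    rw [← h2]
    exact IsPullback.of_isLimit h3
  have h5 := IsPullback.of_bot' h4 h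
  refine ⟨_, MorphismProperty.of_isPullback h5 inferInstance, h.lift_snd _ _ _, ?_⟩
  rw [← hW.range_fromSpec, ← Set.image_univ, ← Set.image_univ,
    ← Scheme.image_preimage_eq_of_isPullback h5, Set.preimage_univ]
end

open Polynomial in
lemma isDomain_of_locally_isStandardSmooth {K S T : Type u} [Field K] [CommRing S] [CommRing T]
    {φ : K →+* S} (h : RingHom.Locally (RingHom.IsStandardSmoothOfRelativeDimension 1) φ)
    (q : Ideal S) [q.IsPrime] [Algebra S T] [IsLocalization.AtPrime T q] : IsDomain T := by
  obtain ⟨s, hs, hst⟩ := h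
  obtain ⟨w, hws, hw⟩ : ∃ w ∈ s, w ∉ q := by
    by_contra! hne
    exact (‹q.IsPrime›).ne_top (top_le_iff.mp (hs ▸ Ideal.span_le.mpr hne))
  obtain ⟨g, -, hg⟩ := (hst w hws).exists_etale_mvPolynomial
  let e := (MvPolynomial.uniqueAlgEquiv K (Fin 1)).symm
  let q' : Ideal (Localization.Away w) := q.map (algebraMap S _)
  have hdisj : Disjoint (Submonoid.powers w : Set S) q :=
    (Ideal.disjoint_powers_iff_notMem_of_isPrime _).mpr hw
  have : q'.IsPrime := IsLocalization.isPrime_of_isPrime_disjoint (.powers w) _ _ ‹_› hdisj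
  have hq' : q'.comap (algebraMap S _) = q :=
    IsLocalization.under_map_of_isPrime_disjoint (.powers w) _ ‹_› hdisj
  let := (g.comp e.toRingEquiv.toRingHom).toAlgebra
  have : Algebra.Etale K[X] (Localization.Away w) :=
    RingHom.Etale.stableUnderComposition _ _ (.of_bijective e.bijective) hg
  have h1 := isDomain_localization_of_etale_polynomial (K := K) q'
  have h2 : IsLocalization.AtPrime (Localization.AtPrime q') (q'.comap (algebraMap S _)) :=
    inferInstance
  simp only [hq'] at h2
  exact (IsLocalization.algEquiv q.primeCompl T (Localization.AtPrime q')).toRingEquiv.injective.isDomain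
    (IsLocalization.algEquiv q.primeCompl T (Localization.AtPrime q')).toRingEquiv.toRingHom

/-- Each point has an open neighbourhood on which functions inject into the stalk, hence an
irreducible one. The closure of such a neighbourhood is open as well as closed, so by connectedness
it is everything. -/
lemma isIntegral_of_isDomain_stalk (P : Scheme.{u}) [ConnectedSpace P] [IsLocallyNoetherian P]
    (h : ∀ x : P, IsDomain (P.presheaf.stalk x)) : IsIntegral P := by
  have hirr (x : P) : ∃ V : P.Opens, x ∈ V ∧ IsPreirreducible (V : Set P) := by
    obtain ⟨V, hx, hV, hinj⟩ := P.exists_germ_injective x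
    refine ⟨V, hx, ?_⟩
    have : IsDomain Γ(P, V) := hinj.isDomain (P.presheaf.germ V x hx).hom
    rw [← hV.range_fromSpec, ← Set.image_univ]
    exact (PreirreducibleSpace.isPreirreducible_univ (X := Spec Γ(P, V))).image _
      hV.fromSpec.continuous.continuousOn
  have : IsReduced P := isReduced_of_isReduced_stalk P
  obtain ⟨x⟩ : Nonempty P := inferInstance
  obtain ⟨V, hx, hV⟩ := hirr x
  have hcl : IsClopen (closure (V : Set P)) := by
    refine ⟨isClosed_closure, isOpen_iff_mem_nhds.mpr fun y hy ↦ ?_⟩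
    obtain ⟨V', hy', hV'⟩ := hirr y
    have hne : ((V' : Set P) ∩ V).Nonempty := mem_closure_iff.mp hy _ V'.2 hy'
    exact Filter.mem_of_superset (V'.2.mem_nhds hy')
      ((subset_closure_inter_of_isPreirreducible_of_isOpen hV' V.2 hne).trans
        (closure_mono Set.inter_subset_right))
  have huniv : closure (V : Set P) = Set.univ := hcl.eq_univ ⟨x, subset_closure hx⟩
  have : IrreducibleSpace P :=
    { isPreirreducible_univ := huniv ▸ hV.closure
      toNonempty := ⟨x⟩ }
  exact isIntegral_of_irreducibleSpace_of_isReduced P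

lemma isIntegral_of_smoothOfRelativeDimension {K : Type u} [Field K] {P : Scheme.{u}}
    (p : P ⟶ Spec (.of K)) [SmoothOfRelativeDimension 1 p] [ConnectedSpace P] : IsIntegral P := by
  have : Smooth p := SmoothOfRelativeDimension.smooth 1 p
  have : IsLocallyNoetherian P := LocallyOfFiniteType.isLocallyNoetherian p
  refine isIntegral_of_isDomain_stalk P fun x ↦ ?_
  obtain ⟨V, hV, hx, -⟩ := exists_isAffineOpen_mem_and_subset (x := x) (U := ⊤) trivial
  obtain ⟨φ, hφ⟩ := Spec.map_surjective (hV.fromSpec ≫ p)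
  have h1 : SmoothOfRelativeDimension (0 + 1) (hV.fromSpec ≫ p) := inferInstance
  rw [zero_add, ← hφ, HasRingHomProperty.Spec_iff (P := @SmoothOfRelativeDimension 1)] at h1
  let := P.presheaf.algebra_section_stalk ⟨x, hx⟩
  have := hV.isLocalization_stalk ⟨x, hx⟩
  exact isDomain_of_locally_isStandardSmooth h1 (hV.primeIdealOf ⟨x, hx⟩).asIdeal

section
variable {X B : Scheme.{u}} (f : X ⟶ B)

lemma eq_genericPoint_of_injective [IsIntegral B] {U : B.Opens} (hU : IsAffineOpen U) [Nonempty U]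
    {K : Type u} [Field K]
    [Algebra Γ(B, U) K] (hK : Function.Injective (algebraMap Γ(B, U) K)) (y : Spec (.of K)) :
    (Spec.map (CommRingCat.ofHom (algebraMap Γ(B, U) K)) ≫ hU.fromSpec) y = genericPoint B := by
  have : IsDomain Γ(B, U) := inferInstance
  rw [Scheme.Hom.comp_apply, ← genericPoint_eq_of_isOpenImmersion hU.fromSpec]
  congr 1
  rw [genericPoint_eq_bot_of_affine]
  refine PrimeSpectrum.ext ?_
  have hy : y.asIdeal = (⊥ : Ideal K) := @Ideal.eq_bot_of_prime K _ y.asIdeal y.2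
  change y.asIdeal.comap (algebraMap Γ(B, U) K) = ⊥
  rw [hy]
  exact (RingHom.injective_iff_ker_eq_bot _).mp hK

/-- Smoothness makes the local rings of the base change domains, and connectedness then makes it
integral. Letting `K` vary gives the hypothesis of the Bertini–Noether argument. -/
lemma locally_isStandardSmooth_and_isDomain [IsIntegral X] [IsIntegral B]
    [SmoothOfRelativeDimension 1 (f.fiberToSpecResidueField (genericPoint B))]
    [GeometricallyConnected (f.fiberToSpecResidueField (genericPoint B))] {U : B.Opens}
    (hU : IsAffineOpen U) [Nonempty U] {W : X.Opens} (hW : IsAffineOpen W) [Nonempty W]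
    (e : W ≤ f ⁻¹ᵁ U) [Algebra Γ(B, U) Γ(X, W)]
    (hR : algebraMap Γ(B, U) Γ(X, W) = (f.appLE U W e).hom)
    (hinj : Function.Injective (algebraMap Γ(B, U) Γ(X, W))) (K : Type u) [Field K]
    [Algebra Γ(B, U) K] (hK : Function.Injective (algebraMap Γ(B, U) K)) :
    RingHom.Locally (RingHom.IsStandardSmoothOfRelativeDimension 1)
      (algebraMap K (K ⊗[Γ(B, U)] Γ(X, W))) ∧ IsDomain (K ⊗[Γ(B, U)] Γ(X, W)) := by
  let x := Spec.map (CommRingCat.ofHom (algebraMap Γ(B, U) K)) ≫ hU.fromSpec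
  have h := IsPullback.of_hasPullback f x
  obtain ⟨h1, h2⟩ := connectedSpace_and_smooth_of_isPullback f (genericPoint B) x
    (eq_genericPoint_of_injective hU hK) _ _ h
  obtain ⟨j, h3, h4, -⟩ := exists_isOpenImmersion_of_isPullback f hU hW e hR _ _ h
  have := isIntegral_of_smoothOfRelativeDimension (pullback.snd f x)
  have h5 : SmoothOfRelativeDimension (0 + 1) (j ≫ pullback.snd f x) := inferInstance
  rw [zero_add, h4, HasRingHomProperty.Spec_iff (P := @SmoothOfRelativeDimension 1)] at h5
  refine ⟨h5, ?_⟩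
  have : Nontrivial (K ⊗[Γ(B, U)] Γ(X, W)) := by
    have := flat_of_injective_field hK
    exact (Algebra.TensorProduct.includeLeft_injective (S := K) hinj).nontrivial
  have : Nonempty (Spec (.of (K ⊗[Γ(B, U)] Γ(X, W)))) :=
    inferInstanceAs (Nonempty (PrimeSpectrum (K ⊗[Γ(B, U)] Γ(X, W))))
  have := isIntegral_of_isOpenImmersion j
  exact (affine_isIntegral_iff (.of (K ⊗[Γ(B, U)] Γ(X, W)))).mp this
end

end

/-! ### Charts étale over the relative affine line -/

noncomputable section
open Limits TensorProduct

/-- An affine open `W` over `U` with a function `t` that makes `W` étale over the affine line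
over `U`. -/
structure IsChart {X B : Scheme.{u}} (f : X ⟶ B) (U : B.Opens) (W : X.Opens) (t : Γ(X, W)) : Prop where
  isAffineOpen : IsAffineOpen W
  nonempty : Nonempty W
  le : W ≤ f ⁻¹ᵁ U
  etale : (Polynomial.eval₂RingHom (f.appLE U W le).hom t).Etale

section
variable {X B : Scheme.{u}} (f : X ⟶ B)

lemma genericPoint_of_apply_eq [IsIntegral X] [IsIntegral B] {x : X} (hx : f x = genericPoint B) :
    f (genericPoint X) = genericPoint B := by
  have h1 : genericPoint X ⤳ x := (genericPoint_spec X).specializes trivial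
  have h2 : f (genericPoint X) ⤳ genericPoint B := hx ▸ h1.map f.continuous
  exact h2.antisymm ((genericPoint_spec B).specializes trivial) |>.eq

lemma injective_appLE [IsIntegral X] [IsIntegral B] (hf : f (genericPoint X) = genericPoint B)
    (U : B.Opens) (W : X.Opens) [Nonempty W] (e : W ≤ f ⁻¹ᵁ U) :
    Function.Injective (f.appLE U W e).hom := by
  rw [injective_iff_map_eq_zero]
  intro a ha
  by_contra h
  have h1 : genericPoint B ∈ B.basicOpen a := by
    have h2 : ((B.basicOpen a : B.Opens) : Set B).Nonempty := by
      rw [Set.nonempty_iff_ne_empty]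
      intro h3
      exact h ((basicOpen_eq_bot_iff a).mp (TopologicalSpace.Opens.ext h3))
    exact ((genericPoint_spec B).mem_open_set_iff (B.basicOpen a).2).mpr (by simpa using h2)
  have h2 : genericPoint X ∈ X.basicOpen (f.appLE U W e a) := by
    rw [Scheme.basicOpen_appLE]
    exact ⟨genericPoint_mem W, show f (genericPoint X) ∈ _ from hf ▸ h1⟩
  rw [ha, Scheme.basicOpen_zero] at h2
  exact h2

lemma exists_isChart [IsIntegral X] [IsIntegral B] [LocallyOfFiniteType f] [IsLocallyNoetherian B]
    [SmoothOfRelativeDimension 1 (f.fiberToSpecResidueField (genericPoint B))]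
    [GeometricallyConnected (f.fiberToSpecResidueField (genericPoint B))] {U : B.Opens}
    (hU : IsAffineOpen U) [Nonempty U] (O : X.Opens) {x : X} (hxO : x ∈ O) (hx : f x = genericPoint B) :
    ∃ W t, IsChart f U W t ∧ x ∈ W ∧ W ≤ O := by
  have hηU : genericPoint B ∈ U := genericPoint_mem U
  obtain ⟨W, hW, hxW, hWO⟩ := exists_isAffineOpen_mem_and_subset (x := x) (U := O ⊓ f ⁻¹ᵁ U)
    ⟨hxO, show f x ∈ U from hx ▸ hηU⟩
  have e : W ≤ f ⁻¹ᵁ U := hWO.trans inf_le_right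
  have : Nonempty W := ⟨x, hxW⟩
  have hinj := injective_appLE f (genericPoint_of_apply_eq f hx) U W e
  let := (f.appLE U W e).hom.toAlgebra
  have : IsNoetherianRing Γ(B, U) := IsLocallyNoetherian.component_noetherian ⟨U, hU⟩
  have : Algebra.FiniteType Γ(B, U) Γ(X, W) := f.finiteType_appLE hU hW e
  obtain ⟨hloc, -⟩ := locally_isStandardSmooth_and_isDomain f hU hW e rfl hinj (FractionRing Γ(B, U))
    (IsFractionRing.injective _ _)
  let q := (hW.primeIdealOf ⟨x, hxW⟩)
  have hq : q.asIdeal.comap (algebraMap Γ(B, U) Γ(X, W)) = ⊥ := by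
    have h1 : ∀ (y : B) (hy : y ∈ U), y = genericPoint B →
        (hU.primeIdealOf ⟨y, hy⟩).asIdeal = ⊥ := by
      rintro _ hy rfl
      rw [hU.primeIdealOf_genericPoint, genericPoint_eq_bot_of_affine]
      rfl
    exact (congrArg PrimeSpectrum.asIdeal
      (IsAffineOpen.comap_primeIdealOf_appLE U hU W hW e hxW)).trans (h1 _ (e hxW) hx)
  obtain ⟨g, hg, R', _, _, _, _, _, t', ht'⟩ := exists_etale_away hloc q.asIdeal hq
  have hgx : x ∈ X.basicOpen g := by
    have h1 : q ∈ hW.fromSpec ⁻¹ᵁ X.basicOpen g := by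
      rw [hW.fromSpec_preimage_basicOpen]
      exact hg
    have h2 : hW.fromSpec q ∈ X.basicOpen g := h1
    rwa [hW.fromSpec_primeIdealOf] at h2
  have hle : X.basicOpen g ≤ f ⁻¹ᵁ U := (X.basicOpen_le g).trans e
  have := hW.isLocalization_basicOpen g
  let E := IsLocalization.algEquiv (.powers g) R' Γ(X, X.basicOpen g)
  refine ⟨X.basicOpen g, E t', ⟨hW.basicOpen g, ⟨⟨x, hgx⟩⟩, hle, ?_⟩, hgx,
    (X.basicOpen_le g).trans (hWO.trans inf_le_left)⟩
  have h1 : Polynomial.eval₂RingHom (f.appLE U (X.basicOpen g) hle).hom (E t') =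
      E.toRingEquiv.toRingHom.comp
        (Polynomial.aeval t' : Polynomial Γ(B, U) →ₐ[Γ(B, U)] R').toRingHom := by
    refine Polynomial.ringHom_ext' ?_ ?_
    · ext a
      simp only [RingHom.comp_apply, Polynomial.coe_eval₂RingHom, Polynomial.eval₂_C]
      refine Eq.trans ?_ (congrArg E (AlgHom.commutes
        (Polynomial.aeval t' : Polynomial Γ(B, U) →ₐ[Γ(B, U)] R') a)).symm
      rw [IsScalarTower.algebraMap_apply Γ(B, U) Γ(X, W) R', E.commutes]
      exact (DFunLike.congr_fun (congrArg CommRingCat.Hom.hom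
        (f.appLE_map e (homOfLE (X.basicOpen_le g)).op)) a).symm
    · rw [Polynomial.coe_eval₂RingHom, Polynomial.eval₂_X]
      exact (congrArg E (Polynomial.aeval_X t')).symm
  rw [h1]
  exact RingHom.Etale.stableUnderComposition _ _ ht' (.of_bijective E.bijective)

/-- Charts cover the generic fibre. As `f` is closed, the image of the uncovered part is closed and
misses the generic point, so the charts cover the preimage of a principal open set; by
quasi-compactness finitely many suffice. The neighbourhoods `O x` allow the charts to be subordinate
to a given cover. -/
lemma exists_finset_isChart [IsIntegral X] [IsIntegral B] [IsProper f] [IsLocallyNoetherian B]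
    [SmoothOfRelativeDimension 1 (f.fiberToSpecResidueField (genericPoint B))]
    [GeometricallyConnected (f.fiberToSpecResidueField (genericPoint B))] {U : B.Opens}
    (hU : IsAffineOpen U) [Nonempty U] (O : X → X.Opens) (hO : ∀ x, x ∈ O x) :
    ∃ (a : Γ(B, U)) (s : Finset X.Opens), a ≠ 0 ∧ (∀ W ∈ s, (∃ t, IsChart f U W t) ∧ ∃ x, W ≤ O x) ∧
      ∀ x, f x ∈ B.basicOpen a → ∃ W ∈ s, x ∈ W := by
  let I : Set X.Opens := {W | (∃ t, IsChart f U W t) ∧ ∃ x, W ≤ O x}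
  let E : X.Opens := sSup I
  have hE (x : X) (hx : f x = genericPoint B) : x ∈ E := by
    obtain ⟨W, t, h1, h2, h3⟩ := exists_isChart f hU (O x) (hO x) hx
    exact TopologicalSpace.Opens.mem_sSup.mpr ⟨W, ⟨⟨t, h1⟩, x, h3⟩, h2⟩
  let V : B.Opens := ⟨(f '' (E : Set X)ᶜ)ᶜ, (f.isClosedMap _ E.2.isClosed_compl).isOpen_compl⟩
  have hηV : genericPoint B ∈ V := by
    rintro ⟨x, hx, hfx⟩
    exact hx (hE x hfx)
  obtain ⟨a, ha, haη⟩ := hU.exists_basicOpen_le ⟨genericPoint B, hηV⟩ (genericPoint_mem U)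
  have hcpt : IsCompact (f ⁻¹' (B.basicOpen a : Set B)) :=
    f.isCompact_preimage (hU.basicOpen a).isCompact
  have hsub : f ⁻¹' (B.basicOpen a : Set B) ⊆ ⋃ W ∈ I, (W : Set X) := by
    intro x hx
    have h1 : x ∈ E := by
      by_contra h2
      exact ha hx ⟨x, h2, rfl⟩
    obtain ⟨W, hW, hxW⟩ := TopologicalSpace.Opens.mem_sSup.mp h1
    exact Set.mem_iUnion₂.mpr ⟨W, hW, hxW⟩
  obtain ⟨s, hsI, hs, hcov⟩ := hcpt.elim_finite_subcover_image (fun W _ ↦ W.2) hsub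
  refine ⟨a, hs.toFinset, ?_, ?_, ?_⟩
  · rintro rfl
    simp at haη
  · intro W hW
    exact hsI (hs.mem_toFinset.mp hW)
  · intro x hx
    obtain ⟨W, hW, hxW⟩ := Set.mem_iUnion₂.mp (hcov hx)
    exact ⟨W, hs.mem_toFinset.mpr hW, hxW⟩

variable {f} in
lemma IsChart.exists_forall_isPrime_map [IsIntegral X] [IsIntegral B]
    [SmoothOfRelativeDimension 1 (f.fiberToSpecResidueField (genericPoint B))]
    [GeometricallyConnected (f.fiberToSpecResidueField (genericPoint B))] {U : B.Opens}
    (hU : IsAffineOpen U) [Nonempty U] (hf : f (genericPoint X) = genericPoint B) {W : X.Opens}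
    {t : Γ(X, W)} (h : IsChart f U W t) :
    ∃ a : Γ(B, U), a ≠ 0 ∧ ∀ m : Ideal Γ(B, U), m.IsMaximal → a ∉ m → (m.map (f.appLE U W h.le).hom).IsPrime ∧
      ¬ (m.map (f.appLE U W h.le).hom).IsMaximal ∧
      ∀ P : Ideal Γ(X, W), P.IsPrime → m.map (f.appLE U W h.le).hom < P → P.IsMaximal := by
  have := h.nonempty
  have hinj := injective_appLE f hf U W h.le
  let := (f.appLE U W h.le).hom.toAlgebra
  let := (Polynomial.eval₂RingHom (f.appLE U W h.le).hom t).toAlgebra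
  have : IsScalarTower Γ(B, U) (Polynomial Γ(B, U)) Γ(X, W) := .of_algebraMap_eq' (by
    ext a; exact (Polynomial.eval₂_C _ _).symm)
  have : Algebra.Etale (Polynomial Γ(B, U)) Γ(X, W) := h.etale
  obtain ⟨a, ha, h1⟩ := exists_ne_zero_forall_isPrime_map (A := Γ(B, U)) (R := Γ(X, W))
    fun K _ _ hK ↦ (locally_isStandardSmooth_and_isDomain f hU h.isAffineOpen h.le rfl hinj K hK).2
  refine ⟨a, ha, fun m hm ham ↦ ?_⟩
  obtain ⟨h3, h4⟩ := isMaximal_of_map_lt hm (h1 m hm ham)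
  exact ⟨h1 m hm ham, h3, h4⟩
end

end

/-! ### One-dimensional integral schemes glued from one-dimensional domains -/

noncomputable section
open Limits TensorProduct

/-- A one-dimensional domain. -/
structure IsOneDimensionalDomain (D : Type*) [CommRing D] : Prop where
  isDomain : IsDomain D
  not_isField : ¬ IsField D
  dimensionLEOne : Ring.DimensionLEOne D

lemma IsOneDimensionalDomain.of_ringEquiv {D D' : Type*} [CommRing D] [CommRing D'] (e : D ≃+* D')
    (h : IsOneDimensionalDomain D) : IsOneDimensionalDomain D' := by
  have := h.isDomain
  have := h.dimensionLEOne
  refine ⟨e.symm.injective.isDomain e.symm.toRingHom, fun h' ↦ h.not_isField (e.toMulEquiv.isField h'), ⟨?_⟩⟩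
  intro p hp hpp
  have h1 : (p.comap e).IsMaximal := by
    refine Ring.DimensionLEOne.maximalOfPrime ?_ inferInstance
    rw [← Ideal.map_symm]
    exact fun h ↦ hp ((Ideal.map_eq_bot_iff_of_injective e.symm.injective).mp h)
  exact (Ideal.isMaximal_comap_iff_of_bijective e e.bijective).mp h1

lemma isOneDimensionalDomain_quotient {R : Type*} [CommRing R] {p : Ideal R} (hp : p.IsPrime)
    (hm : ¬ p.IsMaximal) (h : ∀ P : Ideal R, P.IsPrime → p < P → P.IsMaximal) :
    IsOneDimensionalDomain (R ⧸ p) := by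
  refine ⟨inferInstance, fun h ↦ hm (Ideal.Quotient.maximal_of_isField p h), ⟨fun {P} hP hPp ↦ ?_⟩⟩
  have h1 : (P.comap (Ideal.Quotient.mk p)).IsMaximal := by
    refine h _ inferInstance (lt_of_le_of_ne ?_ ?_)
    · exact fun x hx ↦ show Ideal.Quotient.mk p x ∈ P from
        (Ideal.Quotient.eq_zero_iff_mem.mpr hx) ▸ P.zero_mem
    · intro h2
      apply hP
      rw [← Ideal.map_comap_of_surjective _ Ideal.Quotient.mk_surjective P, ← h2, Ideal.map_quotient_self]
  rw [← Ideal.map_comap_of_surjective _ Ideal.Quotient.mk_surjective P]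
  refine Ideal.IsMaximal.map_of_surjective_of_ker_le Ideal.Quotient.mk_surjective ?_
  rintro x hx
  exact show Ideal.Quotient.mk p x ∈ P from (RingHom.mem_ker.mp hx) ▸ P.zero_mem

lemma isOneDimensionalDomain_tensorProduct {A R k : Type u} [CommRing A] [CommRing R] [Field k]
    [Algebra A R] [Algebra A k] (hk : Function.Surjective (algebraMap A k))
    (h : IsOneDimensionalDomain (R ⧸ (RingHom.ker (algebraMap A k)).map (algebraMap A R))) :
    IsOneDimensionalDomain (k ⊗[A] R) := by
  let e₁ := Algebra.TensorProduct.quotIdealMapEquivTensorQuot (A := A) R (RingHom.ker (algebraMap A k))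
  let e₂ : (A ⧸ RingHom.ker (algebraMap A k)) ≃ₐ[A] k :=
    Ideal.quotientKerAlgEquivOfSurjective (f := Algebra.ofId A k) hk
  exact h.of_ringEquiv ((e₁.toRingEquiv.trans
    (Algebra.TensorProduct.congr (AlgEquiv.refl (R := A) (A₁ := R)) e₂).toRingEquiv).trans
      (Algebra.TensorProduct.comm A R k).toRingEquiv)

/-- An open subset of a scheme that is the spectrum of a one-dimensional domain. -/
def IsOneDimensionalAffine {C : Scheme.{u}} (V : Set C) : Prop :=
  ∃ (D : CommRingCat.{u}) (j : Spec D ⟶ C), IsOpenImmersion j ∧ Set.range j = V ∧ IsOneDimensionalDomain D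

lemma IsOneDimensionalAffine.isOpen {C : Scheme.{u}} {V : Set C} (h : IsOneDimensionalAffine V) :
    IsOpen V := by
  obtain ⟨D, j, _, rfl, -⟩ := h
  exact j.isOpenEmbedding.isOpen_range

lemma IsOneDimensionalAffine.isIrreducible {C : Scheme.{u}} {V : Set C}
    (h : IsOneDimensionalAffine V) : IsIrreducible V := by
  obtain ⟨D, j, _, rfl, h⟩ := h
  have := h.isDomain
  rw [← Set.image_univ]
  exact (IrreducibleSpace.isIrreducible_univ (Spec D)).image _ j.continuous.continuousOn

lemma IsOneDimensionalAffine.eq_of_specializes {C : Scheme.{u}} [IsIntegral C] {V : Set C}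
    (h : IsOneDimensionalAffine V) {y y' : C} (hy : y ⤳ y') (hy' : y' ∈ V) :
    y = genericPoint C ∨ y' = y := by
  have hyV : y ∈ V := hy.mem_open h.isOpen hy'
  obtain ⟨D, j, _, rfl, h⟩ := h
  have := h.isDomain
  have := h.dimensionLEOne
  obtain ⟨P, rfl⟩ := hyV
  obtain ⟨P', rfl⟩ := hy'
  by_cases hP : P.asIdeal = ⊥
  · left
    rw [← genericPoint_eq_of_isOpenImmersion j, genericPoint_eq_bot_of_affine]
    congr 1
    exact PrimeSpectrum.ext hP
  · right
    congr 1
    have h1 : P ⤳ P' := j.isOpenEmbedding.isInducing.specializes_iff.mp hy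
    have h2 := (PrimeSpectrum.le_iff_specializes P P').mpr h1
    have h3 : P.asIdeal.IsMaximal := Ring.DimensionLEOne.maximalOfPrime hP P.2
    exact PrimeSpectrum.ext (h3.eq_of_le P'.2.ne_top h2).symm

lemma exists_ne_genericPoint_of_isOneDimensionalAffine {C : Scheme.{u}} [IsIntegral C] {V : Set C}
    (h : IsOneDimensionalAffine V) : ∃ y : C, y ≠ genericPoint C := by
  obtain ⟨D, j, _, rfl, h⟩ := h
  have := h.isDomain
  obtain ⟨m, hm⟩ := Ideal.exists_maximal D
  refine ⟨j ⟨m, hm.isPrime⟩, fun h1 ↦ ?_⟩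
  rw [← genericPoint_eq_of_isOpenImmersion j, genericPoint_eq_bot_of_affine] at h1
  have h2 := congrArg PrimeSpectrum.asIdeal (j.isOpenEmbedding.injective h1)
  have h3 : m = ⊥ := h2
  subst h3
  exact h.not_isField ((Ring.isField_iff_maximal_bot).mpr hm)

/-- Irreducible open sets that meet pairwise have an irreducible union: a nonempty open set met by
one piece is met by all of them. -/
lemma isIntegral_of_isOneDimensionalAffine {C : Scheme.{u}} {ι : Type*} [Nonempty ι] (V : ι → Set C)
    (h : ∀ i, IsOneDimensionalAffine (V i)) (hcov : ∀ x, ∃ i, x ∈ V i)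
    (hmeet : ∀ i j, (V i ∩ V j).Nonempty) : IsIntegral C := by
  have : IsReduced C := by
    have (x : C) : _root_.IsReduced (C.presheaf.stalk x) := by
      obtain ⟨i, hi⟩ := hcov x
      obtain ⟨D, j, _, hj, h⟩ := h i
      have := h.isDomain
      obtain ⟨y, rfl⟩ := hj ▸ hi
      exact isReduced_of_injective (j.stalkMap y).hom
        (asIso (j.stalkMap y)).commRingCatIsoToRingEquiv.injective
    exact isReduced_of_isReduced_stalk C
  have : IrreducibleSpace C := by
    refine { isPreirreducible_univ := ?_, toNonempty := ?_ }
    · rintro O₁ O₂ hO₁ hO₂ ⟨x₁, -, hx₁⟩ ⟨x₂, -, hx₂⟩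
      obtain ⟨i, hi⟩ := hcov x₁
      obtain ⟨j, hj⟩ := hcov x₂
      obtain ⟨y, hy, hyO, hyj⟩ := (h i).isIrreducible.2 O₁ (V j) hO₁ (h j).isOpen ⟨x₁, hi, hx₁⟩ (hmeet i j)
      obtain ⟨z, hz, hz₁, hz₂⟩ := (h j).isIrreducible.2 O₁ O₂ hO₁ hO₂ ⟨y, hyj, hyO⟩ ⟨x₂, hj, hx₂⟩
      exact ⟨z, trivial, hz₁, hz₂⟩
    · obtain ⟨i⟩ := ‹Nonempty ι›
      exact ⟨(hmeet i i).some⟩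
  exact isIntegral_of_irreducibleSpace_of_isReduced C

/-- Specializations can be tested inside one piece, where nonzero primes are maximal; a point other
than the generic one exists since the pieces are not spectra of fields. -/
lemma topologicalKrullDim_eq_one {C : Scheme.{u}} [IsIntegral C]
    (h : ∀ x : C, ∃ V : Set C, x ∈ V ∧ IsOneDimensionalAffine V) : topologicalKrullDim C = 1 := by
  let _ : PartialOrder C := specializationOrder C
  have hgen (x : C) : genericPoint C ⤳ x := (genericPoint_spec C).specializes trivial
  obtain ⟨V, -, hV⟩ := h (genericPoint C)
  obtain ⟨y, hy⟩ := exists_ne_genericPoint_of_isOneDimensionalAffine hV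
  rw [topologicalKrullDim, Order.krullDim_eq_of_orderIso irreducibleSetEquivPoints]
  refine le_antisymm (Order.krullDim_le_one_iff.mpr fun x ↦ ?_) (Order.one_le_krullDim_iff.mpr
    ⟨y, genericPoint C, lt_of_le_of_ne (hgen y) hy⟩)
  by_cases hx : x = genericPoint C
  · exact Or.inr fun z _ ↦ hx ▸ hgen z
  · left
    intro z hz
    obtain ⟨V', hzV, hV'⟩ := h z
    exact ((hV'.eq_of_specializes (show x ⤳ z from hz) hzV).resolve_left hx).ge

lemma isOneDimensionalAffine_preimage {X B : Scheme.{u}} (f : X ⟶ B) {U : B.Opens}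
    (hU : IsAffineOpen U) {W : X.Opens} (hW : IsAffineOpen W) (e : W ≤ f ⁻¹ᵁ U) {k : Type u} [Field k]
    [Algebra Γ(B, U) k] (hk : Function.Surjective (algebraMap Γ(B, U) k)) {C : Scheme.{u}}
    {ι : C ⟶ X} {p : C ⟶ Spec (.of k)}
    (h : IsPullback ι p f (Spec.map (CommRingCat.ofHom (algebraMap Γ(B, U) k)) ≫ hU.fromSpec))
    (h₁ : ((RingHom.ker (algebraMap Γ(B, U) k)).map (f.appLE U W e).hom).IsPrime)
    (h₂ : ¬ ((RingHom.ker (algebraMap Γ(B, U) k)).map (f.appLE U W e).hom).IsMaximal)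
    (h₃ : ∀ P : Ideal Γ(X, W), P.IsPrime →
      (RingHom.ker (algebraMap Γ(B, U) k)).map (f.appLE U W e).hom < P → P.IsMaximal) :
    IsOneDimensionalAffine (ι ⁻¹' W) := by
  let := (f.appLE U W e).hom.toAlgebra
  obtain ⟨j, h4, -, h5⟩ := exists_isOpenImmersion_of_isPullback f hU hW e rfl ι p h
  exact ⟨_, j, h4, h5, isOneDimensionalDomain_tensorProduct hk
    (isOneDimensionalDomain_quotient h₁ h₂ h₃)⟩

end

/-! ### Restriction of the vertical derivation to a fibre -/

noncomputable section
open Polynomial in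
/-- The vertical derivation `V = ∂/∂t` preserves the local ring `O` of a fibre, and a derivation of
the function field `L` of the fibre is proportional to it along `ψ : O → L`. -/
lemma exists_vertical_restriction {k A R O K L : Type*} [Field k] [CommRing A] [CommRing R]
    [CommRing O] [Field K] [Field L] [Algebra k A] [Algebra k R] [Algebra k O] [Algebra k K]
    [Algebra k L] [Algebra A R] [Algebra R O] [Algebra R K] [Algebra O K] [IsScalarTower k A R]
    [IsScalarTower k R O] [IsScalarTower k R K] [IsScalarTower k O K] [IsScalarTower R O K]
    [Algebra.FormallyEtale R O] {t : R} (ht : (aeval t : A[X] →ₐ[A] R).toRingHom.Etale)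
    (V : Derivation k K K) (hV : ∀ a, V (algebraMap R K (algebraMap A R a)) = 0)
    (hVt : V (algebraMap R K t) = 1) (ψ : O →ₐ[k] L)
    (hψ : ∀ a, ∃ c : k, ψ (algebraMap R O (algebraMap A R a)) = algebraMap k L c) :
    ∃ V₀ : O → O, (∀ x, V (algebraMap O K x) = algebraMap O K (V₀ x)) ∧
      ∀ (D : Derivation k L L) (x : O), D (ψ x) = D (ψ (algebraMap R O t)) * ψ (V₀ x) := by
  obtain ⟨V₁, hV₁, hV₁t⟩ := exists_derivation_of_etale (k := k) t ht 0 1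
  obtain ⟨V₀, hV₀⟩ := exists_derivation_extending_of_formallyEtale (k := k) (S := R) (T := O)
    ((Algebra.linearMap R O).compDer V₁)
  have hV₀' (s : R) : V₀ (algebraMap R O s) = algebraMap R O (V₁ s) := hV₀ s
  refine ⟨V₀, fun x ↦ ?_, fun D x ↦ ?_⟩
  · have h1 : V.compAlgebraMap R = (Algebra.linearMap R K).compDer V₁ := by
      refine derivation_ext_of_etale (k := k) t ht (fun a ↦ ?_) ?_
      · change V (algebraMap R K (algebraMap A R a)) = algebraMap R K (V₁ (algebraMap A R a))
        rw [hV, hV₁]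
        exact (map_zero _).symm
      · change V (algebraMap R K t) = algebraMap R K (V₁ t)
        rw [hVt, hV₁t, map_one]
    have h2 : V.compAlgebraMap O = (Algebra.linearMap O K).compDer V₀ := by
      refine derivation_ext_of_formallyEtale (k := k) (S := R) fun s ↦ ?_
      change V (algebraMap O K (algebraMap R O s)) = algebraMap O K (V₀ (algebraMap R O s))
      rw [hV₀', ← IsScalarTower.algebraMap_apply R O K, ← IsScalarTower.algebraMap_apply R O K]
      exact DFunLike.congr_fun h1 s
    exact DFunLike.congr_fun h2 x
  · let := ψ.toRingHom.toAlgebra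
    have : IsScalarTower k O L := .of_algebraMap_eq' ψ.comp_algebraMap.symm
    let := (ψ.toRingHom.comp (algebraMap R O)).toAlgebra
    have : IsScalarTower R O L := .of_algebraMap_eq' rfl
    have : IsScalarTower k R L := .of_algebraMap_eq' (by
      rw [IsScalarTower.algebraMap_eq k O L, IsScalarTower.algebraMap_eq k R O]
      rfl)
    have h1 : D.compAlgebraMap R =
        ((LinearMap.toSpanSingleton O L (D (ψ (algebraMap R O t)))).restrictScalars R).compDer
          ((Algebra.linearMap R O).compDer V₁) := by
      refine derivation_ext_of_etale (k := k) t ht (fun a ↦ ?_) ?_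
      · obtain ⟨c, hc⟩ := hψ a
        change D (ψ (algebraMap R O (algebraMap A R a))) =
          ψ (algebraMap R O (V₁ (algebraMap A R a))) * D (ψ (algebraMap R O t))
        rw [hc, hV₁, Derivation.map_algebraMap]
        exact (mul_eq_zero_of_left ((congrArg ψ (map_zero (algebraMap R O))).trans (map_zero ψ)) _).symm
      · change D (ψ (algebraMap R O t)) = ψ (algebraMap R O (V₁ t)) * D (ψ (algebraMap R O t))
        rw [hV₁t, map_one, map_one, one_mul]
    have h2 : D.compAlgebraMap O =
        (LinearMap.toSpanSingleton O L (D (ψ (algebraMap R O t)))).compDer V₀ := by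
      refine derivation_ext_of_formallyEtale (k := k) (S := R) fun s ↦ ?_
      change D (ψ (algebraMap R O s)) = ψ (V₀ (algebraMap R O s)) * D (ψ (algebraMap R O t))
      rw [hV₀']
      exact DFunLike.congr_fun h1 s
    rw [mul_comm]
    exact DFunLike.congr_fun h2 x

end

/-! ### Charts over the ground field and the local ring along a subvariety -/

noncomputable section

section
variable {𝕜 : Type u} [Field 𝕜] {X B : Scheme.{u}} [X.Over (Spec (.of 𝕜))] [B.Over (Spec (.of 𝕜))]
  {f : X ⟶ B}

lemma algebraMap_sections_eq (W : X.Opens) (c : 𝕜) : algebraMap 𝕜 Γ(X, W) c =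
    (X ↘ Spec (.of 𝕜)).appLE ⊤ W (show W ≤ (X ↘ Spec (.of 𝕜)) ⁻¹ᵁ ⊤ from le_top) ((Scheme.ΓSpecIso (.of 𝕜)).inv c) := rfl

lemma appLE_algebraMap_sections (hf : f ≫ (B ↘ Spec (.of 𝕜)) = X ↘ Spec (.of 𝕜)) {U : B.Opens}
    {W : X.Opens} (e : W ≤ f ⁻¹ᵁ U) (c : 𝕜) :
    f.appLE U W e (algebraMap 𝕜 Γ(B, U) c) = algebraMap 𝕜 Γ(X, W) c := by
  have h : (B ↘ Spec (.of 𝕜)).appLE ⊤ U (show U ≤ (B ↘ Spec (.of 𝕜)) ⁻¹ᵁ ⊤ from le_top) ≫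
      f.appLE U W e = (X ↘ Spec (.of 𝕜)).appLE ⊤ W (show W ≤ (X ↘ Spec (.of 𝕜)) ⁻¹ᵁ ⊤ from le_top) := by
    rw [Scheme.Hom.appLE_comp_appLE]
    simp only [hf]
  exact ConcreteCategory.congr_hom h _

/-- The functions on an open subset of the base, as rational functions. -/
abbrev baseAlgebra (f : X ⟶ B) [IsIntegral X] (U : B.Opens) [Nonempty (f ⁻¹ᵁ U)] :
    Algebra Γ(B, U) X.functionField :=
  ((algebraMap Γ(X, f ⁻¹ᵁ U) X.functionField).comp (f.app U).hom).toAlgebra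

lemma baseAlgebra_apply [IsIntegral X] {U : B.Opens} [Nonempty (f ⁻¹ᵁ U)] {W : X.Opens} [Nonempty W]
    (e : W ≤ f ⁻¹ᵁ U) (a : Γ(B, U)) : (baseAlgebra f U).algebraMap a =
      algebraMap Γ(X, W) X.functionField (f.appLE U W e a) := by
  exact (algebraMap_map_sections (homOfLE e) (f.app U a)).symm

lemma IsChart.isRelativeCoordinate [IsIntegral X] [IsIntegral B]
    (hf : f ≫ (B ↘ Spec (.of 𝕜)) = X ↘ Spec (.of 𝕜)) (hfg : f (genericPoint X) = genericPoint B)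
    {U : B.Opens} [Nonempty (f ⁻¹ᵁ U)] {W : X.Opens} [Nonempty W] {t : Γ(X, W)}
    (h : IsChart f U W t) :
    let _ := baseAlgebra f U
    IsRelativeCoordinate (k := 𝕜) Γ(B, U) (regularFunctions 𝕜 W)
      (algebraMap Γ(X, W) X.functionField t) := by
  intro _
  let := (f.appLE U W h.le).hom.toAlgebra
  have : IsScalarTower Γ(B, U) Γ(X, W) X.functionField :=
    .of_algebraMap_eq fun a ↦ baseAlgebra_apply h.le a
  have : IsScalarTower 𝕜 Γ(B, U) Γ(X, W) :=
    .of_algebraMap_eq fun c ↦ (appLE_algebraMap_sections hf h.le c).symm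
  have := functionField_isFractionRing_of_isAffineOpen X W h.isAffineOpen
  have hinj : Function.Injective (algebraMap Γ(B, U) X.functionField) := by
    rw [IsScalarTower.algebraMap_eq Γ(B, U) Γ(X, W) X.functionField]
    exact (IsFractionRing.injective Γ(X, W) X.functionField).comp (injective_appLE f hfg U W h.le)
  have : IsScalarTower 𝕜 Γ(B, U) X.functionField := .of_algebraMap_eq fun c ↦ by
    rw [IsScalarTower.algebraMap_apply Γ(B, U) Γ(X, W) X.functionField,
      ← IsScalarTower.algebraMap_apply 𝕜 Γ(B, U) Γ(X, W), ← IsScalarTower.algebraMap_apply]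
  refine isRelativeCoordinate_of_etale (R := Γ(X, W)) hinj t ?_
  exact h.etale

lemma IsChart.basicOpen [IsIntegral X] {U : B.Opens} {W : X.Opens} {t : Γ(X, W)}
    (h : IsChart f U W t) {g : Γ(X, W)} (hg : g ≠ 0) :
    IsChart f U (X.basicOpen g) (X.presheaf.map (homOfLE (X.basicOpen_le g)).op t) := by
  have hle : X.basicOpen g ≤ f ⁻¹ᵁ U := (X.basicOpen_le g).trans h.le
  have hne : Nonempty (X.basicOpen g) := by
    have h2 : ((X.basicOpen g : X.Opens) : Set X).Nonempty := by
      rw [Set.nonempty_iff_ne_empty]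
      intro h3
      exact hg ((basicOpen_eq_bot_iff g).mp (TopologicalSpace.Opens.ext h3))
    exact h2.to_subtype
  refine ⟨h.isAffineOpen.basicOpen g, hne, hle, ?_⟩
  have := h.isAffineOpen.isLocalization_basicOpen g
  have h1 : Algebra.Etale Γ(X, W) Γ(X, X.basicOpen g) := .of_isLocalizationAway g
  have h2 : Polynomial.eval₂RingHom (f.appLE U (X.basicOpen g) hle).hom
      (X.presheaf.map (homOfLE (X.basicOpen_le g)).op t) =
      (algebraMap Γ(X, W) Γ(X, X.basicOpen g)).comp
        (Polynomial.eval₂RingHom (f.appLE U W h.le).hom t) := by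
    refine Polynomial.ringHom_ext' ?_ ?_
    · ext a
      simp only [RingHom.comp_apply, Polynomial.coe_eval₂RingHom, Polynomial.eval₂_C]
      exact (DFunLike.congr_fun (congrArg CommRingCat.Hom.hom
        (f.appLE_map h.le (homOfLE (X.basicOpen_le g)).op)) a).symm
    · simp only [RingHom.comp_apply, Polynomial.coe_eval₂RingHom, Polynomial.eval₂_X]
      rfl
  rw [h2]
  exact RingHom.Etale.stableUnderComposition _ _ h.etale (RingHom.etale_algebraMap.mpr h1)
end

section
variable {𝕜 : Type u} [Field 𝕜] {X C : Scheme.{u}} [X.Over (Spec (.of 𝕜))] [C.Over (Spec (.of 𝕜))]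
  {ι : C ⟶ X} [IsIntegral C]

/-- The map from the local ring at the generic point of a closed subvariety to its function field. -/
def localRingToFunctionField (hι : ι ≫ (X ↘ Spec (.of 𝕜)) = C ↘ Spec (.of 𝕜)) :
    X.presheaf.stalk (ι (genericPoint C)) →ₐ[𝕜] C.functionField where
  toRingHom := (ι.stalkMap (genericPoint C)).hom
  commutes' c := by
    have h1 := germ_algebraMap_sections (𝕜 := 𝕜) (W := ⊤) (ι (genericPoint C)) trivial c
    have h2 := germ_algebraMap_sections (𝕜 := 𝕜) (W := ι ⁻¹ᵁ ⊤) (genericPoint C) trivial c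
    rw [← h1]
    refine (Scheme.Hom.germ_stalkMap_apply ι ⊤ (genericPoint C) trivial _).trans ?_
    refine Eq.trans ?_ h2
    congr 1
    have h3 := appLE_algebraMap_sections hι (U := ⊤) (W := ι ⁻¹ᵁ ⊤) le_rfl c
    rwa [Scheme.Hom.appLE_eq_app] at h3

lemma localRingToFunctionField_germ (hι : ι ≫ (X ↘ Spec (.of 𝕜)) = C ↘ Spec (.of 𝕜)) {W : X.Opens}
    [Nonempty (ι ⁻¹ᵁ W)] (h : ι (genericPoint C) ∈ W) (r : Γ(X, W)) :
    localRingToFunctionField hι (X.presheaf.germ W _ h r) =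
      algebraMap Γ(C, ι ⁻¹ᵁ W) C.functionField (ι.app W r) :=
  Scheme.Hom.germ_stalkMap_apply ι W (genericPoint C) h r

end

end

/-! ### Constants, places and closed points of a proper fibre -/

noncomputable section

section
variable {𝕜 : Type u} [Field 𝕜] {C : Scheme.{u}} [C.Over (Spec (.of 𝕜))]

lemma exists_appLE_eq_algebraMap {V : (Spec (.of 𝕜)).Opens} (hV : V = ⊤) (s : Γ(Spec (.of 𝕜), V))
    (W : C.Opens) (e : W ≤ (C ↘ Spec (.of 𝕜)) ⁻¹ᵁ V) :
    ∃ c : 𝕜, (C ↘ Spec (.of 𝕜)).appLE V W e s = algebraMap 𝕜 Γ(C, W) c := by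
  subst hV
  refine ⟨(Scheme.ΓSpecIso (.of 𝕜)).hom s, ?_⟩
  rw [algebraMap_sections_eq]
  congr 1
  exact (ConcreteCategory.congr_hom (Scheme.ΓSpecIso (.of 𝕜)).hom_inv_id s).symm

/-- The composite to the base factors through the spectrum of the ground field, so functions from
the base restrict to constants. -/
lemma exists_app_appLE_eq_algebraMap {X B : Scheme.{u}} {f : X ⟶ B} {ι : C ⟶ X} {z : Spec (.of 𝕜) ⟶ B}
    (hz : ι ≫ f = (C ↘ Spec (.of 𝕜)) ≫ z) {U : B.Opens} (hU : ∀ x, z x ∈ U) {W : X.Opens}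
    (e : W ≤ f ⁻¹ᵁ U) (a : Γ(B, U)) :
    ∃ c : 𝕜, ι.app W (f.appLE U W e a) = algebraMap 𝕜 Γ(C, ι ⁻¹ᵁ W) c := by
  have h1 : z ⁻¹ᵁ U = ⊤ := by ext x; simpa using hU x
  obtain ⟨c, hc⟩ := exists_appLE_eq_algebraMap (C := C) h1 (z.app U a) (ι ⁻¹ᵁ W) (h1 ▸ le_top)
  refine ⟨c, Eq.trans ?_ hc⟩
  have h2 : f.appLE U W e ≫ ι.app W = z.app U ≫ (C ↘ Spec (.of 𝕜)).appLE (z ⁻¹ᵁ U) (ι ⁻¹ᵁ W)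
      (h1 ▸ le_top) := by
    rw [Scheme.Hom.app_eq_appLE, Scheme.Hom.app_eq_appLE, Scheme.Hom.appLE_comp_appLE,
      Scheme.Hom.appLE_comp_appLE]
    simp only [hz]
  exact ConcreteCategory.congr_hom h2 a

lemma fromSpecStalk_over [IsIntegral C] : C.fromSpecStalk (genericPoint C) ≫ (C ↘ Spec (.of 𝕜)) =
    Spec.map (CommRingCat.ofHom (algebraMap 𝕜 C.functionField)) := by
  have h1 : (C ↘ Spec (.of 𝕜)) = C.toSpecΓ ≫ Spec.map (C ↘ Spec (.of 𝕜)).appTop ≫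
      Spec.map (Scheme.ΓSpecIso (.of 𝕜)).inv := by
    rw [← Scheme.toSpecΓ_naturality_assoc, ← SpecMap_ΓSpecIso_hom, ← Spec.map_comp]
    simp
  have h2 : CommRingCat.ofHom (algebraMap 𝕜 C.functionField) = (Scheme.ΓSpecIso (.of 𝕜)).inv ≫
      (C ↘ Spec (.of 𝕜)).appTop ≫ C.presheaf.germ ⊤ (genericPoint C) trivial := by
    ext c
    exact TopCat.Presheaf.germ_res_apply C.presheaf (homOfLE le_top) (genericPoint C)
      (show genericPoint C ∈ (⊤ : C.Opens) from trivial) _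
  rw [h2, h1, Scheme.fromSpecStalk_toSpecΓ_assoc, Spec.map_comp, Spec.map_comp, Category.assoc,
    ← h1]

lemma fromSpecStalk_appLE_top {C : Scheme.{u}} {W : C.Opens} {x : C} (hx : x ∈ W)
    (e : ⊤ ≤ C.fromSpecStalk x ⁻¹ᵁ W) : (C.fromSpecStalk x).appLE W ⊤ e ≫
      (Scheme.ΓSpecIso (C.presheaf.stalk x)).hom = C.presheaf.germ W x hx := by
  rw [Scheme.Hom.appLE, Scheme.fromSpecStalk_app hx]
  simp only [Category.assoc]
  rw [← Functor.map_comp_assoc]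
  have : ((homOfLE le_top : C.fromSpecStalk x ⁻¹ᵁ W ⟶ ⊤).op ≫ (homOfLE e).op) = 𝟙 _ := rfl
  rw [this, CategoryTheory.Functor.map_id, Category.id_comp, Iso.inv_hom_id, Category.comp_id]

/-- By the valuative criterion every place has a centre on the proper curve, and functions regular
at the centre lie in the valuation ring. -/
lemma exists_forall_mem_of_isProper [IsIntegral C] [IsProper (C ↘ Spec (.of 𝕜))]
    (v : ValuationSubring C.functionField) (hv : ∀ c : 𝕜, algebraMap 𝕜 C.functionField c ∈ v) :
    ∃ y : C, ∀ (W : C.Opens) [Nonempty W], y ∈ W → ∀ r : Γ(C, W),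
      algebraMap Γ(C, W) C.functionField r ∈ v := by
  let i₂ : 𝕜 →+* v := (algebraMap 𝕜 C.functionField).codRestrict v.toSubring hv
  have hex : ValuativeCriterion.Existence (C ↘ Spec (.of 𝕜)) := by
    have h : UniversallyClosed (C ↘ Spec (.of 𝕜)) := inferInstance
    rw [UniversallyClosed.eq_valuativeCriterion] at h
    exact h.1
  have hw : C.fromSpecStalk (genericPoint C) ≫ (C ↘ Spec (.of 𝕜)) =
      Spec.map (CommRingCat.ofHom (algebraMap v C.functionField)) ≫
        Spec.map (CommRingCat.ofHom i₂) := by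
    rw [fromSpecStalk_over, ← Spec.map_comp]
    rfl
  obtain ⟨l, hl, -⟩ := (hex
    { R := v, K := C.functionField, i₁ := C.fromSpecStalk (genericPoint C),
      i₂ := Spec.map (CommRingCat.ofHom i₂), commSq := ⟨hw⟩ }).exists_lift
  dsimp only at l hl
  refine ⟨l (IsLocalRing.closedPoint v), fun W _ hy r ↦ ?_⟩
  have htop : ⊤ ≤ l ⁻¹ᵁ W := fun x _ ↦
    (IsLocalRing.specializes_closedPoint x).mem_open (l ⁻¹ᵁ W).2 hy
  have h1 : algebraMap Γ(C, W) C.functionField r =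
      algebraMap v C.functionField ((Scheme.ΓSpecIso (.of v)).hom (l.appLE W ⊤ htop r)) := by
    have h2 := Scheme.ΓSpecIso_naturality (CommRingCat.ofHom (algebraMap v C.functionField))
    have h3 : l.appLE W ⊤ htop ≫ (Scheme.ΓSpecIso (.of v)).hom ≫
        CommRingCat.ofHom (algebraMap v C.functionField) = C.germToFunctionField W := by
      let φ := CommRingCat.ofHom (algebraMap v C.functionField)
      have h5 := Scheme.Hom.appLE_comp_appLE (Spec.map φ) l (U := W) (V := ⊤) (W := ⊤) htop
        (show ⊤ ≤ Spec.map φ ⁻¹ᵁ ⊤ from le_top)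
      simp only [φ, hl] at h5
      have h6 : (Spec.map φ).appLE ⊤ ⊤ (show ⊤ ≤ Spec.map φ ⁻¹ᵁ ⊤ from le_top) = (Spec.map φ).appTop :=
        Scheme.Hom.appLE_eq_app _
      have h4 : l.appLE W ⊤ htop ≫ (Spec.map φ).appTop = _ := (congrArg (_ ≫ ·) h6.symm).trans h5
      rw [← h2, ← Category.assoc, h4]
      exact fromSpecStalk_appLE_top (genericPoint_mem W) _
    exact (ConcreteCategory.congr_hom h3 r).symm
  rw [h1]
  exact Subtype.prop _

/-- The kernel of `p` is maximal, and a point closed in an open subset of a Jacobson space is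
closed. -/
lemma exists_closedPoint_of_algHom [IsIntegral C] [LocallyOfFiniteType (C ↘ Spec (.of 𝕜))]
    {V : C.Opens} (hV : IsAffineOpen V) [Nonempty V] (p : regularFunctions 𝕜 V →ₐ[𝕜] 𝕜) :
    ∃ y : C, y ∈ V ∧ IsClosed {y} ∧ ∀ r : Γ(C, V),
      y ∈ C.basicOpen r ↔ p ⟨_, algebraMap_mem_regularFunctions V r⟩ ≠ 0 := by
  let π : Γ(C, V) →ₐ[𝕜] 𝕜 := p.comp (IsScalarTower.toAlgHom 𝕜 Γ(C, V) C.functionField).rangeRestrict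
  have hmax : (RingHom.ker π.toRingHom).IsMaximal :=
    RingHom.ker_isMaximal_of_surjective _ fun c ↦ ⟨algebraMap 𝕜 _ c, π.commutes c⟩
  let m : PrimeSpectrum Γ(C, V) := ⟨_, hmax.isPrime⟩
  have hm : IsClosed {m} := (PrimeSpectrum.isClosed_singleton_iff_isMaximal m).mpr hmax
  have hyV : hV.fromSpec m ∈ V := by
    have : hV.fromSpec m ∈ Set.range hV.fromSpec := ⟨m, rfl⟩
    rwa [hV.range_fromSpec] at this
  refine ⟨hV.fromSpec m, hyV, ?_, fun r ↦ ?_⟩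
  · have : JacobsonSpace C := LocallyOfFiniteType.jacobsonSpace (C ↘ Spec (.of 𝕜))
    have h1 : hV.fromSpec '' {m} = {hV.fromSpec m} := Set.image_singleton
    refine isClosed_singleton_of_isLocallyClosed_singleton ?_
    rw [← h1]
    exact hm.isLocallyClosed.image hV.fromSpec.isOpenEmbedding.isInducing
      hV.fromSpec.isOpenEmbedding.isOpen_range.isLocallyClosed
  · change m ∈ hV.fromSpec ⁻¹ᵁ C.basicOpen r ↔ _
    rw [hV.fromSpec_preimage_basicOpen]
    rfl
end

end

/-! ### The contradiction on one fibre -/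

noncomputable section

section
variable {𝕜 : Type u} [Field 𝕜] {C : Scheme.{u}} [C.Over (Spec (.of 𝕜))] [IsIntegral C]

lemma isFractionRing_regularFunctions {V : C.Opens} (hV : IsAffineOpen V) [Nonempty V] :
    IsFractionRing (regularFunctions 𝕜 V) C.functionField := by
  have := functionField_isFractionRing_of_isAffineOpen C V hV
  refine IsFractionRing.of_field _ _ fun z ↦ ?_
  obtain ⟨x, y, -, rfl⟩ := IsFractionRing.div_surjective (A := Γ(C, V)) z
  exact ⟨⟨_, algebraMap_mem_regularFunctions V x⟩, ⟨_, algebraMap_mem_regularFunctions V y⟩, rfl⟩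

lemma fg_regularFunctions [LocallyOfFiniteType (C ↘ Spec (.of 𝕜))] {V : C.Opens}
    (hV : IsAffineOpen V) [Nonempty V] : (regularFunctions 𝕜 V).FG := by
  have := finiteType_sections (𝕜 := 𝕜) hV
  have h : (⊤ : Subalgebra 𝕜 Γ(C, V)).FG := Algebra.FiniteType.out
  rw [regularFunctions, ← Algebra.map_top]
  exact h.map _

lemma algHom_eq_of_forall {V : C.Opens} [Nonempty V] {p p' : regularFunctions 𝕜 V →ₐ[𝕜] 𝕜}
    (h : ∀ r : Γ(C, V), p ⟨_, algebraMap_mem_regularFunctions V r⟩ = 0 →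
      p' ⟨_, algebraMap_mem_regularFunctions V r⟩ = 0) : p = p' := by
  ext ⟨_, r, rfl⟩
  let π (p : regularFunctions 𝕜 V →ₐ[𝕜] 𝕜) : Γ(C, V) →ₐ[𝕜] 𝕜 :=
    p.comp (IsScalarTower.toAlgHom 𝕜 Γ(C, V) C.functionField).rangeRestrict
  have h0 (p) (c : 𝕜) : π p (r - algebraMap 𝕜 _ c) = π p r - c := by
    rw [map_sub, AlgHom.commutes, Algebra.algebraMap_self_apply]
  have h1 := h (r - algebraMap 𝕜 _ (π p r)) ((h0 p _).trans (sub_self _))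
  exact (sub_eq_zero.mp ((h0 p' _).symm.trans h1)).symm

end

/-- If the sections `g s` separate `γ` points and `h` makes the products `g s * h` regular along the
fibre `C`, then the function field of `C` has no transcendental element of degree at most `γ`. -/
theorem false_of_separates_of_isChart {𝕜 : Type u} [Field 𝕜] [IsAlgClosed 𝕜] {X B C : Scheme.{u}}
    [X.Over (Spec (.of 𝕜))] [B.Over (Spec (.of 𝕜))] [C.Over (Spec (.of 𝕜))] [IsIntegral X]
    [IsIntegral C] [IsProper (C ↘ Spec (.of 𝕜))] {f : X ⟶ B}
    (hf : f ≫ (B ↘ Spec (.of 𝕜)) = X ↘ Spec (.of 𝕜)) {ι : C ⟶ X} [IsClosedImmersion ι]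
    (hι : ι ≫ (X ↘ Spec (.of 𝕜)) = C ↘ Spec (.of 𝕜)) {z : Spec (.of 𝕜) ⟶ B}
    (hz : ι ≫ f = (C ↘ Spec (.of 𝕜)) ≫ z) {U : B.Opens} (hzU : ∀ x, z x ∈ U)
    [Nonempty (f ⁻¹ᵁ U)] {W₀ : X.Opens} [Nonempty W₀] {t₀ : Γ(X, W₀)} (hW₀ : IsChart f U W₀ t₀)
    (hc₀ : ι (genericPoint C) ∈ W₀) (V : Derivation 𝕜 X.functionField X.functionField)
    (hV : ∀ a, V ((baseAlgebra f U).algebraMap a) = 0)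
    (hVt : V (algebraMap Γ(X, W₀) X.functionField t₀) = 1) {S : Type*} (g : S → Γ(X, W₀))
    {h : Γ(X, W₀)} (hh : IsUnit h)
    (hreg : (∀ y : C, ∃ (W : X.Opens) (_ : Nonempty W) (t : Γ(X, W)), ι y ∈ W ∧ ∀ s, ∃ r : Γ(X, W),
        algebraMap Γ(X, W₀) X.functionField (g s) * algebraMap Γ(X, W₀) X.functionField h =
          algebraMap Γ(X, W) X.functionField r * V (algebraMap Γ(X, W) X.functionField t)) ∨
      ∀ y : C, ∃ (W : X.Opens) (_ : Nonempty W), ι y ∈ W ∧ ∀ s, ∃ r : Γ(X, W),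
        algebraMap Γ(X, W₀) X.functionField (g s) * algebraMap Γ(X, W₀) X.functionField h =
          algebraMap Γ(X, W) X.functionField r)
    {γ : ℕ} (hγ : 2 ≤ γ)
    (hsep : ∀ x : Fin γ → X, Function.Injective x → (∀ i, x i ∈ W₀ ∧ IsClosed {x i}) →
      ∃ s, ∀ i : Fin γ, ((i : ℕ) + 1 < γ → x i ∉ X.basicOpen (g s)) ∧
        ((i : ℕ) + 1 = γ → x i ∈ X.basicOpen (g s)))
    {x : C.functionField} (hx : Transcendental 𝕜 x)
    [FiniteDimensional (IntermediateField.adjoin 𝕜 {x}) C.functionField]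
    (hγx : Module.finrank (IntermediateField.adjoin 𝕜 {x}) C.functionField ≤ γ) : False := by
  let O := X.presheaf.stalk (ι (genericPoint C))
  let ψ : O →ₐ[𝕜] C.functionField := localRingToFunctionField hι
  have hgen (y : C) {W : X.Opens} (hy : ι y ∈ W) : ι (genericPoint C) ∈ W :=
    (((genericPoint_spec C).specializes (y := y) trivial).map ι.continuous).mem_open W.2 hy
  let gm (W : X.Opens) (hW : ι (genericPoint C) ∈ W) : Γ(X, W) →+* O := (X.presheaf.germ W _ hW).hom
  have hgm (W : X.Opens) [Nonempty W] (hW : ι (genericPoint C) ∈ W) (r : Γ(X, W)) :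
      algebraMap O X.functionField (gm W hW r) = algebraMap Γ(X, W) X.functionField r :=
    X.algebraMap_germ_eq_germToFunctionField hW r
  have hO : Function.Injective (algebraMap O X.functionField) := IsFractionRing.injective _ _
  have hnonempty (W : X.Opens) (hW : ι (genericPoint C) ∈ W) : Nonempty (ι ⁻¹ᵁ W) := ⟨⟨genericPoint C, hW⟩⟩
  have hψgm (W : X.Opens) (hW : ι (genericPoint C) ∈ W) (r : Γ(X, W)) :
      have : Nonempty (ι ⁻¹ᵁ W) := hnonempty W hW
      ψ (gm W hW r) = algebraMap Γ(C, ι ⁻¹ᵁ W) C.functionField (ι.app W r) := by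
    have : Nonempty (ι ⁻¹ᵁ W) := hnonempty W hW
    exact localRingToFunctionField_germ hι hW r
  -- `V` preserves the local ring of `X` at the generic point of the fibre, and derivations of the
  -- function field of the fibre are multiples of its reduction. Thus identities involving `V`
  -- reduce to identities on the fibre.
  obtain ⟨V₀, hV₀, hD⟩ : ∃ V₀ : O → O,
      (∀ x, V (algebraMap O X.functionField x) = algebraMap O X.functionField (V₀ x)) ∧
      ∀ (D : Derivation 𝕜 C.functionField C.functionField) (x : O),
        D (ψ x) = D (ψ (gm W₀ hc₀ t₀)) * ψ (V₀ x) := by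
    let := (f.appLE U W₀ hW₀.le).hom.toAlgebra
    let : Algebra Γ(X, W₀) O := (gm W₀ hc₀).toAlgebra
    have : IsScalarTower 𝕜 Γ(B, U) Γ(X, W₀) :=
      .of_algebraMap_eq fun c ↦ (appLE_algebraMap_sections hf hW₀.le c).symm
    have : IsScalarTower 𝕜 Γ(X, W₀) O :=
      .of_algebraMap_eq fun c ↦ (germ_algebraMap_sections _ hc₀ c).symm
    have : IsScalarTower Γ(X, W₀) O X.functionField := .of_algebraMap_eq fun r ↦ (hgm W₀ hc₀ r).symm
    have : IsScalarTower 𝕜 O X.functionField := .of_algebraMap_eq fun c ↦ by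
      rw [IsScalarTower.algebraMap_apply 𝕜 Γ(X, W₀) O, ← IsScalarTower.algebraMap_apply Γ(X, W₀) O,
        ← IsScalarTower.algebraMap_apply]
    have hloc : IsLocalization.AtPrime O (hW₀.isAffineOpen.primeIdealOf ⟨_, hc₀⟩).asIdeal :=
      hW₀.isAffineOpen.isLocalization_stalk ⟨_, hc₀⟩
    have : Algebra.FormallyEtale Γ(X, W₀) O := .of_isLocalization
      (hW₀.isAffineOpen.primeIdealOf ⟨_, hc₀⟩).asIdeal.primeCompl
    refine exists_vertical_restriction (A := Γ(B, U)) (R := Γ(X, W₀)) (t := t₀) hW₀.etale V (fun a ↦ ?_) hVt ψ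
      (fun a ↦ ?_)
    · exact (congrArg V (baseAlgebra_apply hW₀.le a)).symm.trans (hV a)
    · obtain ⟨c, hc⟩ := exists_app_appLE_eq_algebraMap hz hzU hW₀.le a
      refine ⟨c, (hψgm W₀ hc₀ _).trans ?_⟩
      have : Nonempty (ι ⁻¹ᵁ W₀) := hnonempty W₀ hc₀
      exact (congrArg (algebraMap Γ(C, ι ⁻¹ᵁ W₀) C.functionField) hc).trans
        (IsScalarTower.algebraMap_apply 𝕜 Γ(C, ι ⁻¹ᵁ W₀) C.functionField c).symm
  have hne₀ : Nonempty (ι ⁻¹ᵁ W₀) := hnonempty W₀ hc₀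
  have haff : IsAffineOpen (ι ⁻¹ᵁ W₀) := hW₀.isAffineOpen.preimage ι
  have := isFractionRing_regularFunctions (𝕜 := 𝕜) haff
  have hmem (v : ValuationSubring C.functionField) (y : C) {W : X.Opens} (hy : ι y ∈ W)
      (hv : ∀ (W' : C.Opens) [Nonempty W'], y ∈ W' → ∀ r : Γ(C, W'),
        algebraMap Γ(C, W') C.functionField r ∈ v) (r : Γ(X, W)) : ψ (gm W (hgen y hy) r) ∈ v := by
    have : Nonempty (ι ⁻¹ᵁ W) := hnonempty W (hgen y hy)
    rw [hψgm]
    exact hv _ hy _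
  let G (s : S) : regularFunctions 𝕜 (ι ⁻¹ᵁ W₀) :=
    ⟨_, algebraMap_mem_regularFunctions (ι ⁻¹ᵁ W₀) (ι.app W₀ (g s))⟩
  have hG (s : S) : (G s : C.functionField) = ψ (gm W₀ hc₀ (g s)) := (hψgm W₀ hc₀ _).symm
  refine false_of_separates_of_finrank_le (regularFunctions 𝕜 (ι ⁻¹ᵁ W₀)) (fg_regularFunctions haff)
    hγ hx hγx (Set.range G) (ψ (gm W₀ hc₀ h)) ((hh.map (gm W₀ hc₀)).map ψ).ne_zero ?_ ?_
  · intro p hp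
    choose y hyW hyc hy using fun i ↦ exists_closedPoint_of_algHom (𝕜 := 𝕜) haff (p i)
    have hyinj : Function.Injective y := fun i j hij ↦ hp <| algHom_eq_of_forall fun r hr ↦ by
      by_contra h
      exact (hij ▸ (hy j r).mpr h : y i ∈ C.basicOpen r) |> (hy i r).mp <| hr
    obtain ⟨s, hs⟩ := hsep (fun i ↦ ι (y i)) (ι.isClosedEmbedding.injective.comp hyinj) fun i ↦
      ⟨hyW i, by simpa using ι.isClosedEmbedding.isClosedMap _ (hyc i)⟩
    have hs' (i) : ι (y i) ∈ X.basicOpen (g s) ↔ p i (G s) ≠ 0 := by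
      rw [← hy i]
      change y i ∈ ι ⁻¹ᵁ X.basicOpen (g s) ↔ _
      rw [Scheme.preimage_basicOpen]
    exact ⟨G s, ⟨s, rfl⟩, fun i ↦ ⟨fun hi ↦ not_not.mp fun h ↦ (hs i).1 hi ((hs' i).mpr h),
      fun hi ↦ (hs' i).mp ((hs i).2 hi)⟩⟩
  · refine hreg.imp (fun hreg ↦ ⟨ψ (gm W₀ hc₀ t₀), fun D hD0 hDt ↦ hD0 ?_, ?_⟩) fun hreg ↦ ?_
    · ext b
      -- Here `τ` is the restriction of `t₀`. Every function on the fibre lifts to `O`, so by `hD` a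
      -- derivation that kills `τ` is zero.
      obtain ⟨b, rfl⟩ : ∃ b', ψ b' = b := ι.stalkMap_surjective (genericPoint C) b
      rw [hD, hDt, zero_mul]
      rfl
    · rintro _ ⟨s, rfl⟩ v hv D
      obtain ⟨y, hy⟩ := exists_forall_mem_of_isProper v hv
      obtain ⟨W, _, t, hyW, hr⟩ := hreg y
      obtain ⟨r, hr⟩ := hr s
      -- The identity of rational functions on `X` already holds in the local ring `O`. Applying `ψ`
      -- and multiplying by `D τ` gives a function regular at the centre of `v` times `D` of another
      -- such function.
      have h1 : gm W₀ hc₀ (g s) * gm W₀ hc₀ h = gm W (hgen y hyW) r * V₀ (gm W (hgen y hyW) t) := by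
        apply hO
        rw [map_mul, map_mul, ← hV₀, hgm, hgm, hgm, hgm, hr]
      rw [hG, ← map_mul, h1, map_mul, mul_assoc, mul_comm (ψ (V₀ _)), ← hD]
      exact Submodule.smul_mem _ (⟨_, hmem v y hyW hy r⟩ : v)
        (Submodule.subset_span ⟨_, hmem v y hyW hy t, rfl⟩)
    · rintro _ ⟨s, rfl⟩ v hv
      obtain ⟨y, hy⟩ := exists_forall_mem_of_isProper v hv
      obtain ⟨W, _, hyW, hr⟩ := hreg y
      obtain ⟨r, hr⟩ := hr s
      have h1 : gm W₀ hc₀ (g s) * gm W₀ hc₀ h = gm W (hgen y hyW) r := by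
        apply hO
        rw [map_mul, hgm, hgm, hgm, hr]
      rw [hG, ← map_mul, h1]
      exact hmem v y hyW hy r

end

/-! ### Sections of the line bundle along the fibres -/

noncomputable section

lemma regularForms_mono {k K : Type*} [Field k] [Field K] [Algebra k K] {R R' : Subalgebra k K}
    (h : R ≤ R') (q : ℕ) : regularForms R q ≤ regularForms R' q :=
  AddSubgroup.closure_mono fun _ ⟨r, x, hr, hx, hθ⟩ ↦ ⟨r, x, h hr, fun i ↦ h (hx i), hθ⟩

lemma mem_basicOpen_iff_germ_notMem {X : Scheme.{u}} {W : X.Opens} {x : X} (hx : x ∈ W)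
    (g : Γ(X, W)) : x ∈ X.basicOpen g ↔
      X.presheaf.germ W x hx g ∉ IsLocalRing.maximalIdeal (X.presheaf.stalk x) := by
  rw [Scheme.mem_basicOpen _ _ _ hx, IsLocalRing.mem_maximalIdeal, mem_nonunits_iff, not_not]

section
variable {𝕜 : Type u} [Field 𝕜] {X B : Scheme.{u}} [X.Over (Spec (.of 𝕜))]
  [IsIntegral X] {f : X ⟶ B}

lemma finite_kaehlerDifferential_functionField [LocallyOfFiniteType (X ↘ Spec (.of 𝕜))]
    {W : X.Opens} (hW : IsAffineOpen W) [Nonempty W] :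
    Module.Finite X.functionField Ω[X.functionField⁄𝕜] := by
  have := finiteType_sections (𝕜 := 𝕜) hW
  have := functionField_isFractionRing_of_isAffineOpen X W hW
  have : Algebra.EssFiniteType Γ(X, W) X.functionField := .of_isLocalization _ (nonZeroDivisors Γ(X, W))
  have : Algebra.EssFiniteType 𝕜 X.functionField := .comp 𝕜 Γ(X, W) _
  infer_instance

/-- The chart is shrunk to the locus where the numerator and denominator of `z` are invertible. This
makes the factor `h` a nonzero function on the fibres meeting the chart. -/
lemma IsChart.exists_isUnit_algebraMap_eq {U : B.Opens} {W : X.Opens} [Nonempty W] {t : Γ(X, W)}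
    (h : IsChart f U W t) {z : X.functionField} (hz : z ≠ 0) :
    ∃ (W' : X.Opens) (_ : Nonempty W') (e : W' ≤ W) (z' : Γ(X, W')),
      IsChart f U W' (X.presheaf.map (homOfLE e).op t) ∧ IsUnit z' ∧
        algebraMap Γ(X, W') X.functionField z' = z := by
  have := functionField_isFractionRing_of_isAffineOpen X W h.isAffineOpen
  obtain ⟨a, b, hb, rfl⟩ := IsFractionRing.div_surjective (A := Γ(X, W)) z
  have hb0 : b ≠ 0 := nonZeroDivisors.ne_zero hb
  have ha0 : a ≠ 0 := by rintro rfl; simp at hz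
  have h' := h.basicOpen (mul_ne_zero ha0 hb0)
  let ρ := (X.presheaf.map (homOfLE (X.basicOpen_le (a * b))).op).hom
  have hu : IsUnit (ρ (a * b)) := RingedSpace.isUnit_res_basicOpen _ _
  rw [map_mul, IsUnit.mul_iff] at hu
  obtain ⟨⟨u, hu⟩, ⟨v, hv⟩⟩ := hu
  refine ⟨_, h'.nonempty, X.basicOpen_le (a * b), ↑(u * v⁻¹), h', Units.isUnit _, ?_⟩
  have := h'.nonempty
  rw [eq_div_iff (by simpa using hb0), ← algebraMap_map_sections (homOfLE (X.basicOpen_le (a * b))) b,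
    ← algebraMap_map_sections (homOfLE (X.basicOpen_le (a * b))) a]
  refine (map_mul _ _ _).symm.trans (congrArg _ ?_)
  change ↑(u * v⁻¹) * ρ b = ρ a
  rw [← hv, ← hu, ← Units.val_mul, inv_mul_cancel_right]

variable (f) in
/-- After multiplication by a function `h`, the sections of a line bundle of forms are regular along
the fibres. -/
theorem exists_regular_products [B.Over (Spec (.of 𝕜))] [IsIntegral B] [LocallyOfFiniteType (X ↘ Spec (.of 𝕜))]
    [LocallyOfFiniteType (B ↘ Spec (.of 𝕜))] [IsProper f]
    [SmoothOfRelativeDimension 1 (f.fiberToSpecResidueField (genericPoint B))]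
    [GeometricallyConnected (f.fiberToSpecResidueField (genericPoint B))]
    (hf : f ≫ (B ↘ Spec (.of 𝕜)) = X ↘ Spec (.of 𝕜)) (hfg : f (genericPoint X) = genericPoint B)
    {U : B.Opens} (hU : IsAffineOpen U) [Nonempty U] [Nonempty (f ⁻¹ᵁ U)] {L : X.Modules}
    (hL : IsLineBundle L) {q : ℕ} (φ : L ⟶ sheafOfForms (X ↘ Spec (.of 𝕜)) q) [Mono φ] (O : X.Opens)
    (hO : (O : Set X).Nonempty) :
    ∃ (V : Derivation 𝕜 X.functionField X.functionField) (W₀ : X.Opens) (_ : Nonempty W₀)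
      (t₀ : Γ(X, W₀)) (g : Γ(L, ⊤) → Γ(X, W₀)) (h : Γ(X, W₀)) (a : Γ(B, U)) (S : Finset X.Opens),
      (∀ a, V ((baseAlgebra f U).algebraMap a) = 0) ∧
      V (algebraMap Γ(X, W₀) X.functionField t₀) = 1 ∧ IsChart f U W₀ t₀ ∧ IsUnit h ∧ W₀ ≤ O ∧
      (∀ s x, x ∈ W₀ → (VanishesAt L s x ↔ x ∉ X.basicOpen (g s))) ∧ a ≠ 0 ∧
      (∀ W ∈ S, ∃ t, IsChart f U W t) ∧ (∀ x, f x ∈ B.basicOpen a → ∃ W ∈ S, x ∈ W) ∧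
      ((∀ W ∈ S, ∃ (_ : Nonempty W) (t : Γ(X, W)), ∀ s, ∃ r : Γ(X, W),
        algebraMap Γ(X, W₀) X.functionField (g s) * algebraMap Γ(X, W₀) X.functionField h =
          algebraMap Γ(X, W) X.functionField r * V (algebraMap Γ(X, W) X.functionField t)) ∨
      ∀ W ∈ S, ∃ (_ : Nonempty W), ∀ s, ∃ r : Γ(X, W),
        algebraMap Γ(X, W₀) X.functionField (g s) * algebraMap Γ(X, W₀) X.functionField h =
          algebraMap Γ(X, W) X.functionField r) := by
  have : IsLocallyNoetherian B := LocallyOfFiniteType.isLocallyNoetherian (B ↘ Spec (.of 𝕜))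
  obtain ⟨W₂, _, ω, g, hW₂O, hω, hg, hreg⟩ := exists_form_of_mono hL φ O hO
  choose Wx hWx hxWx hregx using hreg
  obtain ⟨W₁, t₁, h₁, -, hW₁⟩ := exists_isChart f hU W₂ (genericPoint_mem W₂) hfg
  have := h₁.nonempty
  have := finite_kaehlerDifferential_functionField (𝕜 := 𝕜) h₁.isAffineOpen
  have := finiteType_sections (𝕜 := 𝕜) hU
  let _ := baseAlgebra f U
  have : IsScalarTower 𝕜 Γ(B, U) X.functionField := .of_algebraMap_eq fun c ↦ by
    refine Eq.trans ?_ (baseAlgebra_apply h₁.le _).symm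
    rw [appLE_algebraMap_sections hf, ← IsScalarTower.algebraMap_apply]
  have hinj : Function.Injective (algebraMap Γ(B, U) X.functionField) := fun a b hab ↦ by
    refine injective_appLE f hfg U W₁ h₁.le (X.germToFunctionField_injective W₁ ?_)
    exact (baseAlgebra_apply h₁.le a).symm.trans (hab.trans (baseAlgebra_apply h₁.le b))
  have hc₁ := h₁.isRelativeCoordinate (𝕜 := 𝕜) hf hfg
  obtain ⟨V, hV, hVt, -⟩ := hc₁.exists_vertical
  obtain ⟨h, hh, H⟩ := exists_coordinate_function (span_isStableOn_eq_top hinj hc₁) V hV hω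
  obtain ⟨W₀, _, e, h', h₀, hh', rfl⟩ := h₁.exists_isUnit_algebraMap_eq hh
  obtain ⟨a, S, ha, hS, hcov⟩ := exists_finset_isChart f hU Wx hxWx
  have hforms (W) (hW : W ∈ S) [Nonempty W] (s) :
      algebraMap Γ(X, W₂) X.functionField (g s) • ω ∈ regularForms (regularFunctions 𝕜 W) q := by
    obtain ⟨x, hx⟩ := (hS W hW).2
    have := hWx x
    exact regularForms_mono (regularFunctions_mono hx) q (hregx x s)
  have hg' (s) : algebraMap Γ(X, W₀) X.functionField (X.presheaf.map (homOfLE (e.trans hW₁)).op (g s)) =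
      algebraMap Γ(X, W₂) X.functionField (g s) := algebraMap_map_sections _ _
  refine ⟨V, W₀, ‹_›, _, fun s ↦ X.presheaf.map (homOfLE (e.trans hW₁)).op (g s), h', a, S, hV, ?_, h₀, hh',
    (e.trans hW₁).trans hW₂O, fun s x hx ↦ ?_, ha, fun W hW ↦ (hS W hW).1, hcov, ?_⟩
  · rw [algebraMap_map_sections, hVt]
  · rw [hg s x (hW₁ (e hx)), mem_basicOpen_iff_germ_notMem hx, not_not]
    exact iff_of_eq (congrArg (· ∈ IsLocalRing.maximalIdeal (X.presheaf.stalk x))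
      (TopCat.Presheaf.germ_res_apply X.presheaf (homOfLE (e.trans hW₁)) x hx (g s)).symm)
  · simp only [hg']
    refine H.imp (fun H W hW ↦ ?_) fun H W hW ↦ ?_
    · obtain ⟨t, ht⟩ := (hS W hW).1
      have := ht.nonempty
      refine ⟨this, t, fun s ↦ ?_⟩
      obtain ⟨_, ⟨r, rfl⟩, hr⟩ := H _ _ (ht.isRelativeCoordinate hf hfg) _ (hforms W hW s)
      exact ⟨r, hr⟩
    · obtain ⟨t, ht⟩ := (hS W hW).1
      have := ht.nonempty
      refine ⟨this, fun s ↦ ?_⟩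
      have hc := ht.isRelativeCoordinate (𝕜 := 𝕜) hf hfg
      -- A derivation is determined by its values on the base and on the coordinate; if `V` killed
      -- both, it would be zero.
      have hVt' : V (algebraMap Γ(X, W) X.functionField t) ≠ 0 := fun h0 ↦ by
        have : V = 0 := hc.ext _ _ (fun a ↦ by rw [hV]; rfl) (by rw [h0]; rfl)
        rw [this] at hVt
        exact zero_ne_one hVt
      obtain ⟨r, hr⟩ := H _ _ hc hVt' _ (hforms W hW s)
      exact ⟨r, hr.symm⟩

end

lemma exists_forall_isPrime_map {X B : Scheme.{u}} {f : X ⟶ B} [IsIntegral X] [IsIntegral B]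
    [SmoothOfRelativeDimension 1 (f.fiberToSpecResidueField (genericPoint B))]
    [GeometricallyConnected (f.fiberToSpecResidueField (genericPoint B))] {U : B.Opens}
    (hU : IsAffineOpen U) [Nonempty U] (hf : f (genericPoint X) = genericPoint B) (S : Finset X.Opens)
    (hS : ∀ W ∈ S, ∃ t, IsChart f U W t) :
    ∃ a : Γ(B, U), a ≠ 0 ∧ ∀ m : Ideal Γ(B, U), m.IsMaximal → a ∉ m → ∀ W ∈ S, ∀ e : W ≤ f ⁻¹ᵁ U,
      (m.map (f.appLE U W e).hom).IsPrime ∧ ¬ (m.map (f.appLE U W e).hom).IsMaximal ∧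
      ∀ P : Ideal Γ(X, W), P.IsPrime → m.map (f.appLE U W e).hom < P → P.IsMaximal := by
  have h (W : S) := (hS W W.2).choose_spec.exists_forall_isPrime_map hU hf
  choose a ha H using h
  refine ⟨∏ W, a W, Finset.prod_ne_zero_iff.mpr fun W _ ↦ ha W, fun m hm ham W hW e ↦
    H ⟨W, hW⟩ m hm fun h ↦ ham ?_⟩
  exact m.mem_of_dvd (Finset.dvd_prod_of_mem a (Finset.mem_univ ⟨W, hW⟩)) h

end

/-! ### The general fibres -/

noncomputable section
open Limits

/-- The fibre over a closed point of an affine open subset of the base is the base change along a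
homomorphism from the ring of functions to the algebraically closed field. -/
lemma exists_isPullback_fiber {𝕜 : Type u} [Field 𝕜] [IsAlgClosed 𝕜] {X B : Scheme.{u}} {f : X ⟶ B}
    {pX : X ⟶ Spec (.of 𝕜)} {pB : B ⟶ Spec (.of 𝕜)} [LocallyOfFiniteType pB] (hf : f ≫ pB = pX)
    {U : B.Opens} (hU : IsAffineOpen U) {b : B} (hbU : b ∈ U) (hb : IsClosed {b}) :
    ∃ _ : Algebra Γ(B, U) 𝕜, Function.Surjective (algebraMap Γ(B, U) 𝕜) ∧
      (∀ a : Γ(B, U), b ∈ B.basicOpen a → algebraMap Γ(B, U) 𝕜 a ≠ 0) ∧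
      IsPullback (f.fiberι b) (f.fiberι b ≫ pX) f
        (Spec.map (CommRingCat.ofHom (algebraMap Γ(B, U) 𝕜)) ≫ hU.fromSpec) := by
  let z := pointOfClosedPoint pB b hb
  have hzU : Set.range z ⊆ Set.range hU.fromSpec := by
    rw [hU.range_fromSpec]
    rintro _ ⟨x, rfl⟩
    rw [pointOfClosedPoint_apply]
    exact hbU
  let z' := IsOpenImmersion.lift hU.fromSpec z hzU
  let φ := Spec.preimage z'
  let _ : Algebra Γ(B, U) 𝕜 := φ.hom.toAlgebra
  have hφ : Spec.map (CommRingCat.ofHom (algebraMap Γ(B, U) 𝕜)) = z' := Spec.map_preimage z'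
  have hz : Spec.map (CommRingCat.ofHom (algebraMap Γ(B, U) 𝕜)) ≫ hU.fromSpec = z := by
    rw [hφ, IsOpenImmersion.lift_fac]
  refine ⟨inferInstance, fun c ↦ ?_, fun a ha h0 ↦ ?_, ?_⟩
  · let r := Spec.preimage (hU.fromSpec ≫ pB)
    have hr : r ≫ CommRingCat.ofHom (algebraMap Γ(B, U) 𝕜) = 𝟙 _ := by
      apply Spec.map_injective
      rw [Spec.map_comp, Spec.map_preimage, ← Category.assoc, hz, pointOfClosedPoint_comp, Spec.map_id]
    exact ⟨r c, ConcreteCategory.congr_hom hr c⟩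
  · let y : Spec (.of 𝕜) := IsLocalRing.closedPoint 𝕜
    have h1 : z' y ∈ hU.fromSpec ⁻¹ᵁ B.basicOpen a := by
      change hU.fromSpec (z' y) ∈ B.basicOpen a
      rw [← Scheme.Hom.comp_apply, IsOpenImmersion.lift_fac, pointOfClosedPoint_apply]
      exact ha
    rw [hU.fromSpec_preimage_basicOpen, ← hφ] at h1
    have h2 : algebraMap Γ(B, U) 𝕜 a ∉ y.asIdeal := h1
    exact h2 (h0 ▸ y.asIdeal.zero_mem)
  · rw [hz]
    let e := residueFieldIsoBase pB b hb
    have h1 : IsPullback (f.fiberι b) (f.fiberToSpecResidueField b) f (B.fromSpecResidueField b) :=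
      .of_hasPullback _ _
    have he : Spec.map e.inv = B.fromSpecResidueField b ≫ pB := SpecMap_residueFieldIsoBase_inv pB b hb
    refine h1.of_iso (Iso.refl _) (Iso.refl _) (Scheme.Spec.mapIso e.symm.op.symm).symm (Iso.refl _) ?_ ?_ ?_ ?_
    · simp
    · simp only [Iso.refl_hom, Category.id_comp]
      change _ ≫ Spec.map e.inv = _
      rw [he, ← Scheme.Hom.fiber_fac_assoc, hf]
    · simp
    · simp only [Iso.refl_hom, Category.comp_id]
      change _ = Spec.map e.inv ≫ Spec.map e.hom ≫ _
      rw [← Spec.map_comp_assoc, Iso.hom_inv_id, Spec.map_id, Category.id_comp]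

/-- A connected space is nonempty, so some point lies over the generic point of `B`, and the generic
point of `X` specializes to it. -/
lemma apply_genericPoint_of_geometricallyConnected {X B : Scheme.{u}} (f : X ⟶ B) [IsIntegral X]
    [IsIntegral B] [SmoothOfRelativeDimension 1 (f.fiberToSpecResidueField (genericPoint B))]
    [GeometricallyConnected (f.fiberToSpecResidueField (genericPoint B))] :
    f (genericPoint X) = genericPoint B := by
  have h1 : IsPullback (f.fiberι (genericPoint B)) (f.fiberToSpecResidueField (genericPoint B)) f
    (B.fromSpecResidueField (genericPoint B)) := .of_hasPullback _ _
  have h2 := (connectedSpace_and_smooth_of_isPullback f (genericPoint B)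
    (K := B.residueField (genericPoint B)) (B.fromSpecResidueField (genericPoint B)) (fun y ↦ by
      have : B.fromSpecResidueField (genericPoint B) y ∈ Set.range (B.fromSpecResidueField (genericPoint B)) :=
        ⟨y, rfl⟩
      rwa [Scheme.range_fromSpecResidueField] at this) _ _ h1).1
  obtain ⟨x⟩ := h2.toNonempty
  have h3 : f.fiberι (genericPoint B) x ∈ f ⁻¹' {genericPoint B} :=
    f.range_fiberι (genericPoint B) ▸ ⟨x, rfl⟩
  exact genericPoint_of_apply_eq f h3

/-- The function fields of the general fibres of `f` have no transcendental elements of degree at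
most `γ`. -/
theorem exists_forall_lt_finrank {𝕜 : Type u} [Field 𝕜] [IsAlgClosed 𝕜] {X B : Scheme.{u}}
    [X.Over (Spec (.of 𝕜))] [B.Over (Spec (.of 𝕜))] [IsIntegral X] [IsIntegral B]
    [LocallyOfFiniteType (X ↘ Spec (.of 𝕜))] [LocallyOfFiniteType (B ↘ Spec (.of 𝕜))] (f : X ⟶ B)
    [IsProper f] [SmoothOfRelativeDimension 1 (f.fiberToSpecResidueField (genericPoint B))]
    [GeometricallyConnected (f.fiberToSpecResidueField (genericPoint B))]
    (hf : f ≫ (B ↘ Spec (.of 𝕜)) = X ↘ Spec (.of 𝕜)) {γ : ℕ} (hγ : 2 ≤ γ) {q : ℕ} {L : X.Modules}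
    (hL : IsLineBundle L) (φ : L ⟶ sheafOfForms (X ↘ Spec (.of 𝕜)) q) [Mono φ] (O : X.Opens)
    (hO : (O : Set X).Nonempty) (hsep : SeparatesPointsOn L γ O) :
    ∃ V : B.Opens, (V : Set B).Nonempty ∧ ∀ b ∈ V, IsClosed {b} →
      let _ : (f.fiber b).Over (Spec (.of 𝕜)) := ⟨f.fiberι b ≫ (X ↘ Spec (.of 𝕜))⟩
      ∃ hC : IsIntegralAlgebraicCurve (f.fiber b ↘ Spec (.of 𝕜)), let _ := hC.isIntegral
        ∀ x : (f.fiber b).functionField, Transcendental 𝕜 x →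
          FiniteDimensional (IntermediateField.adjoin 𝕜 {x}) (f.fiber b).functionField →
          γ < Module.finrank (IntermediateField.adjoin 𝕜 {x}) (f.fiber b).functionField := by
  classical
  have : IsLocallyNoetherian B := LocallyOfFiniteType.isLocallyNoetherian (B ↘ Spec (.of 𝕜))
  have hfg := apply_genericPoint_of_geometricallyConnected f
  obtain ⟨U, hU, hηU, -⟩ := exists_isAffineOpen_mem_and_subset (x := genericPoint B)
    (U := ⊤) trivial
  have : Nonempty U := ⟨⟨_, hηU⟩⟩
  have : Nonempty (f ⁻¹ᵁ U) := ⟨⟨genericPoint X, show f (genericPoint X) ∈ U from hfg ▸ hηU⟩⟩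
  obtain ⟨D, W₀, _, t₀, g, h, a₀, S, hD, hDt, hW₀, hh, hW₀O, hg, ha₀, hS, hcov, hreg⟩ :=
    exists_regular_products f hf hfg hU hL φ O hO
  let T := insert W₀ S
  have hT (W) (hW : W ∈ T) : ∃ t, IsChart f U W t := by
    rcases Finset.mem_insert.mp hW with rfl | hW
    exacts [⟨_, hW₀⟩, hS W hW]
  -- A chart inside each pairwise intersection. Its fibre is nonempty for general `b`, so the pieces
  -- of the fibre meet.
  have hM (p : X.Opens × X.Opens) : ∃ M : X.Opens, p.1 ∈ T → p.2 ∈ T →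
      (∃ t, IsChart f U M t) ∧ M ≤ p.1 ⊓ p.2 := by
    by_cases hp : p.1 ∈ T ∧ p.2 ∈ T
    · obtain ⟨_, h1⟩ := hT _ hp.1
      obtain ⟨_, h2⟩ := hT _ hp.2
      have := h1.nonempty
      have := h2.nonempty
      obtain ⟨M, t, hM, -, hle⟩ := exists_isChart f hU (p.1 ⊓ p.2)
        ⟨genericPoint_mem p.1, genericPoint_mem p.2⟩ hfg
      exact ⟨M, fun _ _ ↦ ⟨⟨t, hM⟩, hle⟩⟩
    · exact ⟨⊥, fun h1 h2 ↦ absurd ⟨h1, h2⟩ hp⟩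
  choose M hM hMle using hM
  obtain ⟨a₁, ha₁, H⟩ := exists_forall_isPrime_map hU hfg (T ∪ (T ×ˢ T).image M) (by
    intro W hW
    rcases Finset.mem_union.mp hW with hW | hW
    · exact hT W hW
    · obtain ⟨p, hp, rfl⟩ := Finset.mem_image.mp hW
      exact hM p (Finset.mem_product.mp hp).1 (Finset.mem_product.mp hp).2)
  -- Where `a₀` is nonzero the charts cover the fibre; where `a₁` is nonzero the fibre of each chart
  -- is an integral curve.
  refine ⟨B.basicOpen (a₀ * a₁), ?_, fun b hb hbc ↦ ?_⟩
  · rw [Set.nonempty_iff_ne_empty]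
    exact fun h3 ↦ mul_ne_zero ha₀ ha₁ ((basicOpen_eq_bot_iff _).mp (TopologicalSpace.Opens.ext h3))
  have hb' := hb
  rw [Scheme.basicOpen_mul] at hb'
  obtain ⟨_, hk, hka, hpb⟩ := exists_isPullback_fiber hf hU (B.basicOpen_le _ hb) hbc
  let _ : (f.fiber b).Over (Spec (.of 𝕜)) := ⟨f.fiberι b ≫ (X ↘ Spec (.of 𝕜))⟩
  intro _
  have hmax : (RingHom.ker (algebraMap Γ(B, U) 𝕜)).IsMaximal := RingHom.ker_isMaximal_of_surjective _ hk
  have hone (W) (hW : W ∈ T ∪ (T ×ˢ T).image M) (e : W ≤ f ⁻¹ᵁ U) (hWa : IsAffineOpen W) :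
      IsOneDimensionalAffine (f.fiberι b ⁻¹' W) := by
    obtain ⟨h₁, h₂, h₃⟩ := H _ hmax (fun h ↦ hka a₁ hb'.2 h) W hW e
    exact isOneDimensionalAffine_preimage f hU hWa e hk hpb h₁ h₂ h₃
  have honeT (W) (hW : W ∈ T) : IsOneDimensionalAffine (f.fiberι b ⁻¹' W) := by
    obtain ⟨t, ht⟩ := hT W hW
    exact hone W (Finset.mem_union_left _ hW) ht.le ht.isAffineOpen
  have hfib (y : f.fiber b) : f (f.fiberι b y) = b := by
    have : f.fiberι b y ∈ f ⁻¹' {b} := f.range_fiberι b ▸ ⟨y, rfl⟩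
    exact this
  have hcov' (y : f.fiber b) : ∃ W ∈ S, f.fiberι b y ∈ W :=
    hcov _ (by rw [hfib]; exact hb'.1)
  have hint : IsIntegral (f.fiber b) := by
    have : Nonempty T := ⟨⟨W₀, Finset.mem_insert_self _ _⟩⟩
    refine isIntegral_of_isOneDimensionalAffine (ι := T) (fun W ↦ f.fiberι b ⁻¹' (W : X.Opens))
      (fun W ↦ honeT W W.2) (fun y ↦ ?_) fun W W' ↦ ?_
    · obtain ⟨W, hW, hy⟩ := hcov' y
      exact ⟨⟨W, Finset.mem_insert_of_mem hW⟩, hy⟩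
    · obtain ⟨t, ht⟩ := hM (W, W') W.2 W'.2
      have hle := hMle (W, W') W.2 W'.2
      obtain ⟨y, hy⟩ := (hone (M (W, W')) (Finset.mem_union_right _ (Finset.mem_image_of_mem _
        (Finset.mem_product.mpr ⟨W.2, W'.2⟩))) ht.le ht.isAffineOpen).isIrreducible.nonempty
      exact ⟨y, hle hy⟩
  have hprop : IsProper (f.fiber b ↘ Spec (.of 𝕜)) := MorphismProperty.of_isPullback hpb ‹IsProper f›
  have hdim : topologicalKrullDim (f.fiber b) = 1 := topologicalKrullDim_eq_one fun y ↦ by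
    obtain ⟨W, hW, hy⟩ := hcov' y
    exact ⟨_, hy, honeT W (Finset.mem_insert_of_mem hW)⟩
  refine ⟨⟨hint, inferInstance, inferInstance, inferInstance, hdim⟩, fun x hx hfin ↦ ?_⟩
  by_contra! hle
  have hcl : IsClosedImmersion (f.fiberι b) := by
    have := isClosed_singleton_iff_isClosedImmersion.mp hbc
    exact inferInstanceAs (IsClosedImmersion (pullback.fst _ _))
  have hzU (y) : (Spec.map (CommRingCat.ofHom (algebraMap Γ(B, U) 𝕜)) ≫ hU.fromSpec) y ∈ U := by
    rw [Scheme.Hom.comp_apply]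
    have : hU.fromSpec (Spec.map (CommRingCat.ofHom (algebraMap Γ(B, U) 𝕜)) y) ∈ Set.range hU.fromSpec :=
      ⟨_, rfl⟩
    rwa [hU.range_fromSpec] at this
  -- `W₀` was included in `T` so that it meets the fibre, hence contains its generic point.
  have hgen₀ : f.fiberι b (genericPoint (f.fiber b)) ∈ W₀ := by
    have h1 := honeT W₀ (Finset.mem_insert_self _ _)
    obtain ⟨y, hy⟩ := h1.isIrreducible.nonempty
    exact (((genericPoint_spec (f.fiber b)).specializes (y := y) trivial)).mem_open h1.isOpen hy
  refine false_of_separates_of_isChart hf (ι := f.fiberι b) rfl hpb.w hzU hW₀ hgen₀ D hD hDt g hh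
    ?_ hγ ?_ hx hle
  · refine hreg.imp (fun hreg y ↦ ?_) fun hreg y ↦ ?_
    · obtain ⟨W, hW, hy⟩ := hcov' y
      obtain ⟨hne, t, ht⟩ := hreg W hW
      exact ⟨W, hne, t, hy, ht⟩
    · obtain ⟨W, hW, hy⟩ := hcov' y
      obtain ⟨hne, ht⟩ := hreg W hW
      exact ⟨W, hne, hy, ht⟩
  · intro y hy hyW
    obtain ⟨s, hs⟩ := hsep y hy fun i ↦ ⟨hW₀O (hyW i).1, (hyW i).2⟩
    exact ⟨s, fun i ↦ ⟨fun hi ↦ (hg s _ (hyW i).1).mp ((hs i).1 hi),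
      fun hi ↦ not_not.mp fun h ↦ (hs i).2 hi ((hg s _ (hyW i).1).mpr h)⟩⟩

end

/-! ### Dominant morphisms and the function field of the normalization -/

noncomputable section

section
variable {𝕜 : Type u} [Field 𝕜]

lemma genericPoint_mem_of_isDominant {N P : Scheme.{u}} [IsIntegral N] (φ : N ⟶ P) [IsDominant φ]
    {U : P.Opens} (hU : (U : Set P).Nonempty) : φ (genericPoint N) ∈ U := by
  obtain ⟨n, hn⟩ := φ.denseRange.exists_mem_open U.2 hU
  exact (((genericPoint_spec N).specializes (y := n) trivial).map φ.continuous).mem_open U.2 hn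

lemma apply_genericPoint_of_isDominant {N P : Scheme.{u}} [IsIntegral N] [IsIntegral P] (φ : N ⟶ P)
    [IsDominant φ] : φ (genericPoint N) = genericPoint P :=
  (((genericPoint_spec P).specializes trivial).antisymm <| specializes_iff_forall_open.mpr
    fun U hU h ↦ genericPoint_mem_of_isDominant φ (U := ⟨U, hU⟩) ⟨_, h⟩).eq.symm

/-- A dominant morphism to a curve with an affine open subset `Spec 𝕜[x]` embeds its local ring at
the generic point into the subfield generated by one transcendental element. -/
lemma exists_transcendental_of_isDominant [IsAlgClosed 𝕜] {N P : Scheme.{u}}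
    [N.Over (Spec (.of 𝕜))] [P.Over (Spec (.of 𝕜))] [IsIntegral N] (φ : N ⟶ P)
    (hφ : φ ≫ (P ↘ Spec (.of 𝕜)) = N ↘ Spec (.of 𝕜)) [IsDominant φ] {U : P.Opens}
    (hU : IsAffineOpen U) [IsDomain Γ(P, U)] {x₀ : Γ(P, U)} (hx₀ : Algebra.adjoin 𝕜 {x₀} = ⊤)
    (hx₀' : ∀ c, x₀ ≠ algebraMap 𝕜 _ c) :
    ∃ x : N.functionField, Transcendental 𝕜 x ∧ Function.Injective (localRingToFunctionField hφ) ∧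
      ∀ o, localRingToFunctionField hφ o ∈ IntermediateField.adjoin 𝕜 {x} := by
  have hbasic (a : Γ(P, U)) (ha : a ≠ 0) : φ (genericPoint N) ∈ P.basicOpen a := by
    apply genericPoint_mem_of_isDominant
    rw [Set.nonempty_iff_ne_empty]
    intro h
    have h1 := hU.fromSpec_preimage_basicOpen a
    rw [show P.basicOpen a = ⊥ from TopologicalSpace.Opens.ext h] at h1
    exact ha (PrimeSpectrum.basicOpen_eq_bot_iff a |>.mp h1.symm).eq_zero
  have hU' : φ (genericPoint N) ∈ U := P.basicOpen_le 1 (hbasic 1 one_ne_zero)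
  let ψ := localRingToFunctionField hφ
  let γ : Γ(P, U) →ₐ[𝕜] P.presheaf.stalk (φ (genericPoint N)) :=
    { (P.presheaf.germ U _ hU').hom with commutes' := fun c ↦ germ_algebraMap_sections _ hU' c }
  have hγ (a : Γ(P, U)) (ha : a ≠ 0) : IsUnit (γ a) := (Scheme.mem_basicOpen _ _ _ hU').mp (hbasic a ha)
  have hψγ : Function.Injective (ψ.comp γ) := by
    rw [injective_iff_map_eq_zero]
    intro a ha
    by_contra h
    exact ((hγ a h).map ψ).ne_zero ha
  have hfrac (o) : ∃ a b, b ≠ 0 ∧ o * γ b = γ a := by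
    let _ := (P.presheaf.germ U _ hU').hom.toAlgebra
    have : IsLocalization.AtPrime (P.presheaf.stalk (φ (genericPoint N)))
      (hU.primeIdealOf ⟨_, hU'⟩).asIdeal := hU.isLocalization_stalk ⟨_, hU'⟩
    obtain ⟨⟨a, b⟩, h⟩ := IsLocalization.surj (hU.primeIdealOf ⟨_, hU'⟩).asIdeal.primeCompl o
    exact ⟨a, b, fun h0 ↦ b.2 (h0 ▸ Ideal.zero_mem _), h⟩
  refine ⟨ψ (γ x₀), fun halg ↦ ?_, ?_, fun o ↦ ?_⟩
  · obtain ⟨c, hc⟩ := IsAlgClosed.algebraMap_bijective_of_isIntegral (k := 𝕜)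
      (K := integralClosure 𝕜 N.functionField) |>.2 ⟨_, halg.isIntegral⟩
    refine hx₀' c (hψγ ?_)
    rw [AlgHom.commutes]
    exact (congrArg Subtype.val hc).symm
  · rw [injective_iff_map_eq_zero]
    intro o ho
    obtain ⟨a, b, hb, h⟩ := hfrac o
    have ha : a = 0 := hψγ <| by
      rw [map_zero]
      exact (congrArg ψ h).symm.trans ((map_mul ψ _ _).trans (mul_eq_zero_of_left ho _))
    rw [ha, map_zero] at h
    exact ((hγ b hb).mul_left_eq_zero).mp h
  · have hmem (a) : ψ (γ a) ∈ IntermediateField.adjoin 𝕜 {ψ (γ x₀)} := by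
      have ha : a ∈ Algebra.adjoin 𝕜 {x₀} := hx₀ ▸ Algebra.mem_top
      have h1 : ψ.comp γ a ∈ (Algebra.adjoin 𝕜 {x₀}).map (ψ.comp γ) := ⟨a, ha, rfl⟩
      rw [AlgHom.map_adjoin, Set.image_singleton] at h1
      exact IntermediateField.algebra_adjoin_le_adjoin _ _ h1
    obtain ⟨a, b, hb, h⟩ := hfrac o
    have h1 : ψ o = ψ (γ a) / ψ (γ b) := by
      rw [eq_div_iff ((hγ b hb).map ψ).ne_zero, ← map_mul, h]
    exact h1 ▸ div_mem (hmem a) (hmem b)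

/-- The function field of the normalization. -/
lemma exists_algEquiv_functionField_normalizationOf {C : Scheme.{u}} [IsIntegral C]
    [C.Over (Spec (.of 𝕜))] [(normalizationOf C).Over (Spec (.of 𝕜))]
    (h : normalizationOfHom C ≫ (C ↘ Spec (.of 𝕜)) = normalizationOf C ↘ Spec (.of 𝕜)) :
    Nonempty (C.functionField ≃ₐ[𝕜] (normalizationOf C).functionField) := by
  let i := C.fromSpecStalk (genericPoint C)
  let pt : Spec (C.presheaf.stalk (genericPoint C)) := IsLocalRing.closedPoint _
  have hi : i pt = genericPoint C := C.fromSpecStalk_closedPoint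
  have hpt : genericPoint (Spec (C.presheaf.stalk (genericPoint C))) = pt :=
    Subsingleton.elim (α := PrimeSpectrum C.functionField) _ _
  have hto : i.toNormalization pt = genericPoint i.normalization :=
    hpt ▸ apply_genericPoint_of_isDominant i.toNormalization
  have hν : i.fromNormalization (genericPoint i.normalization) = genericPoint C := by
    rw [← hto, ← Scheme.Hom.comp_apply, Scheme.Hom.toNormalization_fromNormalization, hi]
  -- The composite from the generic point to `C` is a preimmersion, hence surjective on stalks. The
  -- stalk of the normalization is a field and so embeds in the last one, and the first map is
  -- already surjective.
  have hsurj (ξ) (hξ : i.toNormalization pt = ξ) (hξ' : ξ = genericPoint i.normalization) :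
      Function.Surjective (i.fromNormalization.stalkMap ξ) := by
    have hf : IsField (i.normalization.presheaf.stalk ξ) := by
      subst hξ'
      exact Field.toIsField i.normalization.functionField
    subst hξ
    have h1 : Function.Surjective ((i.toNormalization ≫ i.fromNormalization).stalkMap pt) := by
      have : IsPreimmersion (i.toNormalization ≫ i.fromNormalization) := by
        rw [Scheme.Hom.toNormalization_fromNormalization]
        infer_instance
      exact (i.toNormalization ≫ i.fromNormalization).stalkMap_surjective pt
    rw [Scheme.Hom.stalkMap_comp] at h1
    intro o
    obtain ⟨c, hc⟩ := h1 (i.toNormalization.stalkMap pt o)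
    let := hf.toField
    exact ⟨c, (i.toNormalization.stalkMap pt).hom.injective hc⟩
  have key (y : C) (hy : y = genericPoint C) (α : C.presheaf.stalk y →ₐ[𝕜] (normalizationOf C).functionField)
      (hα : Function.Surjective α) : Nonempty (C.functionField ≃ₐ[𝕜] (normalizationOf C).functionField) := by
    subst hy
    exact ⟨AlgEquiv.ofBijective α ⟨RingHom.injective (R := C.functionField) α.toRingHom, hα⟩⟩
  exact key (normalizationOfHom C (genericPoint (normalizationOf C))) hν (localRingToFunctionField h) (hsurj _ hto rfl)

end

end

/-! ### The standard affine chart of the projective line -/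

noncomputable section

section
open MvPolynomial HomogeneousLocalization
variable (𝕜 : Type u) [Field 𝕜]

attribute [local instance] MvPolynomial.gradedAlgebra

lemma X_mem_homogeneousSubmodule_one (i : Fin 2) :
    (X i : MvPolynomial (Fin 2) 𝕜) ∈ homogeneousSubmodule (Fin 2) 𝕜 1 :=
  (mem_homogeneousSubmodule _ _).mpr (isHomogeneous_X 𝕜 i)

/-- The degree-zero part of `𝕜[T₀, T₁][1/T₀]`. -/
abbrev StandardChart : Type u := Away (homogeneousSubmodule (Fin 2) 𝕜) (X 0)

/-- The inclusion of the constants. -/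
abbrev StandardChart.C : 𝕜 →+* StandardChart 𝕜 :=
  (fromZeroRingHom (homogeneousSubmodule (Fin 2) 𝕜) _).comp
    (algebraMap 𝕜 (homogeneousSubmodule (Fin 2) 𝕜 0))

/-- The coordinate `T₁ / T₀`. -/
def StandardChart.coordinate : StandardChart 𝕜 :=
  Away.mk (homogeneousSubmodule (Fin 2) 𝕜) (d := 1) (X_mem_homogeneousSubmodule_one 𝕜 0) 1 (X 1)
    ((one_smul ℕ 1).symm ▸ X_mem_homogeneousSubmodule_one 𝕜 1)

lemma StandardChart.isDomain : IsDomain (StandardChart 𝕜) := by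
  have : IsDomain (Localization.Away (X 0 : MvPolynomial (Fin 2) 𝕜)) :=
    IsLocalization.isDomain_localization (powers_le_nonZeroDivisors_of_noZeroDivisors (X_ne_zero 0))
  exact (val_injective _).isDomain (algebraMap (StandardChart 𝕜) (Localization _))

lemma StandardChart.coordinate_ne (c : 𝕜) :
    StandardChart.coordinate 𝕜 ≠ StandardChart.C 𝕜 c := by
  intro h
  have h1 := congrArg HomogeneousLocalization.val h
  have h2 : (StandardChart.C 𝕜 c).val = algebraMap (MvPolynomial (Fin 2) 𝕜) _ (MvPolynomial.C c) := rfl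
  rw [StandardChart.coordinate, Away.val_mk, h2, ← Localization.mk_one_eq_algebraMap,
    Localization.mk_eq_mk_iff, Localization.r_iff_exists] at h1
  obtain ⟨⟨_, n, rfl⟩, h1⟩ := h1
  have h3 := mul_left_cancel₀ (pow_ne_zero n (X_ne_zero 0)) h1
  simpa using congrArg (MvPolynomial.eval ![0, 1]) h3

/-- Monomials of degree `n` divided by the `n`-th power of `X 0` are powers of the coordinate, and
together with the constants they span the chart. -/
lemma StandardChart.eq_top_of_mem {S : Subring (StandardChart 𝕜)} (hC : ∀ c, StandardChart.C 𝕜 c ∈ S)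
    (hx : StandardChart.coordinate 𝕜 ∈ S) : S = ⊤ := by
  have h0 (r : homogeneousSubmodule (Fin 2) 𝕜 0) : ∃ c, r = algebraMap 𝕜 _ c := by
    obtain ⟨r, hr⟩ := r
    have hr' := hr
    rw [homogeneousSubmodule_zero] at hr'
    obtain ⟨c, hc⟩ := Submodule.mem_one.mp hr'
    exact ⟨c, Subtype.ext hc.symm⟩
  rw [eq_top_iff]
  intro a _
  have ha := (Away.span_mk_prod_pow_eq_top (𝒜 := homogeneousSubmodule (Fin 2) 𝕜) (f := X 0) (d := 1)
    (X_mem_homogeneousSubmodule_one 𝕜 0) (X : Fin 2 → _) (by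
      rw [eq_top_iff]
      intro p _
      have hp : p ∈ Algebra.adjoin 𝕜 (Set.range X) := MvPolynomial.adjoin_range_X (R := 𝕜) ▸ Algebra.mem_top
      induction hp using Algebra.adjoin_induction with
      | mem x hx => exact Algebra.subset_adjoin hx
      | algebraMap r => exact Subalgebra.algebraMap_mem _ (algebraMap 𝕜 (homogeneousSubmodule (Fin 2) 𝕜 0) r)
      | add x y _ _ hx hy => exact add_mem (hx trivial) (hy trivial)
      | mul x y _ _ hx hy => exact mul_mem (hx trivial) (hy trivial))
    (fun _ ↦ 1) (fun i ↦ X_mem_homogeneousSubmodule_one 𝕜 i)).ge (Submodule.mem_top (x := a))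
  induction ha using Submodule.span_induction with
  | zero => exact S.zero_mem
  | add x y _ _ hx hy => exact S.add_mem (hx trivial) (hy trivial)
  | smul r x _ hx =>
    rw [Algebra.smul_def]
    obtain ⟨c, rfl⟩ := h0 r
    exact S.mul_mem (hC c) (hx trivial)
  | mem x hx' =>
    obtain ⟨n, e, he, rfl⟩ := hx'
    have : Away.mk (homogeneousSubmodule (Fin 2) 𝕜) (d := 1) (X_mem_homogeneousSubmodule_one 𝕜 0) n
        (∏ i, X i ^ e i) (he ▸ SetLike.prod_pow_mem_graded _ _ _ _ fun i _ ↦ X_mem_homogeneousSubmodule_one 𝕜 i) =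
          StandardChart.coordinate 𝕜 ^ e 1 := by
      apply val_injective
      rw [val_pow, StandardChart.coordinate, Away.val_mk, Away.val_mk, Localization.mk_pow,
        Localization.mk_eq_mk_iff, Localization.r_iff_exists]
      refine ⟨1, ?_⟩
      simp only [Fin.sum_univ_two, smul_eq_mul, mul_one] at he
      simp only [OneMemClass.coe_one, one_mul, Fin.prod_univ_two, SubmonoidClass.mk_pow, pow_one, ← he]
      ring
    rw [this]
    exact S.pow_mem hx _

lemma exists_isAffineOpen_projectiveLine [(projectiveLine 𝕜).Over (Spec (.of 𝕜))]
    (h : (projectiveLine 𝕜 ↘ Spec (.of 𝕜)) = projectiveLineToSpec 𝕜) :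
    ∃ (U : (projectiveLine 𝕜).Opens) (x : Γ(projectiveLine 𝕜, U)), IsAffineOpen U ∧
      IsDomain Γ(projectiveLine 𝕜, U) ∧ Algebra.adjoin 𝕜 {x} = ⊤ ∧ ∀ c, x ≠ algebraMap 𝕜 _ c := by
  let j : Spec (.of (StandardChart 𝕜)) ⟶ projectiveLine 𝕜 :=
    Proj.awayι (homogeneousSubmodule (Fin 2) 𝕜) (X 0) (m := 1) (X_mem_homogeneousSubmodule_one 𝕜 0) one_pos
  have hjo : IsOpenImmersion j := inferInstanceAs (IsOpenImmersion
    (Proj.awayι (homogeneousSubmodule (Fin 2) 𝕜) (X 0) (X_mem_homogeneousSubmodule_one 𝕜 0) one_pos))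
  have hj : j ≫ projectiveLineToSpec 𝕜 = Spec.map (CommRingCat.ofHom (StandardChart.C 𝕜)) := by
    rw [projectiveLineToSpec]
    refine (Category.assoc _ _ _).symm.trans ((congrArg (· ≫ _) (Proj.awayι_toSpecZero
      (homogeneousSubmodule (Fin 2) 𝕜) (X 0) (X_mem_homogeneousSubmodule_one 𝕜 0) one_pos)).trans ?_)
    exact (Spec.map_comp _ _).symm
  let U := j ''ᵁ ⊤
  let i : Γ(projectiveLine 𝕜, U) ≅ .of (StandardChart 𝕜) := j.appIso ⊤ ≪≫ Scheme.ΓSpecIso _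
  let σ := i.commRingCatIsoToRingEquiv
  have hσ (c : 𝕜) : σ (algebraMap 𝕜 _ c) = StandardChart.C 𝕜 c := by
    have h1 : (projectiveLine 𝕜 ↘ Spec (.of 𝕜)).appLE ⊤ U le_top ≫ i.hom =
        (Scheme.ΓSpecIso (.of 𝕜)).hom ≫ CommRingCat.ofHom (StandardChart.C 𝕜) := by
      have h2 := Scheme.Hom.appLE_comp_appLE j (projectiveLine 𝕜 ↘ Spec (.of 𝕜)) (U := ⊤) (V := U)
        (W := ⊤) le_top (j.preimage_image_eq ⊤).ge
      have h3 : j ≫ (projectiveLine 𝕜 ↘ Spec (.of 𝕜)) = _ := (congrArg (j ≫ ·) h).trans hj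
      simp only [h3] at h2
      have h4 : (Spec.map (CommRingCat.ofHom (StandardChart.C 𝕜))).appLE ⊤ ⊤ le_top =
        (Spec.map (CommRingCat.ofHom (StandardChart.C 𝕜))).appTop := Scheme.Hom.appLE_eq_app _
      rw [← Scheme.ΓSpecIso_naturality, ← h4, ← h2, Category.assoc, ← j.appIso_hom']
      rfl
    have h2 := ConcreteCategory.congr_hom h1 ((Scheme.ΓSpecIso (.of 𝕜)).inv c)
    refine h2.trans (congrArg (StandardChart.C 𝕜) ?_)
    exact ConcreteCategory.congr_hom (Scheme.ΓSpecIso (.of 𝕜)).inv_hom_id c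
  refine ⟨U, σ.symm (StandardChart.coordinate 𝕜), (isAffineOpen_top _).image_of_isOpenImmersion j,
    ?_, ?_, fun c hc ↦ StandardChart.coordinate_ne 𝕜 c ?_⟩
  · have := StandardChart.isDomain 𝕜
    exact σ.injective.isDomain σ.toRingHom
  · rw [eq_top_iff]
    intro a _
    have h1 := StandardChart.eq_top_of_mem 𝕜
      (S := (Algebra.adjoin 𝕜 {σ.symm (StandardChart.coordinate 𝕜)}).toSubring.map σ.toRingHom)
      (fun c ↦ ⟨_, Subalgebra.algebraMap_mem _ c, hσ c⟩)
      ⟨_, Algebra.subset_adjoin rfl, σ.apply_symm_apply _⟩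
    obtain ⟨b, hb, hab⟩ := h1.ge (Subring.mem_top (σ a))
    exact σ.injective hab ▸ hb
  · rw [← hσ, ← hc, σ.apply_symm_apply]

end

end

/-! ### From degrees of function fields to gonality -/

noncomputable section

/-- Because `O` embeds in `k(x)`, the degree over `k(x)` is at most the rank over `O`. This
inequality suffices, so `O` need not be identified with `k(x)`. -/
lemma rank_adjoin_le_of_injective {k K : Type*} {O K' : Type v} [Field k] [Field K] [Algebra k K]
    [CommRing O] [Field K'] [Algebra O K'] [Algebra k K'] (e : K' ≃ₐ[k] K) (x : K')
    (hinj : Function.Injective (algebraMap O K'))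
    (hmem : ∀ o, algebraMap O K' o ∈ IntermediateField.adjoin k {x}) :
    Cardinal.lift.{v} (Module.rank (IntermediateField.adjoin k {e x}) K) ≤
      Cardinal.lift (Module.rank O K') := by
  have hmem' (o) : e (algebraMap O K' o) ∈ IntermediateField.adjoin k {e x} := by
    have h : e (algebraMap O K' o) ∈ (IntermediateField.adjoin k {x}).map e.toAlgHom :=
      ⟨_, hmem o, rfl⟩
    rwa [IntermediateField.adjoin_map, Set.image_singleton] at h
  refine lift_rank_le_of_injective_injective (fun o ↦ ⟨_, hmem' o⟩) e.symm.toAddMonoidHom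
    (fun o ho ↦ ?_) e.symm.injective fun o m ↦ ?_
  · have h := congrArg Subtype.val ho
    exact hinj (by simpa using h)
  · change e.symm (e (algebraMap O K' o) * m) = _
    rw [map_mul, e.symm_apply_apply, Algebra.smul_def]
    rfl

/-- A dominant morphism of degree at most `γ` embeds the function field of the line into a subfield
generated by one transcendental element. The function field has degree at most `γ` over this
subfield, and it is isomorphic to the function field of `C`. -/
theorem lt_gonality {𝕜 : Type u} [Field 𝕜] [IsAlgClosed 𝕜] {C : Scheme.{u}} [C.Over (Spec (.of 𝕜))]
    (hC : IsIntegralAlgebraicCurve (C ↘ Spec (.of 𝕜))) {γ : ℕ} [IsIntegral C]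
    (H : ∀ x : C.functionField, Transcendental 𝕜 x →
      FiniteDimensional (IntermediateField.adjoin 𝕜 {x}) C.functionField →
      γ < Module.finrank (IntermediateField.adjoin 𝕜 {x}) C.functionField) :
    ((γ + 1 : ℕ) : ℕ∞) ≤ gonality (C ↘ Spec (.of 𝕜)) hC := by
  refine le_iInf fun φ ↦ le_iInf fun hφ ↦ le_iInf fun _ ↦ ?_
  let _ : (normalizationOf C).Over (Spec (.of 𝕜)) := ⟨normalizationOfHom C ≫ (C ↘ Spec (.of 𝕜))⟩
  let _ : (projectiveLine 𝕜).Over (Spec (.of 𝕜)) := ⟨projectiveLineToSpec 𝕜⟩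
  obtain ⟨U, x₀, hU, _, hx₀, hx₀'⟩ := exists_isAffineOpen_projectiveLine 𝕜 rfl
  obtain ⟨x, hx, hinj, hmem⟩ := exists_transcendental_of_isDominant φ hφ hU hx₀ hx₀'
  obtain ⟨e⟩ := exists_algEquiv_functionField_normalizationOf (𝕜 := 𝕜) (C := C) rfl
  let := (φ.stalkMap (genericPoint (normalizationOf C))).hom.toAlgebra
  by_contra! h
  have h1 : Module.rank ((projectiveLine 𝕜).presheaf.stalk (φ (genericPoint (normalizationOf C))))
      (normalizationOf C).functionField ≤ γ :=
    Cardinal.toENat_le_natCast.mp (Order.le_of_lt_add_one (by exact_mod_cast h))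
  have h2 := (Cardinal.lift_le.mp (rank_adjoin_le_of_injective e.symm x hinj hmem)).trans h1
  have h3 : FiniteDimensional (IntermediateField.adjoin 𝕜 {e.symm x}) C.functionField :=
    Module.rank_lt_aleph0_iff.mp (h2.trans_lt (Cardinal.natCast_lt_aleph0))
  have h4 : Transcendental 𝕜 (e.symm x) := fun h ↦ hx (by
    simpa using h.algHom e.toAlgHom)
  exact (H _ h4 h3).not_ge (Module.finrank_le_of_rank_le h2)

end

theorem mainTheorem10 {𝕜 : Type u} [Field 𝕜] [IsAlgClosed 𝕜] {X B : Scheme.{u}}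
    (pX : X ⟶ Spec (.of 𝕜)) (pB : B ⟶ Spec (.of 𝕜))
    [IsIntegral X] [IsSeparated pX] [LocallyOfFiniteType pX] [QuasiCompact pX]
    [IsIntegral B] [IsSeparated pB] [LocallyOfFiniteType pB] [QuasiCompact pB]
    (hX : IsNormalScheme X) (hB : IsNormalScheme B)
    (f : X ⟶ B) (hf : f ≫ pB = pX) [IsProper f]
    [SmoothOfRelativeDimension 1 (f.fiberToSpecResidueField (genericPoint B))]
    [GeometricallyConnected (f.fiberToSpecResidueField (genericPoint B))]
    (γ : ℕ) (hγ : 2 ≤ γ) (n : ℕ) (hn : topologicalKrullDim X = n)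
    (q : ℕ) (hq1 : 1 ≤ q) (hqn : q ≤ n)
    (L : X.Modules) (hL : IsLineBundle L) (φ : L ⟶ sheafOfForms pX q) [Mono φ]
    (U : X.Opens) (hU : (U : Set X).Nonempty) (hsep : SeparatesPointsOn L γ U) :
    ∃ V : B.Opens, (V : Set B).Nonempty ∧ ∀ b ∈ V, IsClosed {b} →
      ∃ hC : IsIntegralAlgebraicCurve (f.fiberι b ≫ pX),
        ((γ + 1 : ℕ) : ℕ∞) ≤ gonality (f.fiberι b ≫ pX) hC := by
  let _ : X.Over (Spec (.of 𝕜)) := ⟨pX⟩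
  let _ : B.Over (Spec (.of 𝕜)) := ⟨pB⟩
  have : LocallyOfFiniteType (X ↘ Spec (.of 𝕜)) := ‹LocallyOfFiniteType pX›
  have : LocallyOfFiniteType (B ↘ Spec (.of 𝕜)) := ‹LocallyOfFiniteType pB›
  have hf' : f ≫ (B ↘ Spec (.of 𝕜)) = X ↘ Spec (.of 𝕜) := hf
  let φ' : L ⟶ sheafOfForms (X ↘ Spec (.of 𝕜)) q := φ
  have : Mono φ' := ‹Mono φ›
  obtain ⟨V, hV, H⟩ := exists_forall_lt_finrank f hf' hγ hL φ' U hU hsep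
  refine ⟨V, hV, fun b hb hbc ↦ ?_⟩
  obtain ⟨hC, h⟩ := H b hb hbc
  let _ : (f.fiber b).Over (Spec (.of 𝕜)) := ⟨f.fiberι b ≫ pX⟩
  have := hC.isIntegral
  exact ⟨hC, lt_gonality hC h⟩
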